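/- **Setting.** Let $G=(V,E)$ be an undirected graph with $n$ vertices, without multiple edges, self loops allowed. For $B\subseteq V$ let $G\nabla B$ be $G$ with the self loops at the vertices of $B$ toggled, let $G[S]$ be the subgraph induced by $S$, and let $\operatorname{rk}$ and $\operatorname{n}$ denote rank and nullity of the adjacency matrix over $GF(2)$. Courcelle's multivariate interlace polynomial is $$C(G)=\sum_{A,B\subseteq V,\ A\cap B=\emptyset}\ \prod_{a\in A}x_a\prod_{b\in B}y_b\; u^{\operatorname{rk}((G\nabla B)[A\cup B])}\,v^{\operatorname{n}((G\nabla B)[A\cup B])}.$$ A nice tree decomposition of $G$ is a tree decomposition $(\{X_i\}_{i\in I},T)$ whose tree is rooted, with empty root bag, such that each node $i$ is a leaf node (no children, $X_i=\emptyset$), a join node (two children $j_1,j_2$ with $X_i=X_{j_1}=X_{j_2}$), an introduce node (one child $j$, $X_i=X_j\cup\{a\}$, $a\notin X_j$) or a forget node (one child $j$, $X_j=X_i\cup\{a\}$, $a\notin X_i$). Its width is $\max_i|X_i|-1$. **The algorithm.** A scenario of a vertex set $U$ is a pair $s=(s_1,s_2)$ of a linearly independent set $s_1\subseteq\{0,1\}^U$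 (over $GF(2)$) and a symmetric $U\times U$ matrix $s_2$ over $GF(2)$. Fix a bottom-up traversal of the nodes (children before parents); order the vertices in the order in which they are forgotten, and order vectors lexicographically. For a set $S$ of vectors let $\min(S)$ be the basis of its span obtained by running through $S$ in increasing order and keeping each vector that is not in the span of the smaller ones. Let $M_H(U)$ be the adjacency matrix of $H[U]$. * Join of scenarios $s,t$ of $U$: $s\star_H t=\bigl(\min(s_1\cup t_1),\ s_2+t_2-M_H(U)\bigr)$. * Introduce $a$, giving a scenario of $U\ni a$: $s_1$ gets zero components at $a$, and $s_2$ gets the row and column $a$ of $M_H(U)$. * Ignore $a\in U$: delete the $a$-components in $s_1$ and take $\min$; delete row and column $a$ of $s_2$. * Forget $a\in U$; this yields a scenario $s\ominus a$ of $U\setminus\{a\}$ and a number $r=r(s,a)\in\{0,1,2\}$. (1) If some $c\in s_1$ has $c_a=1$, let $w$ be the minimum such vector; replace each $c\in s_1\setminus\{w\}$ by $c+c_a w$, and $m=s_2$ by the matrix with entries $m_{yx}+w_xm_{ya}+w_ym_{ax}+w_xw_ym_{aa}$, then delete all components, rows and columns $a$; $r=2$. (2) Otherwise, if $(s_2)_{aa}=1$,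 replace the entries $m_{yx}$ ($x,y\ne a$) of $m=s_2$ by $m_{yx}+m_{ax}m_{ya}$, clear all other entries of row and column $a$ except $(a,a)$, and continue as in (3), but with $r=1$. (3) Otherwise delete the components $a$ in $s_1$, add column $a$ of $s_2$ (without its entry $a$) to this set if it is not in its span, delete row and column $a$ of $s_2$; $r=0$. The algorithm visits the nodes $i$ along the traversal and fills a table $S(i,D,s)$ for all $D\subseteq X_i$ and all scenarios $s$ of $X_i$. At a leaf, $S(i,\emptyset,(\emptyset,0))\leftarrow1$. At other nodes all entries are first set to $0$. At a join node, for all pairs $s',s''$ of scenarios of $X_i$, $S(j_1,D,s')\cdot S(j_2,D,s'')$ is added to $S(i,D,s'\star_{G\nabla D}s'')$. At an introduce node, for each scenario $s'$ of $X_j$, $S(i,D,s)\leftarrow S(j,D\setminus\{a\},s')$, where $s$ is obtained from $s'$ by introducing $a$ with respect to $H=G\nabla D$. At a forget node, for each scenario $s'$ of $X_j$: $S(j,D,s')$ is added to $S(i,D,s)$, where $s$ is $s'$ with $a$ ignored; and, with $r=r(s',a)$, both $x_au^{r}v^{1-r}S(j,D,s')$ and $y_au^{r}v^{1-r}S(j,D\cup\{a\},s')$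 are added to $S(i,D,s'\ominus a)$. The output is $S(\mathrm{root},\emptyset,(\emptyset,0))$. Arithmetic operations are additions, multiplications and inversions of numbers (powers are computed by these); each of them is counted. **Theorem.** There is an absolute constant $B$, and for each $c$ there is a constant $K$, such that the following holds for every graph $G$ with $n$ vertices, every nice tree decomposition of $G$ of width $k$ with at most $cn$ nodes, and every bottom-up traversal of it. 1. For all elements $x_a,y_a$ ($a\in V$), $u$, $v$ of a field with $v\neq0$, the output of the algorithm is the value of $C(G)$ at $((x_a)_{a\in V},(y_a)_{a\in V},u,v)$, and the algorithm uses at most $2^{3k^2+K(k+1)}\cdot n$ arithmetic operations, that is, $2^{3k^2+O(k)}\cdot n$. 2. If the numbers are rational, $v\ne0$, and $u$, $v$ and all $x_a,y_a$ have bit length at most $\ell$, then all inputs and results of the arithmetic operations carried out have bit length at most $B\,\ell\,n$. Here the bit length of a rational number is the number of binary digits of its numerator plus that of its denominator, in lowest terms. -/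

import Mathlib

namespace Interlace

/-! ### Graphs with loops and the multivariate interlace polynomial -/

/-- An undirected graph without multiple edges, self loops allowed. -/
structure LoopGraph (V : Type*) where
  Adj : V → V → Prop
  symm : ∀ a b, Adj a b → Adj b a

namespace LoopGraph

variable {V : Type*}

/-- The graph with the self loops at the vertices of `A` toggled. -/
def toggle (G : LoopGraph V) (A : Finset V) : LoopGraph V where
  Adj a b := (a = b ∧ a ∈ A ∧ ¬ G.Adj a b) ∨ (¬ (a = b ∧ a ∈ A) ∧ G.Adj a b)
  symm := by
    rintro a b (⟨rfl, h⟩ | ⟨h, h'⟩)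
    · exact Or.inl ⟨rfl, h⟩
    · refine Or.inr ⟨?_, G.symm _ _ h'⟩
      rintro ⟨rfl, hb⟩
      exact h ⟨rfl, hb⟩

open Classical in
/-- The adjacency matrix, over the field with two elements, of the subgraph induced by `S`. -/
noncomputable def inducedMatrix (G : LoopGraph V) (S : Finset V) : Matrix S S (ZMod 2) :=
  fun a b => if G.Adj a b then 1 else 0

/-- The rank of the adjacency matrix of the subgraph induced by `S`. -/
noncomputable def rk (G : LoopGraph V) (S : Finset V) : ℕ := (G.inducedMatrix S).rank

/-- The nullity of the adjacency matrix of the subgraph induced by `S`. -/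
noncomputable def nullity (G : LoopGraph V) (S : Finset V) : ℕ := S.card - G.rk S

end LoopGraph

/-- The indeterminates `x_a`, `y_a` (one for each vertex `a`), `u` and `v`. -/
inductive Indet (V : Type*)
  | x (a : V)
  | y (a : V)
  | u
  | v

/-- The multivariate interlace polynomial of `G`. -/
noncomputable def interlacePolynomial {V : Type*} [Fintype V] [DecidableEq V]
    (G : LoopGraph V) : MvPolynomial (Indet V) ℤ :=
  ∑ p : Finset V × Finset V with Disjoint p.1 p.2,
    (∏ a ∈ p.1, MvPolynomial.X (Indet.x a)) * (∏ a ∈ p.2, MvPolynomial.X (Indet.y a))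
      * MvPolynomial.X Indet.u ^ (G.toggle p.2).rk (p.1 ∪ p.2)
      * MvPolynomial.X Indet.v ^ (G.toggle p.2).nullity (p.1 ∪ p.2)

/-- The assignment of values to the indeterminates that is given by an evaluation point. -/
def evalPoint {V F : Type*} (x y : V → F) (u v : F) : Indet V → F
  | .x a => x a
  | .y a => y a
  | .u => u
  | .v => v

/-! ### Nice tree decompositions -/

/-- A tree decomposition of `G` with set of nodes `I`. -/
structure TreeDecomposition {V : Type*} (G : LoopGraph V) (I : Type*) where
  tree : SimpleGraph I
  isTree : tree.IsTree
  bag : I → Finset V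
  vertex_mem : ∀ a, ∃ i, a ∈ bag i
  edge_mem : ∀ a b, G.Adj a b → ∃ i, a ∈ bag i ∧ b ∈ bag i
  connected : ∀ a, (tree.induce {i | a ∈ bag i}).Connected

/-- The width: the maximum bag size minus one. -/
def TreeDecomposition.width {V I : Type*} [Fintype I] {G : LoopGraph V}
    (T : TreeDecomposition G I) : ℤ :=
  ((Finset.univ.sup fun i => (T.bag i).card : ℕ) : ℤ) - 1

/-- The type of a node of a nice tree decomposition, together with its children and with the
vertex that is introduced or forgotten. -/
inductive NodeKind (V I : Type*)
  | leaf
  | join (j₁ j₂ : I)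
  | introduce (j : I) (a : V)
  | forget (j : I) (a : V)

/-- `NodeKind.Valid children bag i κ`: the node `i` is of the type `κ`. -/
def NodeKind.Valid {V I : Type*} [DecidableEq V] (children : I → Set I) (bag : I → Finset V)
    (i : I) : NodeKind V I → Prop
  | .leaf => children i = ∅ ∧ bag i = ∅
  | .join j₁ j₂ => j₁ ≠ j₂ ∧ children i = {j₁, j₂} ∧ bag i = bag j₁ ∧ bag i = bag j₂
  | .introduce j a => children i = {j} ∧ a ∉ bag j ∧ bag i = insert a (bag j)
  | .forget j a => children i = {j} ∧ a ∉ bag i ∧ bag j = insert a (bag i)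

/-- The children of the node `i` when the tree is rooted at `root`: the neighbours of `i` that are
one step farther away from `root`. -/
def TreeDecomposition.childSet {V I : Type*} {G : LoopGraph V} (T : TreeDecomposition G I)
    (root i : I) : Set I :=
  {j | T.tree.Adj i j ∧ T.tree.dist root j = T.tree.dist root i + 1}

/-- A nice tree decomposition: the tree is rooted at `root`, the bag of the root is empty, and
each node is a leaf, a join, an introduce or a forget node. -/
structure NiceTreeDecomposition {V : Type*} [DecidableEq V] (G : LoopGraph V) (I : Type*)
    extends TreeDecomposition G I where
  root : I
  bag_root : bag root = ∅
  kind : I → NodeKind V I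
  kind_valid : ∀ i, (kind i).Valid (toTreeDecomposition.childSet root) bag i

namespace NiceTreeDecomposition

variable {V I : Type*} [DecidableEq V] {G : LoopGraph V}

/-- A bottom-up traversal: a list that contains each node exactly once, and each node after all
its children. -/
def IsBottomUp [DecidableEq I] (T : NiceTreeDecomposition G I) (t : List I) : Prop :=
  t.Nodup ∧ (∀ i, i ∈ t) ∧ ∀ i, ∀ j ∈ T.childSet T.root i, t.idxOf j < t.idxOf i

/-- The procedure `SupplyVertexOrder`: the vertices, listed in the order in which they are
forgotten along the traversal `t`. -/
def vertexOrder (T : NiceTreeDecomposition G I) (t : List I) : List V :=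
  t.filterMap fun i =>
    match T.kind i with
    | .forget _ a => some a
    | _ => none

end NiceTreeDecomposition

/-! ### Scenarios

Vectors in `{0,1}^U` and `U × U` matrices, for `U` a set of vertices, are represented by vectors
and matrices that are indexed by all vertices and vanish outside `U`. -/

section Scenarios

variable {V : Type*}

/-- A pair of a set of vectors and a matrix. -/
abbrev Scenario (V : Type*) := Finset (V → ZMod 2) × Matrix V V (ZMod 2)

/-- `s` is a scenario of `U`: the vectors are linearly independent vectors in `{0,1}^U`, the
matrix is a symmetric `U × U` matrix. The vectors are listed in lexicographic order, so that it
is enough to keep their set. -/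
def IsScenario (U : Finset V) (s : Scenario V) : Prop :=
  (∀ c ∈ s.1, ∀ a, a ∉ U → c a = 0) ∧
  LinearIndepOn (ZMod 2) id (s.1 : Set (V → ZMod 2)) ∧
  s.2.IsSymm ∧
  ∀ a b, a ∉ U ∨ b ∉ U → s.2 a b = 0

open Classical in
/-- The set of all scenarios of `U`. -/
noncomputable def scenarios [Fintype V] (U : Finset V) : Finset (Scenario V) :=
  Finset.univ.filter (IsScenario U)

/-- The scenario without vectors and with the zero matrix. -/
def emptyScenario : Scenario V := (∅, 0)

open Classical in
/-- The adjacency matrix of the subgraph of `G` induced by `U`. -/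
noncomputable def adjOn (G : LoopGraph V) (U : Finset V) : Matrix V V (ZMod 2) :=
  fun a b => if a ∈ U ∧ b ∈ U ∧ G.Adj a b then 1 else 0

/-- The entries of a vector, listed in the vertex order `ord`. Vectors are compared by the
lexicographic order of these lists. -/
def entries (ord : List V) (c : V → ZMod 2) : List ℕ := ord.map fun a => (c a).val

open Classical in
/-- The minimal basis of the span of `C` that consists of elements of `C`: run through `C` in
increasing order and take each vector that is not in the span of the smaller ones. -/
noncomputable def minBasis (ord : List V) (C : Finset (V → ZMod 2)) : Finset (V → ZMod 2) :=
  C.filter fun c =>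
    c ∉ Submodule.span (ZMod 2) {d : V → ZMod 2 | d ∈ C ∧ entries ord d < entries ord c}

/-- The minimum element of a nonempty set of vectors. -/
noncomputable def minVector (ord : List V) (C : Finset (V → ZMod 2)) (h : C.Nonempty) :
    V → ZMod 2 :=
  (C.exists_min_image (entries ord) h).choose

variable [DecidableEq V]

/-- The vector `c` with the component `a` deleted. -/
def delVec (a : V) (c : V → ZMod 2) : V → ZMod 2 := Function.update c a 0

/-- The matrix `M` with the row and the column `a` deleted. -/
def delMat (a : V) (M : Matrix V V (ZMod 2)) : Matrix V V (ZMod 2) :=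
  fun i j => if i = a ∨ j = a then 0 else M i j

open Classical in
/-- The join of two scenarios of `U` with respect to `G[U]`. -/
noncomputable def joinScenario (ord : List V) (G : LoopGraph V) (U : Finset V)
    (s₁ s₂ : Scenario V) : Scenario V :=
  (minBasis ord (s₁.1 ∪ s₂.1), adjOn G U + (s₁.2 - adjOn G U) + (s₂.2 - adjOn G U))

/-- Adding the vertex `a` to the extension: the vectors get a zero component for `a`, the matrix
gets the row and the column `a` of the adjacency matrix of `G[U]`, where `U` is the new
extension. -/
noncomputable def introduceScenario (G : LoopGraph V) (U : Finset V) (a : V) (s : Scenario V) :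
    Scenario V :=
  (s.1, fun i j => if i = a ∨ j = a then adjOn G U i j else s.2 i j)

open Classical in
/-- Ignoring the vertex `a` of the extension. -/
noncomputable def ignoreScenario (ord : List V) (a : V) (s : Scenario V) : Scenario V :=
  (minBasis ord (s.1.image (delVec a)), delMat a s.2)

open Classical in
/-- Forgetting the vertex `a` when neither a vector of the scenario nor a self loop can be used
to eliminate it: the column `a` of the matrix joins the vectors, if it is not in their span. -/
noncomputable def forgetIsolated (a : V) (s : Scenario V) : Scenario V :=
  let C := s.1.image (delVec a)
  let col := delVec a fun i => s.2 i a
  (if col ∈ Submodule.span (ZMod 2) (C : Set (V → ZMod 2)) then C else insert col C,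
    delMat a s.2)

/-- The symmetric Gaussian elimination step with the self loop at `a`. -/
def loopElim (a : V) (M : Matrix V V (ZMod 2)) : Matrix V V (ZMod 2) :=
  fun y x =>
    if y = a ∧ x = a then 1
    else if y = a ∨ x = a then 0
    else M y x + M a x * M y a

/-- The effect on the matrix of adding column and row `a` to all columns and rows `i ≠ a` with
`w i = 1`, followed by deletion of the row and the column `a`. -/
def edgeElim (a : V) (w : V → ZMod 2) (M : Matrix V V (ZMod 2)) : Matrix V V (ZMod 2) :=
  delMat a fun y x => M y x + w x * M y a + w y * M a x + w x * w y * M a a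

open Classical in
/-- Turning the vertex `a` of the extension into a vertex of the graph that is extended: the new
scenario, and the increase of the rank. -/
noncomputable def forgetScenario (ord : List V) (a : V) (s : Scenario V) : Scenario V × ℕ :=
  if h : (s.1.filter fun c => c a = 1).Nonempty then
    let w := minVector ord (s.1.filter fun c => c a = 1) h
    (((s.1.erase w).image fun c => delVec a (c + c a • w), edgeElim a w s.2), 2)
  else if s.2 a a = 1 then
    (forgetIsolated a (s.1, loopElim a s.2), 1)
  else
    (forgetIsolated a s, 0)

end Scenarios

/-! ### The algorithm

The algorithm runs on a memory that holds the table of the values `S(i, D, s)`. Every arithmetic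
operation is recorded. -/

/-- A recorded arithmetic operation: its inputs and its result. -/
structure ArithStep (F : Type) where
  inputs : List F
  result : F

/-- The state of the computation: the table `S(i, D, s)` and the record of the arithmetic
operations carried out so far. -/
structure Machine (V I F : Type) where
  table : I → Finset V → Scenario V → F
  record : List (ArithStep F)

/-- Computations on the machine. -/
abbrev Comp (V I F α : Type) := StateM (Machine V I F) α

section Algorithm

variable {V I F : Type}

/-- Record an arithmetic operation and return its result. -/
def arith (inputs : List F) (result : F) : Comp V I F F := fun m =>
  (result, { m with record := ⟨inputs, result⟩ :: m.record })

variable [Field F]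

/-- Addition of two numbers. -/
def addOp (p q : F) : Comp V I F F := arith [p, q] (p + q)

/-- Multiplication of two numbers. -/
def mulOp (p q : F) : Comp V I F F := arith [p, q] (p * q)

/-- Inversion of a number. -/
def invOp (p : F) : Comp V I F F := arith [p] p⁻¹

/-- The power `p ^ r`, by multiplications. -/
def powOp (p : F) : ℕ → Comp V I F F
  | 0 => pure 1
  | 1 => pure p
  | r + 2 => do
    let q ← powOp p (r + 1)
    mulOp q p

/-- The power `p ^ n` for an exponent `n` in `{1, 0, -1}`. -/
def signPowOp (p : F) (n : ℤ) : Comp V I F F :=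
  if n = 1 then pure p else if n = 0 then pure 1 else invOp p

/-- Read the table entry `S(i, D, s)`. -/
def readS (i : I) (D : Finset V) (s : Scenario V) : Comp V I F F := fun m =>
  (m.table i D s, m)

open Classical in
/-- The assignment `S(i, D, s) ← z`. -/
noncomputable def writeS (i : I) (D : Finset V) (s : Scenario V) (z : F) : Comp V I F Unit :=
  fun m => ((), { m with
    table := fun i' D' s' => if i' = i ∧ D' = D ∧ s' = s then z else m.table i' D' s' })

/-- The assignment `S(i, D, s) ← S(i, D, s) + z`. -/
noncomputable def accumulate (i : I) (D : Finset V) (s : Scenario V) (z : F) :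
    Comp V I F Unit := do
  let z₀ ← readS i D s
  let z₁ ← addOp z₀ z
  writeS i D s z₁

variable [Fintype V] [DecidableEq V]

/-- `S(i, D, s) ← 0` for all scenarios `s` of `U`. -/
noncomputable def initS (i : I) (U D : Finset V) : Comp V I F Unit :=
  (scenarios U).toList.forM fun s => writeS i D s 0

/-- The parts at a join node `i` with bag `U` and children `j₁`, `j₂`. -/
noncomputable def joinNode (G : LoopGraph V) (ord : List V) (i j₁ j₂ : I) (U D : Finset V) :
    Comp V I F Unit := do
  initS i U D
  (scenarios U).toList.forM fun s₁ =>
    (scenarios U).toList.forM fun s₂ => do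
      let s := joinScenario ord (G.toggle D) U s₁ s₂
      let p ← readS j₁ D s₁
      let q ← readS j₂ D s₂
      let z ← mulOp p q
      accumulate i D s z

/-- The parts at an introduce node `i` with bag `U` and child `j` with bag `U'`; the vertex `a`
is introduced. -/
noncomputable def introduceNode (G : LoopGraph V) (i j : I) (a : V) (U U' D : Finset V) :
    Comp V I F Unit := do
  initS i U D
  (scenarios U').toList.forM fun s' => do
    let s := introduceScenario (G.toggle D) U a s'
    let z ← readS j (D.erase a) s'
    writeS i D s z

/-- `S(i, D, s) ← S(i, D, s) + t u^r v^(1-r) S(j, D', s')`, where `s` and `r` are the scenario and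
the rank increase that belong to forgetting `a` in `s'`. -/
noncomputable def forgetTerm (ord : List V) (t u v : F) (i j : I) (a : V) (D D' : Finset V)
    (s' : Scenario V) : Comp V I F Unit := do
  let s := (forgetScenario ord a s').1
  let r := (forgetScenario ord a s').2
  let n : ℤ := 1 - r
  let pu ← powOp u r
  let pv ← signPowOp v n
  let z₁ ← mulOp t pu
  let z₂ ← mulOp z₁ pv
  let z₃ ← readS j D' s'
  let z₄ ← mulOp z₂ z₃
  accumulate i D s z₄

/-- The parts at a forget node `i` with bag `U` and child `j` with bag `U'`; the vertex `a` is
forgotten. -/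
noncomputable def forgetNode (ord : List V) (x y : V → F) (u v : F) (i j : I) (a : V)
    (U U' D : Finset V) : Comp V I F Unit := do
  initS i U D
  (scenarios U').toList.forM fun s' => do
    let z ← readS j D s'
    accumulate i D (ignoreScenario ord a s') z
    forgetTerm ord (x a) u v i j a D D s'
    forgetTerm ord (y a) u v i j a D (insert a D) s'

/-- The algorithm: evaluate the interlace polynomial of `G` at `(x, y, u, v)` by dynamic
programming over the scenarios of the bags, along the bottom-up traversal `t` of the nice tree
decomposition `T`. -/
noncomputable def algorithm {G : LoopGraph V} (T : NiceTreeDecomposition G I) (t : List I)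
    (x y : V → F) (u v : F) : Comp V I F F := do
  let ord := T.vertexOrder t
  t.forM fun i =>
    (T.bag i).powerset.toList.forM fun D =>
      match T.kind i with
      | .leaf => writeS i D emptyScenario 1
      | .join j₁ j₂ => joinNode G ord i j₁ j₂ (T.bag i) D
      | .introduce j a => introduceNode G i j a (T.bag i) (T.bag j) D
      | .forget j a => forgetNode ord x y u v i j a (T.bag i) (T.bag j) D
  readS T.root ∅ emptyScenario

/-- The value that the algorithm returns, started with the zero table and an empty record. -/
noncomputable def output {G : LoopGraph V} (T : NiceTreeDecomposition G I) (t : List I)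
    (x y : V → F) (u v : F) : F :=
  ((algorithm T t x y u v).run ⟨fun _ _ _ => 0, []⟩).1

/-- The arithmetic operations that the algorithm carries out. -/
noncomputable def operations {G : LoopGraph V} (T : NiceTreeDecomposition G I) (t : List I)
    (x y : V → F) (u v : F) : List (ArithStep F) :=
  ((algorithm T t x y u v).run ⟨fun _ _ _ => 0, []⟩).2.record

end Algorithm

/-- The bit length of a rational number: the number of binary digits of its numerator plus that
of its denominator, in lowest terms. -/
def bitLength (q : ℚ) : ℕ := Nat.size q.num.natAbs + Nat.size q.den

end Interlace

set_option linter.unusedSectionVars false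

/-! A scenario is the outcome of a partial symmetric Gaussian elimination, and the proof rests on a
description of that outcome without coordinates. Let M be a symmetric matrix over GF(2), W the set
of eliminated vertices and U the bag. Consider those z supported on U for which some p supported on
W makes p + z orthogonal to W. They form a subspace, and the form M(p + z, p' + z') on it does not
depend on the choice of p and p'. `Represents` says that the vectors of the scenario are equations
for this subspace and that its matrix induces this form on it. Only the span of the vectors matters,
so the choices made by `minBasis` are irrelevant to correctness. They serve to keep the vectors
independent and hence the number of scenarios small.

Join, introduce and ignore preserve `Represents` because of the missing edges that a tree
decomposition guarantees. Forgetting a vertex a moves the unit vector at a from U to W. The three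
cases of the algorithm say how its coefficient t is found: from an equation w with a nonzero
component at a, from the loop at a, or not at all. The nullity is the dimension of the radical of M
on W. It changes by -1, 0 and +1 in these cases, that is, by 1 - r, so the rank grows by r
(`Represents.forget`). This explains the factor u^r v^(1-r).

The table invariant `Correct` attaches to each disjoint pair (A, B) of sets of forgotten vertices
some scenario representing it, and says that the table is the sum of the corresponding terms placed
at these scenarios. Every update is additive in each table it reads, so sums over scenarios turn
into sums over pairs (`sum_apply_sum_pt`). At the root all vertices are forgotten and only the empty
scenario exists.

For the operation count, a bag of size w has at most 2^(w^2 + w(w+1)/2) scenarios. The costliest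
nodes run over pairs of scenarios, which gives 2^(3w^2 + w), for each of the 2^w sets D.

For the bit length, each forgotten vertex contributes a factor of at most 2^(6l) to a common
denominator Q. The quantity controlled is the sum of |Q f(s)| over all scenarios s. It is at most
2^(8l) to the power of the number of forgotten vertices: joins multiply it, and a forget step costs
at most a factor 3 * 2^(6l). Working with a sum instead of a maximum keeps the number of scenarios,
and thus the width, out of the estimate. It also bounds all intermediate sums. -/

namespace Interlace

open Matrix

/-! ### Bilinear forms over GF(2): supports, orthogonality, radicals. -/

section Linear

variable {V : Type*} [Fintype V] [DecidableEq V]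

theorem zmod_two_eq_zero_or_one (t : ZMod 2) : t = 0 ∨ t = 1 := by
  revert t; decide

theorem zmod_two_add_eq_zero_iff {s t : ZMod 2} : s + t = 0 ↔ s = t := by
  revert s t; decide

/-- The bilinear form with matrix `M`. -/
def form (M : Matrix V V (ZMod 2)) (x y : V → ZMod 2) : ZMod 2 := x ⬝ᵥ M *ᵥ y

section Form

variable (M : Matrix V V (ZMod 2)) (x y z : V → ZMod 2)

theorem form_add_left : form M (x + y) z = form M x z + form M y z := add_dotProduct _ _ _

theorem form_add_right : form M x (y + z) = form M x y + form M x z := by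
  simp [form, Matrix.mulVec_add, dotProduct_add]

theorem form_smul_left (t : ZMod 2) : form M (t • x) y = t * form M x y := by
  simp [form, smul_dotProduct]

theorem form_smul_right (t : ZMod 2) : form M x (t • y) = t * form M x y := by
  simp [form, Matrix.mulVec_smul, dotProduct_smul]

theorem form_zero_right : form M x 0 = 0 := by simp [form]

theorem form_add_matrix (N : Matrix V V (ZMod 2)) :
    form (M + N) x y = form M x y + form N x y := by
  simp [form, Matrix.add_mulVec, dotProduct_add]

theorem form_sub_matrix (N : Matrix V V (ZMod 2)) :
    form (M - N) x y = form M x y - form N x y := by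
  simp [form, Matrix.sub_mulVec, dotProduct_sub]

variable {M} in
theorem form_comm (hM : M.IsSymm) : form M x y = form M y x := by
  rw [form, form, dotProduct_comm, Matrix.dotProduct_mulVec, ← Matrix.mulVec_transpose, hM.eq,
    dotProduct_comm, dotProduct_comm, dotProduct_comm]

theorem form_eq_sum : form M x y = ∑ a, ∑ b, x a * M a b * y b := by
  simp [form, dotProduct, Matrix.mulVec, Finset.mul_sum, mul_assoc]

theorem form_single_left (a : V) : form M (Pi.single a 1) x = (M *ᵥ x) a := by
  simp [form]

theorem form_single_single (a b : V) : form M (Pi.single a 1) (Pi.single b 1) = M a b := by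
  simp [form]

end Form

/-- The vectors that vanish outside `U`. -/
def supportedOn (U : Finset V) : Submodule (ZMod 2) (V → ZMod 2) where
  carrier := {z | ∀ a, a ∉ U → z a = 0}
  add_mem' hx hy a ha := by simp [hx a ha, hy a ha]
  zero_mem' a _ := rfl
  smul_mem' t x hx a ha := by simp [hx a ha]

theorem mem_supportedOn {U : Finset V} {z : V → ZMod 2} :
    z ∈ supportedOn U ↔ ∀ a, a ∉ U → z a = 0 := Iff.rfl

theorem supportedOn_mono {U W : Finset V} (h : U ⊆ W) : supportedOn U ≤ supportedOn W :=
  fun _ hz a ha => hz a fun h' => ha (h h')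

theorem single_mem_supportedOn {U : Finset V} {a : V} (h : a ∈ U) (t : ZMod 2) :
    Pi.single a t ∈ supportedOn U := fun b hb => by
  rw [Pi.single_eq_of_ne]; rintro rfl; exact hb h

theorem supportedOn_empty : supportedOn (∅ : Finset V) = ⊥ := by
  ext z
  simp only [mem_supportedOn, Submodule.mem_bot, Finset.notMem_empty, not_false_eq_true,
    forall_const]
  exact ⟨fun h => funext h, fun h a => by simp [h]⟩

theorem exists_add_of_mem_supportedOn_insert {U : Finset V} {a : V} {z : V → ZMod 2}
    (hz : z ∈ supportedOn (insert a U)) (ha : a ∉ U) :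
    ∃ z₀ ∈ supportedOn U, ∃ t : ZMod 2, z = z₀ + t • Pi.single a 1 := by
  refine ⟨Function.update z a 0, fun b hb => ?_, z a, ?_⟩
  · by_cases hba : b = a
    · simp [hba]
    · simp [hba, hz b (by simp [hb, hba])]
  · ext b
    by_cases hba : b = a
    · subst hba; simp
    · simp [hba]

theorem add_smul_single_mem_supportedOn_insert {U : Finset V} {a : V} {z : V → ZMod 2}
    (hz : z ∈ supportedOn U) (t : ZMod 2) :
    z + t • Pi.single a 1 ∈ supportedOn (insert a U) :=
  add_mem (supportedOn_mono (Finset.subset_insert _ _) hz)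
    (Submodule.smul_mem _ _ (single_mem_supportedOn (Finset.mem_insert_self _ _) 1))

theorem supportedOn_union (U W : Finset V) :
    supportedOn (U ∪ W) = supportedOn U ⊔ supportedOn W := by
  refine le_antisymm (fun z hz => ?_) (sup_le (supportedOn_mono Finset.subset_union_left)
    (supportedOn_mono Finset.subset_union_right))
  refine Submodule.mem_sup.2 ⟨fun a => if a ∈ U then z a else 0, fun a ha => by simp [ha],
    fun a => if a ∈ U then 0 else z a, fun a ha => ?_, ?_⟩
  · by_cases h : a ∈ U
    · simp [h]
    · simp [h, hz a (by simp [h, ha])]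
  · ext a
    by_cases h : a ∈ U <;> simp [h]

theorem disjoint_supportedOn {U W : Finset V} (h : Disjoint U W) :
    supportedOn U ⊓ supportedOn W = ⊥ := by
  rw [eq_bot_iff]
  rintro z ⟨h₁, h₂⟩
  refine (Submodule.mem_bot _).2 (funext fun a => ?_)
  by_cases ha : a ∈ U
  · exact h₂ a (Finset.disjoint_left.1 h ha)
  · exact h₁ a ha

theorem form_congr {M N : Matrix V V (ZMod 2)} {S T : Finset V}
    (h : ∀ a ∈ S, ∀ b ∈ T, M a b = N a b) {x y : V → ZMod 2}
    (hx : x ∈ supportedOn S) (hy : y ∈ supportedOn T) : form M x y = form N x y := by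
  rw [form_eq_sum, form_eq_sum]
  refine Finset.sum_congr rfl fun a _ => Finset.sum_congr rfl fun b _ => ?_
  by_cases ha : a ∈ S
  · by_cases hb : b ∈ T
    · rw [h a ha b hb]
    · simp [hy b hb]
  · simp [hx a ha]

theorem form_eq_zero {M : Matrix V V (ZMod 2)} {S T : Finset V}
    (h : ∀ a ∈ S, ∀ b ∈ T, M a b = 0) {x y : V → ZMod 2}
    (hx : x ∈ supportedOn S) (hy : y ∈ supportedOn T) : form M x y = 0 := by
  rw [form_congr (N := 0) (by simpa using h) hx hy]
  simp [form]

/-- The vectors that are orthogonal, with respect to `M`, to all vectors supported on `W`. -/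
def orth (M : Matrix V V (ZMod 2)) (W : Finset V) : Submodule (ZMod 2) (V → ZMod 2) where
  carrier := {x | ∀ q ∈ supportedOn W, form M q x = 0}
  add_mem' hx hy q hq := by simp [form_add_right, hx q hq, hy q hq]
  zero_mem' q _ := form_zero_right _ _
  smul_mem' t x hx q hq := by simp [form_smul_right, hx q hq]

theorem mem_orth {M : Matrix V V (ZMod 2)} {W : Finset V} {x : V → ZMod 2} :
    x ∈ orth M W ↔ ∀ q ∈ supportedOn W, form M q x = 0 := Iff.rfl

theorem orth_union (M : Matrix V V (ZMod 2)) (U W : Finset V) :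
    orth M (U ∪ W) = orth M U ⊓ orth M W := by
  ext x
  simp only [Submodule.mem_inf, mem_orth]
  refine ⟨fun h => ⟨fun q hq => h q (supportedOn_mono Finset.subset_union_left hq),
    fun q hq => h q (supportedOn_mono Finset.subset_union_right hq)⟩, fun h q hq => ?_⟩
  rw [supportedOn_union] at hq
  obtain ⟨q₁, h₁, q₂, h₂, rfl⟩ := Submodule.mem_sup.1 hq
  rw [form_add_left, h.1 _ h₁, h.2 _ h₂, add_zero]

theorem mem_orth_insert {M : Matrix V V (ZMod 2)} {W : Finset V} {a : V} {x : V → ZMod 2}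
    (ha : a ∉ W) :
    x ∈ orth M (insert a W) ↔ x ∈ orth M W ∧ form M (Pi.single a 1) x = 0 := by
  refine ⟨fun h => ⟨fun q hq => h q (supportedOn_mono (Finset.subset_insert _ _) hq),
    h _ (single_mem_supportedOn (Finset.mem_insert_self _ _) 1)⟩, fun h q hq => ?_⟩
  obtain ⟨q₀, hq₀, t, rfl⟩ := exists_add_of_mem_supportedOn_insert hq ha
  rw [form_add_left, form_smul_left, h.1 _ hq₀, h.2, mul_zero, add_zero]

theorem mem_orth_congr {M N : Matrix V V (ZMod 2)} {W S : Finset V}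
    (h : ∀ a ∈ W, ∀ b ∈ S, M a b = N a b) {x : V → ZMod 2} (hx : x ∈ supportedOn S) :
    x ∈ orth M W ↔ x ∈ orth N W := by
  refine forall₂_congr fun q hq => ?_
  rw [form_congr h hq hx]

theorem mem_orth_iff {M : Matrix V V (ZMod 2)} {W : Finset V} {x : V → ZMod 2} :
    x ∈ orth M W ↔ ∀ w ∈ W, (M *ᵥ x) w = 0 := by
  refine ⟨fun h w hw => ?_, fun h q hq => ?_⟩
  · rw [← form_single_left]; exact h _ (single_mem_supportedOn hw 1)
  · refine Finset.sum_eq_zero fun a _ => ?_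
    by_cases ha : a ∈ W
    · rw [h a ha, mul_zero]
    · rw [hq a ha, zero_mul]

/-- The radical of the form with matrix `M`, restricted to the vectors supported on `W`. -/
def radical (M : Matrix V V (ZMod 2)) (W : Finset V) : Submodule (ZMod 2) (V → ZMod 2) :=
  supportedOn W ⊓ orth M W

theorem radical_congr {M N : Matrix V V (ZMod 2)} {W : Finset V}
    (h : ∀ a ∈ W, ∀ b ∈ W, M a b = N a b) : radical M W = radical N W := by
  ext x
  simp only [radical, Submodule.mem_inf]
  exact and_congr_right fun hx => mem_orth_congr h hx

theorem finrank_radical_empty (M : Matrix V V (ZMod 2)) :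
    Module.finrank (ZMod 2) (radical M ∅) = 0 := by
  rw [radical, supportedOn_empty, bot_inf_eq, finrank_bot]

/-- With no entries between the two blocks, orthogonality to a block only sees the component in that
block. The radical is therefore the direct sum of the two radicals. -/
theorem finrank_radical_union {M : Matrix V V (ZMod 2)} {W₁ W₂ : Finset V}
    (hd : Disjoint W₁ W₂) (h₁₂ : ∀ a ∈ W₁, ∀ b ∈ W₂, M a b = 0)
    (h₂₁ : ∀ a ∈ W₂, ∀ b ∈ W₁, M a b = 0) :
    Module.finrank (ZMod 2) (radical M (W₁ ∪ W₂)) =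
      Module.finrank (ZMod 2) (radical M W₁) + Module.finrank (ZMod 2) (radical M W₂) := by
  rw [← Submodule.finrank_sup_add_finrank_inf_eq]
  have h0 : radical M W₁ ⊓ radical M W₂ = ⊥ := by
    rw [eq_bot_iff, ← disjoint_supportedOn hd]
    exact inf_le_inf inf_le_left inf_le_left
  rw [h0, finrank_bot, add_zero]
  refine congrArg (fun S : Submodule (ZMod 2) (V → ZMod 2) => Module.finrank (ZMod 2) S) ?_
  rw [radical, orth_union, supportedOn_union]
  refine le_antisymm ?_ (sup_le ?_ ?_)
  · rintro x ⟨hx, hx₁, hx₂⟩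
    obtain ⟨p, hp, q, hq, rfl⟩ := Submodule.mem_sup.1 hx
    refine Submodule.mem_sup.2 ⟨p, ⟨hp, fun r hr => ?_⟩, q, ⟨hq, fun r hr => ?_⟩, rfl⟩
    · simpa [form_add_right, form_eq_zero h₁₂ hr hq] using hx₁ r hr
    · simpa [form_add_right, form_eq_zero h₂₁ hr hp] using hx₂ r hr
  · rintro p ⟨hp, hp'⟩
    exact ⟨Submodule.mem_sup_left hp, hp', fun r hr => form_eq_zero h₂₁ hr hp⟩
  · rintro p ⟨hp, hp'⟩
    exact ⟨Submodule.mem_sup_right hp, fun r hr => form_eq_zero h₁₂ hr hp, hp'⟩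

/-- A vector that is orthogonal to the radical can be moved into the orthogonal complement of
the vectors supported on `W` by a vector supported on `W`. -/
theorem exists_add_mem_orth {M : Matrix V V (ZMod 2)} (hM : M.IsSymm) {W : Finset V}
    {e : V → ZMod 2} (he : ∀ q ∈ radical M W, form M e q = 0) :
    ∃ p ∈ supportedOn W, p + e ∈ orth M W := by
  -- `R` is M followed by restriction to W, so its kernel is the orthogonal space, and in
  -- characteristic two it suffices to find p with the same image as e.
  let R : (V → ZMod 2) →ₗ[ZMod 2] (V → ZMod 2) :=
    { toFun := fun x a => if a ∈ W then (M *ᵥ x) a else 0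
      map_add' := fun x y => by ext a; by_cases h : a ∈ W <;> simp [h, Matrix.mulVec_add]
      map_smul' := fun t x => by ext a; by_cases h : a ∈ W <;> simp [h, Matrix.mulVec_smul] }
  have hR : ∀ x, R x = 0 ↔ x ∈ orth M W := fun x => by
    rw [mem_orth_iff, funext_iff]
    refine forall_congr' fun a => ?_
    by_cases h : a ∈ W <;> simp [R, h]
  suffices h : R e ∈ (supportedOn W).map R by
    obtain ⟨p, hp, hpe⟩ := h
    refine ⟨p, hp, (hR _).1 ?_⟩
    rw [map_add, hpe]
    ext a
    exact CharTwo.add_self_eq_zero _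
  by_contra hne
  obtain ⟨f, hfe, hf⟩ := Submodule.exists_le_ker_of_notMem hne
  -- The separating functional, composed with `R`, is pairing with a vector q supported on W. It
  -- vanishes on the image of the vectors supported on W, so q lies in the radical, yet it does not
  -- vanish at e.
  set q : V → ZMod 2 := fun a => if a ∈ W then f (Pi.single a 1) else 0 with hqdef
  have hfR : ∀ x, f (R x) = form M q x := fun x => by
    conv_lhs => rw [pi_eq_sum_univ (R x), map_sum]
    refine Finset.sum_congr rfl fun a _ => ?_
    have : (fun j => if a = j then (1 : ZMod 2) else 0) = Pi.single a 1 := by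
      ext j; simp [Pi.single_apply, eq_comm]
    rw [map_smul, this]
    by_cases h : a ∈ W <;> simp [R, q, h, mul_comm]
  have hq : q ∈ supportedOn W := fun a ha => by simp [q, ha]
  apply hfe
  rw [hfR, form_comm _ _ hM]
  refine he q ⟨hq, fun p hp => ?_⟩
  rw [form_comm _ _ hM, ← hfR]
  exact hf ⟨p, hp, rfl⟩

end Linear

/-! ### What a scenario means; introducing, joining and ignoring. -/

section Represents

variable {V : Type*} [Fintype V] [DecidableEq V]

/-- The scenario `s` describes the form with matrix `M` after elimination of the vertices of `W`:
its vectors cut out the space of those vectors supported on `U` that can be made orthogonal to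
`W` by adding a vector supported on `W`, and its matrix is the form induced on that space. -/
structure Represents (M : Matrix V V (ZMod 2)) (W U : Finset V) (s : Scenario V) : Prop where
  exists_iff : ∀ z ∈ supportedOn U,
    (∃ p ∈ supportedOn W, p + z ∈ orth M W) ↔ ∀ c ∈ s.1, c ⬝ᵥ z = 0
  form_eq : ∀ z ∈ supportedOn U, ∀ z' ∈ supportedOn U, ∀ p ∈ supportedOn W,
    ∀ p' ∈ supportedOn W, p + z ∈ orth M W → p' + z' ∈ orth M W →
      form M (p + z) (p' + z') = form s.2 z z'

theorem dotProduct_eq_zero_of_mem_span {S : Set (V → ZMod 2)} {z c : V → ZMod 2}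
    (h : ∀ c ∈ S, c ⬝ᵥ z = 0) (hc : c ∈ Submodule.span (ZMod 2) S) : c ⬝ᵥ z = 0 := by
  induction hc using Submodule.span_induction with
  | mem x hx => exact h x hx
  | zero => exact zero_dotProduct _
  | add x y _ _ hx hy => rw [add_dotProduct, hx, hy, add_zero]
  | smul t x _ hx => rw [smul_dotProduct, hx, smul_zero]

/-- Allows every operation on the vectors of a scenario to be specified through its span alone. -/
theorem forall_dotProduct_eq_zero_iff_of_span_eq {S T : Set (V → ZMod 2)}
    (h : Submodule.span (ZMod 2) S = Submodule.span (ZMod 2) T) (z : V → ZMod 2) :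
    (∀ c ∈ S, c ⬝ᵥ z = 0) ↔ ∀ c ∈ T, c ⬝ᵥ z = 0 :=
  ⟨fun hS _ hc => dotProduct_eq_zero_of_mem_span hS (h ▸ Submodule.subset_span hc),
    fun hT _ hc => dotProduct_eq_zero_of_mem_span hT (h ▸ Submodule.subset_span hc)⟩

variable {M : Matrix V V (ZMod 2)} {W U : Finset V} {s : Scenario V}

/-- Used to change the set of toggled vertices away from W and U. -/
theorem Represents.congr {N : Matrix V V (ZMod 2)} (h : Represents M W U s)
    (hMN : ∀ a ∈ W ∪ U, ∀ b ∈ W ∪ U, M a b = N a b) : Represents N W U s := by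
  have hsup : ∀ {p z : V → ZMod 2}, p ∈ supportedOn W → z ∈ supportedOn U →
      p + z ∈ supportedOn (W ∪ U) := fun hp hz =>
    add_mem (supportedOn_mono Finset.subset_union_left hp)
      (supportedOn_mono Finset.subset_union_right hz)
  have ho : ∀ {x : V → ZMod 2}, x ∈ supportedOn (W ∪ U) → (x ∈ orth M W ↔ x ∈ orth N W) :=
    fun hx => mem_orth_congr (fun a ha => hMN a (Finset.mem_union_left _ ha)) hx
  refine ⟨fun z hz => ?_, fun z hz z' hz' p hp p' hp' h₁ h₂ => ?_⟩
  · rw [← h.exists_iff z hz]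
    exact exists_congr fun p => and_congr_right fun hp => (ho (hsup hp hz)).symm
  · rw [← form_congr hMN (hsup hp hz) (hsup hp' hz')]
    exact h.form_eq z hz z' hz' p hp p' hp' ((ho (hsup hp hz)).2 h₁) ((ho (hsup hp' hz')).2 h₂)

theorem represents_empty (M : Matrix V V (ZMod 2)) : Represents M ∅ ∅ emptyScenario := by
  have h0 : ∀ z : V → ZMod 2, z ∈ supportedOn (∅ : Finset V) → z = 0 := fun z hz => by
    simpa [supportedOn_empty] using hz
  refine ⟨fun z hz => ?_, fun z hz z' hz' p hp p' hp' _ _ => ?_⟩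
  · rw [h0 z hz]
    simp only [emptyScenario, Finset.notMem_empty, false_imp_iff, implies_true, iff_true]
    exact ⟨0, zero_mem _, by simp⟩
  · rw [h0 z hz, h0 z' hz', h0 p hp, h0 p' hp']
    simp [form]

/-- The new vertex has no entries with W, so adding a multiple of its unit vector does not affect
orthogonality to W. Hence no equation is added, and the new row and column can be copied from M. -/
theorem Represents.introduce {a : V} {s' : Scenario V} (h : Represents M W U s) (haU : a ∉ U)
    (hWa : ∀ w ∈ W, M w a = 0) (haW : ∀ w ∈ W, M a w = 0) (hs : ∀ c ∈ s.1, c a = 0)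
    (h₁ : s'.1 = s.1) (hUU : ∀ b ∈ U, ∀ c ∈ U, s'.2 b c = s.2 b c)
    (h₃ : ∀ b ∈ insert a U, s'.2 a b = M a b ∧ s'.2 b a = M b a) :
    Represents M W (insert a U) s' := by
  set e : V → ZMod 2 := Pi.single a 1 with he
  have heS : e ∈ supportedOn ({a} : Finset V) := single_mem_supportedOn (by simp) 1
  have hqe : ∀ q ∈ supportedOn W, form M q e = 0 := fun q hq =>
    form_eq_zero (by simpa using hWa) hq heS
  have heq : ∀ q ∈ supportedOn W, form M e q = 0 := fun q hq =>
    form_eq_zero (by simpa using haW) heS hq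
  have ho : ∀ (x : V → ZMod 2) (t : ZMod 2), x + t • e ∈ orth M W ↔ x ∈ orth M W :=
    fun x t => forall₂_congr fun q hq => by
      rw [form_add_right, form_smul_right, hqe q hq, mul_zero, add_zero]
  refine ⟨fun z hZ => ?_, fun z hZ z' hZ' p hp p' hp' h₁ h₂ => ?_⟩
  · obtain ⟨z, hz, t, rfl⟩ := exists_add_of_mem_supportedOn_insert hZ haU
    simp only [← add_assoc, ← he, ho]
    rw [h.exists_iff z hz, h₁]
    refine forall₂_congr fun c hc => ?_
    rw [dotProduct_add, dotProduct_smul, he, dotProduct_single, hs c hc]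
    simp
  · obtain ⟨z, hz, t, rfl⟩ := exists_add_of_mem_supportedOn_insert hZ haU
    obtain ⟨z', hz', t', rfl⟩ := exists_add_of_mem_supportedOn_insert hZ' haU
    rw [← add_assoc, ← he, ho] at h₁ h₂
    rw [← add_assoc, ← add_assoc, ← he]
    have key := h.form_eq z hz z' hz' p hp p' hp' h₁ h₂
    have e₁ : form s'.2 z z' = form s.2 z z' := form_congr hUU hz hz'
    have e₂ : form s'.2 e z' = form M e z' :=
      form_congr (fun b hb c hc => by
        rw [Finset.mem_singleton.1 hb]
        exact (h₃ c (Finset.mem_insert_of_mem hc)).1) heS hz'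
    have e₃ : form s'.2 z e = form M z e :=
      form_congr (fun b hb c hc => by
        rw [Finset.mem_singleton.1 hc]
        exact (h₃ b (Finset.mem_insert_of_mem hb)).2) hz heS
    have e₄ : form s'.2 e e = form M e e :=
      form_congr (fun b hb c hc => by
        rw [Finset.mem_singleton.1 hc, Finset.mem_singleton.1 hb]
        exact (h₃ a (Finset.mem_insert_self _ _)).2) heS heS
    simp only [form_add_left, form_add_right, form_smul_left, form_smul_right, e₁, e₂, e₃, e₄,
      ← key, hqe p hp, heq p' hp']
    ring

/-- As W₁ and W₂ have no entries in common, p + q + z is orthogonal to both exactly when p + z is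
orthogonal to W₁ and q + z to W₂, so the equations are united. The two induced forms both contain
M(z, z'); adding them counts it twice, which is why A is subtracted once overall. -/
theorem Represents.join {W₁ W₂ : Finset V} {s₁ s₂ s' : Scenario V} {A : Matrix V V (ZMod 2)}
    (h₁ : Represents M W₁ U s₁) (h₂ : Represents M W₂ U s₂)
    (h₁₂ : ∀ a ∈ W₁, ∀ b ∈ W₂, M a b = 0) (h₂₁ : ∀ a ∈ W₂, ∀ b ∈ W₁, M a b = 0)
    (hA : ∀ a ∈ U, ∀ b ∈ U, A a b = M a b)
    (hs₁ : Submodule.span (ZMod 2) (s'.1 : Set (V → ZMod 2)) =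
      Submodule.span (ZMod 2) ((s₁.1 : Set (V → ZMod 2)) ∪ s₂.1))
    (hs₂ : s'.2 = A + (s₁.2 - A) + (s₂.2 - A)) :
    Represents M (W₁ ∪ W₂) U s' := by
  have hp₁₂ : ∀ p ∈ supportedOn W₁, ∀ q ∈ supportedOn W₂, form M p q = 0 := fun p hp q hq =>
    form_eq_zero h₁₂ hp hq
  have hp₂₁ : ∀ p ∈ supportedOn W₂, ∀ q ∈ supportedOn W₁, form M p q = 0 := fun p hp q hq =>
    form_eq_zero h₂₁ hp hq
  have ho : ∀ p ∈ supportedOn W₁, ∀ q ∈ supportedOn W₂, ∀ z,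
      p + q + z ∈ orth M (W₁ ∪ W₂) ↔ p + z ∈ orth M W₁ ∧ q + z ∈ orth M W₂ := by
    intro p hp q hq z
    rw [orth_union, Submodule.mem_inf]
    refine and_congr (forall₂_congr fun r hr => ?_) (forall₂_congr fun r hr => ?_)
    · simp [form_add_right, hp₁₂ r hr q hq]
    · simp [form_add_right, hp₂₁ r hr p hp]
  refine ⟨fun z hz => ?_, fun z hz z' hz' p hP p' hP' hpz hpz' => ?_⟩
  · have : (∀ c ∈ s'.1, c ⬝ᵥ z = 0) ↔ (∀ c ∈ s₁.1, c ⬝ᵥ z = 0) ∧ ∀ c ∈ s₂.1, c ⬝ᵥ z = 0 := by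
      have := forall_dotProduct_eq_zero_iff_of_span_eq hs₁ z
      simpa [or_imp, forall_and] using this
    rw [this, ← h₁.exists_iff z hz, ← h₂.exists_iff z hz]
    constructor
    · rintro ⟨p, hP, hpz⟩
      rw [supportedOn_union] at hP
      obtain ⟨p, hp, q, hq, rfl⟩ := Submodule.mem_sup.1 hP
      have := (ho p hp q hq z).1 hpz
      exact ⟨⟨p, hp, this.1⟩, ⟨q, hq, this.2⟩⟩
    · rintro ⟨⟨p, hp, hpz⟩, ⟨q, hq, hqz⟩⟩
      refine ⟨p + q, ?_, (ho p hp q hq z).2 ⟨hpz, hqz⟩⟩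
      rw [supportedOn_union]
      exact add_mem (Submodule.mem_sup_left hp) (Submodule.mem_sup_right hq)
  · rw [supportedOn_union] at hP hP'
    obtain ⟨p, hp, q, hq, rfl⟩ := Submodule.mem_sup.1 hP
    obtain ⟨p', hp', q', hq', rfl⟩ := Submodule.mem_sup.1 hP'
    obtain ⟨g₁, g₂⟩ := (ho p hp q hq z).1 hpz
    obtain ⟨g₁', g₂'⟩ := (ho p' hp' q' hq' z').1 hpz'
    have k₁ := h₁.form_eq z hz z' hz' p hp p' hp' g₁ g₁'
    have k₂ := h₂.form_eq z hz z' hz' q hq q' hq' g₂ g₂'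
    rw [hs₂]
    simp only [form_add_matrix, form_sub_matrix, ← k₁, ← k₂, form_congr hA hz hz']
    simp only [form_add_left, form_add_right, hp₁₂ p hp q' hq', hp₂₁ q hq p' hp']
    ring

theorem delVec_dotProduct {a : V} {z : V → ZMod 2} (hz : z a = 0) (c : V → ZMod 2) :
    delVec a c ⬝ᵥ z = c ⬝ᵥ z := by
  refine Finset.sum_congr rfl fun b _ => ?_
  by_cases hb : b = a
  · subst hb; simp [hz]
  · simp [delVec, hb]

theorem form_delMat {a : V} {N : Matrix V V (ZMod 2)} {z z' : V → ZMod 2}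
    (hz : z ∈ supportedOn (U.erase a)) (hz' : z' ∈ supportedOn (U.erase a)) :
    form (delMat a N) z z' = form N z z' :=
  form_congr (fun b hb c hc => by
    simp [delMat, Finset.ne_of_mem_erase hb, Finset.ne_of_mem_erase hc]) hz hz'

/-- Restriction to vectors z that vanish at a: components, rows and columns at a no longer
contribute. -/
theorem Represents.ignore {a : V} {s' : Scenario V} (h : Represents M W U s)
    (h₁ : Submodule.span (ZMod 2) (s'.1 : Set (V → ZMod 2)) =
      Submodule.span (ZMod 2) (delVec a '' (s.1 : Set (V → ZMod 2))))
    (h₂ : s'.2 = delMat a s.2) : Represents M W (U.erase a) s' := by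
  have hU := supportedOn_mono (Finset.erase_subset a U)
  refine ⟨fun z hz => ?_, fun z hz z' hz' p hp p' hp' h₁ h₂ => ?_⟩
  · rw [h.exists_iff z (hU hz)]
    have := forall_dotProduct_eq_zero_iff_of_span_eq h₁ z
    simp only [Set.forall_mem_image, Finset.mem_coe,
      delVec_dotProduct (hz a (Finset.notMem_erase _ _))] at this
    exact this.symm
  · rw [‹s'.2 = _›, form_delMat hz hz']
    exact h.form_eq z (hU hz) z' (hU hz') p hp p' hp' h₁ h₂

end Represents

/-! ### Forgetting a vertex: the three elimination cases. -/

section Forget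

variable {V : Type*} [Fintype V] [DecidableEq V] {M : Matrix V V (ZMod 2)} {W U : Finset V}
  {s : Scenario V} {a : V}

/-- A vector supported on W and a is p + t e with e the unit vector at a, and (p + t e) + z = p + (z
+ t e). So the old scenario is applied to z + t e, and the only new condition is orthogonality to e.
What remains in each case is to find t. -/
theorem Represents.forget_of {s' : Scenario V} (h : Represents M W U s) (haU : a ∈ U)
    (haW : a ∉ W)
    (h₁ : ∀ z ∈ supportedOn (U.erase a), (∀ c ∈ s'.1, c ⬝ᵥ z = 0) ↔
      ∃ t : ZMod 2, ∃ p ∈ supportedOn W, p + (z + t • Pi.single a 1) ∈ orth M W ∧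
        form M (Pi.single a 1) (p + (z + t • Pi.single a 1)) = 0)
    (h₂ : ∀ z ∈ supportedOn (U.erase a), ∀ z' ∈ supportedOn (U.erase a), ∀ t t' : ZMod 2,
      (∃ p ∈ supportedOn W, p + (z + t • Pi.single a 1) ∈ orth M W ∧
        form M (Pi.single a 1) (p + (z + t • Pi.single a 1)) = 0) →
      (∃ p ∈ supportedOn W, p + (z' + t' • Pi.single a 1) ∈ orth M W ∧
        form M (Pi.single a 1) (p + (z' + t' • Pi.single a 1)) = 0) →
      form s.2 (z + t • Pi.single a 1) (z' + t' • Pi.single a 1) = form s'.2 z z') :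
    Represents M (insert a W) (U.erase a) s' := by
  set e : V → ZMod 2 := Pi.single a 1 with he
  have hU : ∀ z ∈ supportedOn (U.erase a), ∀ t : ZMod 2, z + t • e ∈ supportedOn U :=
    fun z hz t => by
      have := add_smul_single_mem_supportedOn_insert (a := a) hz t
      rwa [Finset.insert_erase haU] at this
  have comm : ∀ (p z : V → ZMod 2) (t : ZMod 2), p + t • e + z = p + (z + t • e) := fun p z t => by
    abel
  refine ⟨fun z hz => ?_, fun z hz z' hz' p hP p' hP' hp hp' => ?_⟩
  · rw [h₁ z hz]
    constructor
    · rintro ⟨p, hP, hp⟩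
      obtain ⟨p, hpW, t, rfl⟩ := exists_add_of_mem_supportedOn_insert hP haW
      rw [← he, comm, mem_orth_insert haW] at hp
      exact ⟨t, p, hpW, hp⟩
    · rintro ⟨t, p, hpW, hp⟩
      refine ⟨p + t • e, add_smul_single_mem_supportedOn_insert hpW t, ?_⟩
      rwa [comm, mem_orth_insert haW]
  · obtain ⟨p, hpW, t, rfl⟩ := exists_add_of_mem_supportedOn_insert hP haW
    obtain ⟨p', hpW', t', rfl⟩ := exists_add_of_mem_supportedOn_insert hP' haW
    rw [← he, comm, mem_orth_insert haW] at hp hp'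
    rw [← he, comm, comm, ← h₂ z hz z' hz' t t' ⟨p, hpW, hp⟩ ⟨p', hpW', hp'⟩]
    exact h.form_eq _ (hU z hz t) _ (hU z' hz' t') p hpW p' hpW' hp.1 hp'.1

theorem dotProduct_add_smul_single (c z : V → ZMod 2) (t : ZMod 2) :
    c ⬝ᵥ (z + t • Pi.single a 1) = c ⬝ᵥ z + t * c a := by
  simp [dotProduct_add, dotProduct_smul]

/-- The matrix operation is the substitution t = w · z, carried out in both arguments. -/
theorem form_edgeElim (w : V → ZMod 2) {N : Matrix V V (ZMod 2)} {z z' : V → ZMod 2}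
    (hz : z ∈ supportedOn (U.erase a)) (hz' : z' ∈ supportedOn (U.erase a)) :
    form (edgeElim a w N) z z' =
      form N (z + (w ⬝ᵥ z) • Pi.single a 1) (z' + (w ⬝ᵥ z') • Pi.single a 1) := by
  refine (form_delMat (N := Matrix.of fun y x =>
    N y x + w x * N y a + w y * N a x + w x * w y * N a a) hz hz').trans ?_
  have e₁ : form N z (Pi.single a 1) = ∑ b, z b * N b a := by simp [form, dotProduct]
  have e₂ : form N (Pi.single a 1) z' = ∑ b, N a b * z' b := by
    rw [form_single_left]; rfl
  have e₃ : (w ⬝ᵥ z') * form N z (Pi.single a 1) =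
      ∑ b, ∑ c, (w c * z' c) * (z b * N b a) := by
    rw [e₁, dotProduct, Finset.sum_mul_sum, Finset.sum_comm]
  have e₄ : (w ⬝ᵥ z) * form N (Pi.single a 1) z' =
      ∑ b, ∑ c, (w b * z b) * (N a c * z' c) := by
    rw [e₂, dotProduct, Finset.sum_mul_sum]
  have e₅ : (w ⬝ᵥ z) * ((w ⬝ᵥ z') * N a a) =
      ∑ b, ∑ c, (w b * z b) * (w c * z' c * N a a) := by
    rw [dotProduct, dotProduct, Finset.sum_mul (f := fun c => w c * z' c), Finset.sum_mul_sum]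
  simp only [form_add_left, form_add_right, form_smul_left, form_smul_right, form_single_single,
    mul_add]
  rw [mul_left_comm (w ⬝ᵥ z'), e₃, e₄, e₅, form_eq_sum, form_eq_sum]
  simp only [← Finset.sum_add_distrib, Matrix.of_apply]
  exact Finset.sum_congr rfl fun b _ => Finset.sum_congr rfl fun c _ => by ring

/-- The correction term is the product of the two coefficients t that orthogonality to the unit
vector at a dictates when there is a loop at a. -/
theorem form_loopElim {N : Matrix V V (ZMod 2)} {z z' : V → ZMod 2}
    (hz : z ∈ supportedOn (U.erase a)) (hz' : z' ∈ supportedOn (U.erase a)) :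
    form (loopElim a N) z z' =
      form N z z' + form N (Pi.single a 1) z' * form N z (Pi.single a 1) := by
  have e₁ : form N z (Pi.single a 1) = ∑ b, z b * N b a := by simp [form, dotProduct]
  have e₂ : form N (Pi.single a 1) z' = ∑ b, N a b * z' b := by
    rw [form_single_left]; rfl
  rw [form_congr (N := Matrix.of fun y x => N y x + N a x * N y a) (fun b hb c hc => by
    simp [loopElim, Finset.ne_of_mem_erase hb, Finset.ne_of_mem_erase hc]) hz hz',
    e₁, e₂, form_eq_sum, form_eq_sum, mul_comm, Finset.sum_mul_sum, ← Finset.sum_add_distrib]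
  refine Finset.sum_congr rfl fun b _ => ?_
  rw [← Finset.sum_add_distrib]
  exact Finset.sum_congr rfl fun c _ => by rw [Matrix.of_apply]; ring

/-- If a vector `w` of the scenario has a non-zero component at `a`, then `a` can be eliminated
with its help. -/
theorem Represents.exists_radical (hM : M.IsSymm) (h : Represents M W U s) (haU : a ∈ U)
    {w : V → ZMod 2} (hw : w ∈ s.1) (hwa : w a = 1) :
    ∃ q ∈ radical M W, form M (Pi.single a 1) q = 1 := by
  by_contra! hne
  have hq : ∀ q ∈ radical M W, form M (Pi.single a 1) q = 0 := fun q hq =>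
    (zmod_two_eq_zero_or_one _).resolve_right (hne q hq)
  -- If the unit vector at a were orthogonal to the radical, it could be moved into the orthogonal
  -- space, so it would satisfy the equation w; but its product with w is the component of w at a.
  have := (h.exists_iff _ (single_mem_supportedOn haU 1)).1 (exists_add_mem_orth hM hq) w hw
  simp [hwa] at this

/-- The equation w forces t = w · z, and substituting this into another equation c gives c + c_a w.
Orthogonality to the unit vector at a is no restriction: adding a radical vector that pairs to 1
with it repairs a wrong value without leaving the orthogonal space. -/
theorem Represents.forget_edge (hM : M.IsSymm) (h : Represents M W U s) (haU : a ∈ U)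
    (haW : a ∉ W) {w : V → ZMod 2} (hw : w ∈ s.1) (hwa : w a = 1) {s' : Scenario V}
    (h₁ : ∀ c', c' ∈ s'.1 ↔ ∃ c ∈ s.1, c ≠ w ∧ c' = delVec a (c + c a • w))
    (h₂ : s'.2 = edgeElim a w s.2) : Represents M (insert a W) (U.erase a) s' := by
  obtain ⟨q, hq, hqe⟩ := h.exists_radical hM haU hw hwa
  have hU : ∀ z ∈ supportedOn (U.erase a), ∀ t : ZMod 2,
      z + t • Pi.single a 1 ∈ supportedOn U := fun z hz t => by
    have := add_smul_single_mem_supportedOn_insert (a := a) hz t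
    rwa [Finset.insert_erase haU] at this
  have ht : ∀ z ∈ supportedOn (U.erase a), ∀ t : ZMod 2,
      (∃ p ∈ supportedOn W, p + (z + t • Pi.single a 1) ∈ orth M W ∧
        form M (Pi.single a 1) (p + (z + t • Pi.single a 1)) = 0) → t = w ⬝ᵥ z := by
    rintro z hz t ⟨p, hp, hpo, -⟩
    have := (h.exists_iff _ (hU z hz t)).1 ⟨p, hp, hpo⟩ w hw
    rw [dotProduct_add_smul_single, hwa, mul_one, zmod_two_add_eq_zero_iff] at this
    exact this.symm
  have hc : ∀ z ∈ supportedOn (U.erase a), ∀ c : V → ZMod 2,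
      delVec a (c + c a • w) ⬝ᵥ z = c ⬝ᵥ (z + (w ⬝ᵥ z) • Pi.single a 1) := fun z hz c => by
    rw [delVec_dotProduct (hz a (Finset.notMem_erase _ _)), dotProduct_add_smul_single,
      add_dotProduct, smul_dotProduct, smul_eq_mul, mul_comm]
  refine h.forget_of haU haW (fun z hz => ⟨fun hz' => ?_, ?_⟩) (fun z hz z' hz' t t' h₃ h₄ => ?_)
  · have : ∃ p ∈ supportedOn W, p + (z + (w ⬝ᵥ z) • Pi.single a 1) ∈ orth M W := by
      refine (h.exists_iff _ (hU z hz _)).2 fun c hcs => ?_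
      by_cases hcw : c = w
      · subst hcw
        rw [dotProduct_add_smul_single, hwa, mul_one]
        exact CharTwo.add_self_eq_zero _
      · rw [← hc z hz]
        exact hz' _ ((h₁ _).2 ⟨c, hcs, hcw, rfl⟩)
    obtain ⟨p, hp, hpo⟩ := this
    refine ⟨w ⬝ᵥ z, ?_⟩
    rcases zmod_two_eq_zero_or_one
      (form M (Pi.single a 1) (p + (z + (w ⬝ᵥ z) • Pi.single a 1))) with h0 | h1
    · exact ⟨p, hp, hpo, h0⟩
    · refine ⟨p + q, add_mem hp hq.1, ?_, ?_⟩
      · rw [add_right_comm]; exact add_mem hpo hq.2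
      · rw [add_right_comm, form_add_right, h1, hqe]; rfl
  · rintro ⟨t, hex⟩ c' hc'
    have htz := ht z hz t hex
    subst htz
    obtain ⟨p, hp, hpo, -⟩ := hex
    obtain ⟨c, hcs, -, rfl⟩ := (h₁ _).1 hc'
    rw [hc z hz]
    exact (h.exists_iff _ (hU z hz _)).1 ⟨p, hp, hpo⟩ c hcs
  · rw [ht z hz t h₃, ht z' hz' t' h₄, h₂, form_edgeElim _ hz hz']

/-- If no vector of the scenario has a non-zero component at `a`, the form of `a` with a vector
in the orthogonal complement of `W` can be read off the scenario. -/
theorem Represents.form_single (h : Represents M W U s) (haU : a ∈ U)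
    (hs : ∀ c ∈ s.1, c a = 0) {z p : V → ZMod 2} (hz : z ∈ supportedOn U)
    (hp : p ∈ supportedOn W) (hpz : p + z ∈ orth M W) :
    form M (Pi.single a 1) (p + z) = form s.2 (Pi.single a 1) z := by
  have hea := single_mem_supportedOn haU 1
  -- The unit vector at a satisfies all equations, so it has a lift into the orthogonal space. The
  -- correction p₀ pairs to zero with p + z.
  obtain ⟨p₀, hp₀, ho⟩ := (h.exists_iff _ hea).2 fun c hc => by simp [hs c hc]
  rw [← h.form_eq _ hea z hz p₀ hp₀ p hp ho hpz, form_add_left, hpz p₀ hp₀, zero_add]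

theorem delVec_eq_self {c : V → ZMod 2} (h : c a = 0) : delVec a c = c := by
  rw [delVec, ← h, Function.update_eq_self]

/-- Orthogonality to the unit vector at a reads (row a of the matrix) · z + t = 0, which determines
t. The equations do not involve a and remain. -/
theorem Represents.forget_loop (h : Represents M W U s) (haU : a ∈ U)
    (haW : a ∉ W) (hsymm : s.2.IsSymm) (hs : ∀ c ∈ s.1, c a = 0) (ha : s.2 a a = 1)
    {s' : Scenario V} (h₁ : s'.1 = s.1) (h₂ : s'.2 = delMat a (loopElim a s.2)) :
    Represents M (insert a W) (U.erase a) s' := by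
  have hU : ∀ z ∈ supportedOn (U.erase a), ∀ t : ZMod 2,
      z + t • Pi.single a 1 ∈ supportedOn U := fun z hz t => by
    have := add_smul_single_mem_supportedOn_insert (a := a) hz t
    rwa [Finset.insert_erase haU] at this
  have hf : ∀ z ∈ supportedOn (U.erase a), ∀ t : ZMod 2, ∀ p ∈ supportedOn W,
      p + (z + t • Pi.single a 1) ∈ orth M W →
        (form M (Pi.single a 1) (p + (z + t • Pi.single a 1)) = 0 ↔
          t = form s.2 (Pi.single a 1) z) := fun z hz t p hp hpo => by
    rw [h.form_single haU hs (hU z hz t) hp hpo, form_add_right, form_smul_right,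
      form_single_single, ha, mul_one, zmod_two_add_eq_zero_iff, eq_comm]
  refine h.forget_of haU haW (fun z hz => ⟨fun hz' => ?_, ?_⟩) (fun z hz z' hz' t t' h₃ h₄ => ?_)
  · rw [h₁] at hz'
    obtain ⟨p, hp, hpo⟩ := (h.exists_iff _ (hU z hz (form s.2 (Pi.single a 1) z))).2
      fun c hc => by rw [dotProduct_add_smul_single, hs c hc, hz' c hc]; simp
    exact ⟨_, p, hp, hpo, (hf z hz _ p hp hpo).2 rfl⟩
  · rintro ⟨t, p, hp, hpo, -⟩ c hc
    rw [h₁] at hc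
    simpa [dotProduct_add_smul_single, hs c hc] using
      (h.exists_iff _ (hU z hz t)).1 ⟨p, hp, hpo⟩ c hc
  · obtain ⟨p, hp, hpo, h0⟩ := h₃
    obtain ⟨p', hp', hpo', h0'⟩ := h₄
    have e₁ := (hf z hz t p hp hpo).1 h0
    have e₂ := (hf z' hz' t' p' hp' hpo').1 h0'
    rw [h₂, form_delMat hz hz', form_loopElim hz hz']
    simp only [form_add_left, form_add_right, form_smul_left, form_smul_right, form_single_single,
      ha, form_comm z (Pi.single a 1) hsymm, ← e₁, ← e₂]
    -- The substitution yields the product of the coefficients three times; two copies cancel.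
    linear_combination (t * t') * (by decide : (2 : ZMod 2) = 0)

/-- Here orthogonality to the unit vector at a does not involve t. It becomes the new equation
(column a) · z = 0, and where this holds the form does not depend on t, so t = 0 can be taken. -/
theorem Represents.forget_isolated (h : Represents M W U s) (haU : a ∈ U)
    (haW : a ∉ W) (hsymm : s.2.IsSymm) (hs : ∀ c ∈ s.1, c a = 0) (ha : s.2 a a = 0)
    {s' : Scenario V}
    (h₁ : Submodule.span (ZMod 2) (s'.1 : Set (V → ZMod 2)) = Submodule.span (ZMod 2)
      (insert (delVec a fun i => s.2 i a) (s.1 : Set (V → ZMod 2))))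
    (h₂ : s'.2 = delMat a s.2) :
    Represents M (insert a W) (U.erase a) s' := by
  have hU : ∀ z ∈ supportedOn (U.erase a), ∀ t : ZMod 2,
      z + t • Pi.single a 1 ∈ supportedOn U := fun z hz t => by
    have := add_smul_single_mem_supportedOn_insert (a := a) hz t
    rwa [Finset.insert_erase haU] at this
  have hf : ∀ z ∈ supportedOn (U.erase a), ∀ t : ZMod 2, ∀ p ∈ supportedOn W,
      p + (z + t • Pi.single a 1) ∈ orth M W →
        form M (Pi.single a 1) (p + (z + t • Pi.single a 1)) =
          form s.2 (Pi.single a 1) z := fun z hz t p hp hpo => by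
    rw [h.form_single haU hs (hU z hz t) hp hpo, form_add_right, form_smul_right,
      form_single_single, ha, mul_zero, add_zero]
  have hcol : ∀ z ∈ supportedOn (U.erase a),
      (delVec a fun i => s.2 i a) ⬝ᵥ z = form s.2 (Pi.single a 1) z := fun z hz => by
    rw [delVec_dotProduct (hz a (Finset.notMem_erase _ _)), form_comm _ _ hsymm, form,
      dotProduct_comm]
    congr 1
    ext i
    simp
  refine h.forget_of haU haW (fun z hz => ?_) (fun z hz z' hz' t t' h₃ h₄ => ?_)
  · have := forall_dotProduct_eq_zero_iff_of_span_eq h₁ z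
    simp only [Finset.mem_coe, Set.mem_insert_iff, forall_eq_or_imp, hcol z hz] at this
    rw [this]
    constructor
    · rintro ⟨h0, hz'⟩
      obtain ⟨p, hp, hpo⟩ := (h.exists_iff _ (hU z hz 0)).2
        fun c hc => by rw [dotProduct_add_smul_single, hs c hc, hz' c hc]; simp
      exact ⟨0, p, hp, hpo, (hf z hz _ p hp hpo).trans h0⟩
    · rintro ⟨t, p, hp, hpo, h0⟩
      refine ⟨(hf z hz _ p hp hpo).symm.trans h0, fun c hc => ?_⟩
      simpa [dotProduct_add_smul_single, hs c hc] using
        (h.exists_iff _ (hU z hz t)).1 ⟨p, hp, hpo⟩ c hc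
  · obtain ⟨p, hp, hpo, h0⟩ := h₃
    obtain ⟨p', hp', hpo', h0'⟩ := h₄
    rw [hf z hz t p hp hpo] at h0
    rw [hf z' hz' t' p' hp' hpo'] at h0'
    rw [h₂, form_delMat hz hz']
    simp only [form_add_left, form_add_right, form_smul_left, form_smul_right, form_single_single,
      ha, form_comm z (Pi.single a 1) hsymm, h0, h0']
    ring

/-! ### The rank increase -/

theorem mem_radical_insert {x : V → ZMod 2} (haW : a ∉ W) :
    x ∈ radical M (insert a W) ↔ ∃ p ∈ supportedOn W, ∃ t : ZMod 2, x = p + t • Pi.single a 1 ∧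
      p + t • Pi.single a 1 ∈ orth M W ∧
      form M (Pi.single a 1) (p + t • Pi.single a 1) = 0 := by
  constructor
  · rintro ⟨hx, hx'⟩
    obtain ⟨p, hp, t, rfl⟩ := exists_add_of_mem_supportedOn_insert hx haW
    exact ⟨p, hp, t, rfl, (mem_orth_insert haW).1 hx'⟩
  · rintro ⟨p, hp, t, rfl, h⟩
    exact ⟨add_smul_single_mem_supportedOn_insert hp t, (mem_orth_insert haW).2 h⟩

/-- The equation w forces the coefficient at a to be zero. The new radical is thus the kernel,
inside the old one, of pairing with the unit vector at a, and this functional is nonzero by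
`Represents.exists_radical`. -/
theorem Represents.finrank_radical_edge (hM : M.IsSymm) (h : Represents M W U s) (haU : a ∈ U)
    (haW : a ∉ W) {w : V → ZMod 2} (hw : w ∈ s.1) (hwa : w a = 1) :
    Module.finrank (ZMod 2) (radical M (insert a W)) + 1 =
      Module.finrank (ZMod 2) (radical M W) := by
  obtain ⟨q, hq, hqe⟩ := h.exists_radical hM haU hw hwa
  have hnot : q ∉ radical M (insert a W) := fun hq' => by
    have := ((mem_orth_insert haW).1 hq'.2).2
    rw [hqe] at this
    exact one_ne_zero this
  have hle : radical M (insert a W) ≤ radical M W := fun x hx => by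
    obtain ⟨p, hp, t, rfl, ho, -⟩ := (mem_radical_insert haW).1 hx
    have := (h.exists_iff _ (Submodule.smul_mem _ t (single_mem_supportedOn haU 1))).1
      ⟨p, hp, ho⟩ w hw
    have ht : t = 0 := by simpa [dotProduct_smul, hwa] using this
    subst ht
    rw [zero_smul, add_zero] at ho ⊢
    exact ⟨hp, ho⟩
  have hsup : radical M W = radical M (insert a W) ⊔ Submodule.span (ZMod 2) {q} := by
    refine le_antisymm (fun x hx => ?_) (sup_le hle ((Submodule.span_singleton_le_iff_mem _ _).2 hq))
    have key : ∀ x ∈ radical M W, form M (Pi.single a 1) x = 0 → x ∈ radical M (insert a W) :=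
      fun x hx h0 => ⟨supportedOn_mono (Finset.subset_insert _ _) hx.1,
        (mem_orth_insert haW).2 ⟨hx.2, h0⟩⟩
    refine Submodule.mem_sup.2 ⟨x - form M (Pi.single a 1) x • q, key _ (sub_mem hx
      (Submodule.smul_mem _ _ hq)) ?_, form M (Pi.single a 1) x • q,
      Submodule.smul_mem _ _ (Submodule.mem_span_singleton_self q), sub_add_cancel _ _⟩
    rw [sub_eq_add_neg, ← neg_smul, form_add_right, form_smul_right, hqe]
    ring
  have hq0 : q ≠ 0 := fun h0 => hnot (h0 ▸ zero_mem _)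
  have := Submodule.finrank_sup_add_finrank_inf_eq (radical M (insert a W))
    (Submodule.span (ZMod 2) {q})
  rw [← hsup, finrank_span_singleton hq0] at this
  have hinf : radical M (insert a W) ⊓ Submodule.span (ZMod 2) {q} = ⊥ :=
    (Submodule.disjoint_span_singleton' hq0).2 hnot |>.eq_bot
  rw [hinf, finrank_bot] at this
  omega

/-- For a vector in the orthogonal space, pairing with the unit vector at a returns the coefficient
at a. So the new condition and the new dimension cancel, and the radical itself is unchanged. -/
theorem Represents.finrank_radical_loop (h : Represents M W U s) (haU : a ∈ U)
    (haW : a ∉ W) (hs : ∀ c ∈ s.1, c a = 0) (ha : s.2 a a = 1) :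
    Module.finrank (ZMod 2) (radical M (insert a W)) =
      Module.finrank (ZMod 2) (radical M W) := by
  have hf : ∀ p ∈ supportedOn W, ∀ t : ZMod 2, p + t • Pi.single a 1 ∈ orth M W →
      form M (Pi.single a 1) (p + t • Pi.single a 1) = t := fun p hp t ho => by
    rw [h.form_single haU hs (Submodule.smul_mem _ t (single_mem_supportedOn haU 1)) hp ho,
      form_smul_right, form_single_single, ha, mul_one]
  refine congrArg (fun S : Submodule (ZMod 2) (V → ZMod 2) => Module.finrank (ZMod 2) S) ?_
  ext x
  rw [mem_radical_insert haW]
  constructor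
  · rintro ⟨p, hp, t, rfl, ho, h0⟩
    rw [hf p hp t ho] at h0
    subst h0
    rw [zero_smul, add_zero] at ho ⊢
    exact ⟨hp, ho⟩
  · rintro ⟨hp, ho⟩
    have hx : x = x + (0 : ZMod 2) • Pi.single a 1 := by rw [zero_smul, add_zero]
    refine ⟨x, hp, 0, hx, hx ▸ ho, hf x hp 0 (hx ▸ ho)⟩

/-- Pairing with the unit vector at a vanishes on all candidates, so no condition is added, while
the lift of that unit vector is a new element spanning a complement of the old radical. -/
theorem Represents.finrank_radical_isolated (h : Represents M W U s) (haU : a ∈ U)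
    (haW : a ∉ W) (hs : ∀ c ∈ s.1, c a = 0) (ha : s.2 a a = 0) :
    Module.finrank (ZMod 2) (radical M (insert a W)) =
      Module.finrank (ZMod 2) (radical M W) + 1 := by
  have hf : ∀ p ∈ supportedOn W, ∀ t : ZMod 2, p + t • Pi.single a 1 ∈ orth M W →
      form M (Pi.single a 1) (p + t • Pi.single a 1) = 0 := fun p hp t ho => by
    rw [h.form_single haU hs (Submodule.smul_mem _ t (single_mem_supportedOn haU 1)) hp ho,
      form_smul_right, form_single_single, ha, mul_zero]
  obtain ⟨p₀, hp₀, ho⟩ := (h.exists_iff _ (single_mem_supportedOn haU 1)).2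
    fun c hc => by simp [hs c hc]
  have ho' : p₀ + (1 : ZMod 2) • Pi.single a 1 ∈ orth M W := by rwa [one_smul]
  set q : V → ZMod 2 := p₀ + (1 : ZMod 2) • Pi.single a 1 with hqdef
  have hqa : q a = 1 := by simp [q, hp₀ a haW]
  have hq : q ∈ radical M (insert a W) :=
    (mem_radical_insert haW).2 ⟨p₀, hp₀, 1, rfl, ho', hf p₀ hp₀ 1 ho'⟩
  have hnot : q ∉ radical M W := fun hq' => by
    have := hq'.1 a haW
    rw [hqa] at this
    exact one_ne_zero this
  have hq0 : q ≠ 0 := fun h0 => hnot (h0 ▸ zero_mem _)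
  have hsup : radical M (insert a W) = radical M W ⊔ Submodule.span (ZMod 2) {q} := by
    refine le_antisymm (fun x hx => ?_) (sup_le (fun x hx => ?_)
      ((Submodule.span_singleton_le_iff_mem _ _).2 hq))
    · obtain ⟨p, hp, t, rfl, hpo, -⟩ := (mem_radical_insert haW).1 hx
      refine Submodule.mem_sup.2 ⟨p + t • Pi.single a 1 - t • q, ⟨?_, sub_mem hpo
        (Submodule.smul_mem _ _ ho')⟩, t • q,
        Submodule.smul_mem _ _ (Submodule.mem_span_singleton_self q), sub_add_cancel _ _⟩
      have : p + t • Pi.single a 1 - t • q = p - t • p₀ := by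
        rw [hqdef, one_smul, smul_add]; abel
      rw [this]
      exact sub_mem hp (Submodule.smul_mem _ _ hp₀)
    · have hx0 : x = x + (0 : ZMod 2) • Pi.single a 1 := by rw [zero_smul, add_zero]
      exact (mem_radical_insert haW).2 ⟨x, hx.1, 0, hx0, hx0 ▸ hx.2, hf x hx.1 0 (hx0 ▸ hx.2)⟩
  have := Submodule.finrank_sup_add_finrank_inf_eq (radical M W) (Submodule.span (ZMod 2) {q})
  rw [← hsup, finrank_span_singleton hq0, ((Submodule.disjoint_span_singleton' hq0).2
    hnot).eq_bot, finrank_bot] at this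
  omega

end Forget

/-! ### The lexicographically minimal basis. -/

section MinBasis

variable {V : Type*} {ord : List V}

theorem entries_injective (h : ∀ a, a ∈ ord) : Function.Injective (entries ord) := fun _ _ hcd =>
  funext fun a => ZMod.val_injective 2 (List.map_inj_left.1 hcd a (h a))

theorem mem_minBasis {C : Finset (V → ZMod 2)} {c : V → ZMod 2} :
    c ∈ minBasis ord C ↔ c ∈ C ∧
      c ∉ Submodule.span (ZMod 2) {d | d ∈ C ∧ entries ord d < entries ord c} := by
  simp only [minBasis, Finset.mem_filter]

theorem minBasis_subset (C : Finset (V → ZMod 2)) : minBasis ord C ⊆ C := fun _ h =>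
  (mem_minBasis.1 h).1

/-- Well-founded induction: a rejected vector lies in the span of smaller ones. On a finite type any
strict order is well-founded, so `ord` may be arbitrary. -/
theorem span_minBasis [Finite V] (C : Finset (V → ZMod 2)) :
    Submodule.span (ZMod 2) (minBasis ord C : Set (V → ZMod 2)) =
      Submodule.span (ZMod 2) (C : Set (V → ZMod 2)) := by
  refine le_antisymm (Submodule.span_mono (by exact_mod_cast minBasis_subset C))
    (Submodule.span_le.2 fun c hc => ?_)
  let r : (V → ZMod 2) → (V → ZMod 2) → Prop := fun c d => entries ord c < entries ord d
  have : IsTrans (V → ZMod 2) r := ⟨fun _ _ _ h₁ h₂ => lt_trans h₁ h₂⟩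
  have : Std.Irrefl r := ⟨fun _ h => lt_irrefl _ h⟩
  have wf : WellFounded r := Finite.wellFounded_of_trans_of_irrefl r
  induction c using wf.induction with
  | _ c ih =>
    by_cases hcm : c ∈ minBasis ord C
    · exact Submodule.subset_span hcm
    · have : c ∈ Submodule.span (ZMod 2) {d | d ∈ C ∧ entries ord d < entries ord c} := by
        by_contra h
        exact hcm (mem_minBasis.2 ⟨hc, h⟩)
      exact Submodule.span_le.2 (fun d hd => ih d hd.2 hd.1) this

/-- Vectors are adjoined in increasing order. One that depends on its predecessors would not have
been selected; the predecessors are strictly smaller because `ord` lists all vertices. -/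
theorem linearIndepOn_minBasis (hord : ∀ a, a ∈ ord) (C : Finset (V → ZMod 2)) :
    LinearIndepOn (ZMod 2) id (minBasis ord C : Set (V → ZMod 2)) := by
  classical
  suffices ∀ S : Finset (V → ZMod 2), S ⊆ minBasis ord C →
      LinearIndepOn (ZMod 2) id (S : Set (V → ZMod 2)) from this _ subset_rfl
  intro S
  refine Finset.induction_on_max_value (motive := fun S => S ⊆ minBasis ord C →
      LinearIndepOn (ZMod 2) id (S : Set (V → ZMod 2))) (entries ord) S (fun _ => by simp) ?_
  · intro a S ha hmax ih hS
    rw [Finset.coe_insert]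
    refine (ih ((Finset.subset_insert _ _).trans hS)).id_insert fun hspan => ?_
    refine (mem_minBasis.1 (hS (Finset.mem_insert_self _ _))).2
      (Submodule.span_mono (t := {d | d ∈ C ∧ entries ord d < entries ord a})
        (fun d hd => ⟨?_, lt_of_le_of_ne (hmax d hd) fun h => ha ?_⟩) hspan)
    · exact minBasis_subset C (hS (Finset.mem_insert_of_mem hd))
    · exact entries_injective hord h ▸ hd

end MinBasis

/-! ### The operations map scenarios to scenarios. -/

section Preservation

variable {V : Type*} [Fintype V] [DecidableEq V] {U : Finset V} {s : Scenario V} {a : V} {ord : List V}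
  {G : LoopGraph V}

theorem isScenario_emptyScenario : IsScenario (∅ : Finset V) emptyScenario := by
  refine ⟨by simp [emptyScenario], by simp [emptyScenario], ?_, by simp [emptyScenario]⟩
  exact Matrix.isSymm_zero

theorem IsScenario.eq_emptyScenario (h : IsScenario (∅ : Finset V) s) : s = emptyScenario := by
  obtain ⟨h₁, h₂, -, h₄⟩ := h
  refine Prod.ext (Finset.eq_empty_of_forall_notMem fun c hc => ?_) ?_
  · have h0 : c = 0 := funext fun a => h₁ c hc a (by simp)
    exact h₂.ne_zero hc h0
  · ext a b
    exact h₄ a b (Or.inl (Finset.notMem_empty a))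

theorem adjOn_eq_zero {b : V} (h : a ∉ U ∨ b ∉ U) : adjOn G U a b = 0 := by
  rw [adjOn, if_neg]
  rintro ⟨h₁, h₂, -⟩
  exact h.elim (· h₁) (· h₂)

theorem isSymm_adjOn (G : LoopGraph V) (U : Finset V) : (adjOn G U).IsSymm := by
  ext a b
  rw [Matrix.transpose_apply, adjOn, adjOn]
  congr 1
  exact propext ⟨fun h => ⟨h.2.1, h.1, G.symm _ _ h.2.2⟩, fun h => ⟨h.2.1, h.1, G.symm _ _ h.2.2⟩⟩

theorem IsScenario.join {s₁ s₂ : Scenario V} (hord : ∀ a, a ∈ ord) (h₁ : IsScenario U s₁)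
    (h₂ : IsScenario U s₂) : IsScenario U (joinScenario ord G U s₁ s₂) := by
  refine ⟨fun c hc => ?_, linearIndepOn_minBasis hord _, ?_, fun b c hbc => ?_⟩
  · have hc := minBasis_subset _ hc
    simp only [Finset.mem_union] at hc
    rcases hc with h | h
    · exact h₁.1 c h
    · exact h₂.1 c h
  · exact ((isSymm_adjOn G U).add (h₁.2.2.1.sub (isSymm_adjOn G U))).add
      (h₂.2.2.1.sub (isSymm_adjOn G U))
  · simp [joinScenario, adjOn_eq_zero hbc, h₁.2.2.2 b c hbc, h₂.2.2.2 b c hbc]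

theorem IsScenario.introduce (h : IsScenario U s) :
    IsScenario (insert a U) (introduceScenario G (insert a U) a s) := by
  obtain ⟨h₁, h₂, h₃, h₄⟩ := h
  refine ⟨fun c hc b hb => h₁ c hc b fun h => hb (Finset.mem_insert_of_mem h), h₂, ?_,
    fun b c hbc => ?_⟩
  · ext b c
    rw [Matrix.transpose_apply]
    simp only [introduceScenario]
    simp only [(isSymm_adjOn G (insert a U)).apply b c, h₃.apply b c, or_comm]
  · simp only [introduceScenario]
    split_ifs with h
    · exact adjOn_eq_zero hbc
    · exact h₄ b c (hbc.imp (fun h h' => h (Finset.mem_insert_of_mem h'))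
        fun h h' => h (Finset.mem_insert_of_mem h'))

/-- A scenario of U has zeros in row and column a, so nothing is lost by overwriting them.
Consequently the assignments at an introduce node never collide. -/
theorem introduceScenario_injOn (ha : a ∉ U) :
    Set.InjOn (introduceScenario G (insert a U) a) {s | IsScenario U s} := by
  intro s hs t ht hst
  have h₁ := congrArg Prod.fst hst
  have h₂ := congrArg Prod.snd hst
  refine Prod.ext h₁ ?_
  ext b c
  by_cases h : b = a ∨ c = a
  · have hU : b ∉ U ∨ c ∉ U := h.imp (fun h => by rwa [h]) fun h => by rwa [h]
    rw [hs.2.2.2 b c hU, ht.2.2.2 b c hU]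
  · simpa [introduceScenario, h] using congrFun (congrFun h₂ b) c

theorem delVec_apply_eq_zero {c : V → ZMod 2} {b : V} (h : b ∉ U → c b = 0)
    (hb : b ∉ U.erase a) : delVec a c b = 0 := by
  by_cases hba : b = a
  · simp [delVec, hba]
  · simpa [delVec, hba] using h fun h => hb (Finset.mem_erase.2 ⟨hba, h⟩)

theorem isSymm_delMat {M : Matrix V V (ZMod 2)} (h : M.IsSymm) : (delMat a M).IsSymm := by
  ext b c
  rw [Matrix.transpose_apply]
  simp only [delMat, h.apply b c, or_comm]

theorem delMat_apply_eq_zero {M : Matrix V V (ZMod 2)} {b c : V}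
    (h : b ∉ U ∨ c ∉ U → M b c = 0) (hbc : b ∉ U.erase a ∨ c ∉ U.erase a) :
    delMat a M b c = 0 := by
  rw [delMat]
  split_ifs with hba
  · rfl
  · rw [not_or] at hba
    exact h (hbc.imp (fun h h' => h (Finset.mem_erase.2 ⟨hba.1, h'⟩))
      fun h h' => h (Finset.mem_erase.2 ⟨hba.2, h'⟩))

theorem IsScenario.ignore (hord : ∀ a, a ∈ ord) (h : IsScenario U s) :
    IsScenario (U.erase a) (ignoreScenario ord a s) := by
  refine ⟨fun c hc b hb => ?_, linearIndepOn_minBasis hord _, isSymm_delMat h.2.2.1,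
    fun b c hbc => delMat_apply_eq_zero (h.2.2.2 b c) hbc⟩
  have hc' := minBasis_subset _ hc
  simp only [Finset.mem_image] at hc'
  obtain ⟨c, hc', rfl⟩ := hc'
  exact delVec_apply_eq_zero (h.1 c hc' b) hb

/-- The linear map that underlies the elimination of a vertex by means of a vector. -/
def elimVec (a : V) (w : V → ZMod 2) : (V → ZMod 2) →ₗ[ZMod 2] (V → ZMod 2) where
  toFun c := delVec a (c + c a • w)
  map_add' c d := by
    ext b
    by_cases hb : b = a
    · simp [delVec, hb]
    · simp [delVec, hb]; ring
  map_smul' t c := by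
    ext b
    by_cases hb : b = a
    · simp [delVec, hb]
    · simp [delVec, hb]; ring

theorem forgetIsolated_fst (ha : ∀ c ∈ s.1, c a = 0) :
    ((delVec a fun i => s.2 i a) ∈ Submodule.span (ZMod 2) (s.1 : Set (V → ZMod 2)) ∧
      ((forgetIsolated a s).1 : Set (V → ZMod 2)) = s.1) ∨
    ((delVec a fun i => s.2 i a) ∉ Submodule.span (ZMod 2) (s.1 : Set (V → ZMod 2)) ∧
      ((forgetIsolated a s).1 : Set (V → ZMod 2)) = insert (delVec a fun i => s.2 i a) (s.1 : Set (V → ZMod 2))) := by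
  have himg : @Finset.image _ _ (fun _ _ => Classical.propDecidable _) (delVec a) s.1 = s.1 := by
    ext c
    rw [@Finset.mem_image _ _ (fun _ _ => Classical.propDecidable _)]
    constructor
    · rintro ⟨c, hc, rfl⟩; rwa [delVec_eq_self (ha c hc)]
    · intro hc; exact ⟨c, hc, delVec_eq_self (ha c hc)⟩
  -- Unfolding with the classical decidability instances of the definition, so that the image can be
  -- rewritten inside the `if` condition as well.
  have key : forgetIsolated a s = (@ite _ ((delVec a fun i => s.2 i a) ∈ Submodule.span (ZMod 2)
      ((@Finset.image _ _ (fun _ _ => Classical.propDecidable _) (delVec a) s.1 :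
        Finset (V → ZMod 2)) : Set (V → ZMod 2))) (Classical.propDecidable _)
      (@Finset.image _ _ (fun _ _ => Classical.propDecidable _) (delVec a) s.1)
      (@insert _ _ (@Finset.instInsert _ fun _ _ => Classical.propDecidable _)
        (delVec a fun i => s.2 i a)
        (@Finset.image _ _ (fun _ _ => Classical.propDecidable _) (delVec a) s.1)),
      delMat a s.2) := rfl
  rw [key, himg]
  split_ifs with hspan
  · exact Or.inl ⟨hspan, rfl⟩
  · refine Or.inr ⟨hspan, ?_⟩
    ext c
    simp only [Finset.mem_coe, Finset.mem_insert, Set.mem_insert_iff]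

theorem span_forgetIsolated_fst (ha : ∀ c ∈ s.1, c a = 0) :
    Submodule.span (ZMod 2) ((forgetIsolated a s).1 : Set (V → ZMod 2)) =
      Submodule.span (ZMod 2) (insert (delVec a fun i => s.2 i a) (s.1 : Set (V → ZMod 2))) := by
  rcases forgetIsolated_fst ha with ⟨h, e⟩ | ⟨-, e⟩ <;> rw [e]
  exact (Submodule.span_insert_eq_span h).symm

theorem IsScenario.forgetIsolated (h : IsScenario U s) (ha : ∀ c ∈ s.1, c a = 0) :
    IsScenario (U.erase a) (forgetIsolated a s) := by
  have hC : ∀ c ∈ s.1, ∀ b ∉ U.erase a, c b = 0 := fun c hc b hb => by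
    rw [← delVec_eq_self (ha c hc)]
    exact delVec_apply_eq_zero (h.1 c hc b) hb
  refine ⟨fun c hc b hb => ?_, ?_, isSymm_delMat h.2.2.1,
    fun b c hbc => delMat_apply_eq_zero (h.2.2.2 b c) hbc⟩
  · rw [← Finset.mem_coe] at hc
    rcases forgetIsolated_fst ha with ⟨-, e⟩ | ⟨-, e⟩ <;> rw [e] at hc
    · exact hC c hc b hb
    · rcases hc with rfl | hc
      · exact delVec_apply_eq_zero (fun h' => h.2.2.2 b a (Or.inl h')) hb
      · exact hC c hc b hb
  · rcases forgetIsolated_fst ha with ⟨-, e⟩ | ⟨h', e⟩ <;> rw [e]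
    · exact h.2.1
    · exact h.2.1.id_insert h'

theorem IsScenario.loopElim (h : IsScenario U s) (ha : a ∈ U) :
    IsScenario U (s.1, loopElim a s.2) := by
  refine ⟨h.1, h.2.1, ?_, fun b c hbc => ?_⟩
  · ext b c
    rw [Matrix.transpose_apply]
    simp only [Interlace.loopElim, h.2.2.1.apply b c, h.2.2.1.apply a c, h.2.2.1.apply a b,
      or_comm, and_comm, mul_comm]
  · have hne : ¬ (b = a ∧ c = a) := by
      rintro ⟨rfl, rfl⟩
      exact hbc.elim (· ha) (· ha)
    simp only [Interlace.loopElim, hne, if_false]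
    split_ifs
    · rfl
    · rcases hbc with hb | hc
      · rw [h.2.2.2 b c (Or.inl hb), h.2.2.2 b a (Or.inl hb), mul_zero, add_zero]
      · rw [h.2.2.2 b c (Or.inr hc), h.2.2.2 a c (Or.inr hc), zero_mul, add_zero]

theorem isSymm_edgeElim {M : Matrix V V (ZMod 2)} (h : M.IsSymm) (w : V → ZMod 2) :
    (edgeElim a w M).IsSymm := by
  refine isSymm_delMat ?_
  refine Matrix.ext fun b c => ?_
  change M c b + w b * M c a + w c * M a b + w b * w c * M a a =
    M b c + w c * M b a + w b * M a c + w c * w b * M a a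
  rw [h.apply b c, h.apply a c, h.apply a b]
  ring

theorem edgeElim_apply_eq_zero {M : Matrix V V (ZMod 2)} {w : V → ZMod 2}
    (hM : ∀ b c, b ∉ U ∨ c ∉ U → M b c = 0) (hw : ∀ b, b ∉ U → w b = 0) {b c : V}
    (hbc : b ∉ U.erase a ∨ c ∉ U.erase a) : edgeElim a w M b c = 0 := by
  refine delMat_apply_eq_zero (U := U) (fun h => ?_) hbc
  rcases h with hb | hc
  · simp only [hM b c (Or.inl hb), hM b a (Or.inl hb), hw b hb]; ring
  · simp only [hM b c (Or.inr hc), hM a c (Or.inr hc), hw c hc]; ring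

/-- The three cases of forgetting a vertex. -/
theorem forgetScenario_cases (ord : List V) (a : V) (s : Scenario V) :
    (∃ w ∈ s.1, w a = 1 ∧ (∀ c', c' ∈ (forgetScenario ord a s).1.1 ↔
        ∃ c ∈ s.1, c ≠ w ∧ c' = delVec a (c + c a • w)) ∧
      (forgetScenario ord a s).1.2 = edgeElim a w s.2 ∧ (forgetScenario ord a s).2 = 2) ∨
    ((∀ c ∈ s.1, c a = 0) ∧ s.2 a a = 1 ∧
      forgetScenario ord a s = (forgetIsolated a (s.1, loopElim a s.2), 1)) ∨
    ((∀ c ∈ s.1, c a = 0) ∧ s.2 a a = 0 ∧ forgetScenario ord a s = (forgetIsolated a s, 0)) := by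
  by_cases h : (s.1.filter fun c => c a = 1).Nonempty
  · refine Or.inl ⟨minVector ord _ h, ?_⟩
    have hw := ((s.1.filter fun c => c a = 1).exists_min_image (entries ord) h).choose_spec.1
    rw [Finset.mem_filter] at hw
    refine ⟨hw.1, hw.2, fun c' => ?_, ?_, ?_⟩
    · simp only [forgetScenario, h, dif_pos, Finset.mem_image, Finset.mem_erase]
      constructor
      · rintro ⟨c, ⟨h₁, h₂⟩, rfl⟩; exact ⟨c, h₂, h₁, rfl⟩
      · rintro ⟨c, h₁, h₂, rfl⟩; exact ⟨c, ⟨h₂, h₁⟩, rfl⟩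
    · simp only [forgetScenario, h, dif_pos]
    · simp only [forgetScenario, h, dif_pos]
  · refine Or.inr ?_
    have hs : ∀ c ∈ s.1, c a = 0 := fun c hc => by
      by_contra hca
      exact h ⟨c, Finset.mem_filter.2 ⟨hc, (zmod_two_eq_zero_or_one _).resolve_left hca⟩⟩
    by_cases haa : s.2 a a = 1
    · refine Or.inl ⟨hs, haa, ?_⟩
      simp only [forgetScenario, h, dif_neg, not_false_eq_true, haa, if_true]
    · refine Or.inr ⟨hs, (zmod_two_eq_zero_or_one _).resolve_right haa, ?_⟩
      simp only [forgetScenario, h, dif_neg, not_false_eq_true, haa, if_false]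

/-- The kernel of `elimVec` lies on the line through w. Since w is not in the span of the other
vectors, the map is injective on that span and preserves independence. -/
theorem linearIndepOn_elim {S T : Finset (V → ZMod 2)} {w : V → ZMod 2}
    (hS : LinearIndepOn (ZMod 2) id (S : Set (V → ZMod 2))) (hw : w ∈ S) (hwa : w a = 1)
    (hT : ∀ c', c' ∈ T ↔ ∃ c ∈ S, c ≠ w ∧ c' = delVec a (c + c a • w)) :
    LinearIndepOn (ZMod 2) id (T : Set (V → ZMod 2)) := by
  have hcoe : (T : Set (V → ZMod 2)) = elimVec a w '' ((S : Set (V → ZMod 2)) \ {w}) := by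
    ext c'
    simp only [Finset.mem_coe, hT, Set.mem_image, Set.mem_sdiff, Set.mem_singleton_iff]
    constructor
    · rintro ⟨c, h₁, h₂, rfl⟩; exact ⟨c, ⟨h₁, h₂⟩, rfl⟩
    · rintro ⟨c, ⟨h₁, h₂⟩, rfl⟩; exact ⟨c, h₁, h₂, rfl⟩
  rw [hcoe]
  have hw' : w ∉ Submodule.span (ZMod 2) ((S : Set (V → ZMod 2)) \ {w}) := by
    have := (hS.mono Set.sdiff_subset : LinearIndepOn (ZMod 2) id _).notMem_span_iff_id (a := w)
      (s := (S : Set (V → ZMod 2)) \ {w})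
    refine this.2 ⟨?_, fun h => h.2 rfl⟩
    rwa [Set.insert_sdiff_self_of_mem (Finset.mem_coe.2 hw)]
  refine LinearIndepOn.id_image (v := elimVec a w) ?_
  have hker : ∀ c, elimVec a w c = 0 → c = c a • w := fun c hc => by
    ext b
    by_cases hb : b = a
    · subst hb; simp [hwa]
    · have := congrFun hc b
      simp only [elimVec, LinearMap.coe_mk, AddHom.coe_mk, delVec, Function.update_of_ne hb,
        Pi.add_apply, Pi.zero_apply, zmod_two_add_eq_zero_iff] at this
      exact this
  have := (hS.mono Set.sdiff_subset).map_injOn (elimVec a w) (s := (S : Set (V → ZMod 2)) \ {w})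
  refine this fun x hx y hy hxy => ?_
  rw [Set.image_id, SetLike.mem_coe] at hx hy
  have hd := hker (x - y) (by rw [map_sub, hxy, sub_self])
  rcases zmod_two_eq_zero_or_one ((x - y) a) with h0 | h1
  · rw [h0, zero_smul] at hd
    exact sub_eq_zero.1 hd
  · rw [h1, one_smul] at hd
    have := sub_mem hx hy
    rw [hd] at this
    exact absurd this hw'

theorem IsScenario.forget (h : IsScenario U s) (ha : a ∈ U) :
    IsScenario (U.erase a) (forgetScenario ord a s).1 := by
  rcases forgetScenario_cases ord a s with ⟨w, hw, hwa, h₁, h₂, -⟩ | ⟨hs, -, e⟩ | ⟨hs, -, e⟩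
  · refine ⟨fun c' hc' b hb => ?_, linearIndepOn_elim h.2.1 hw hwa h₁, ?_, fun b c hbc => ?_⟩
    · obtain ⟨c, hc, -, rfl⟩ := (h₁ c').1 hc'
      exact delVec_apply_eq_zero (fun hbU => by simp [h.1 c hc b hbU, h.1 w hw b hbU]) hb
    · rw [h₂]; exact isSymm_edgeElim h.2.2.1 w
    · rw [h₂]; exact edgeElim_apply_eq_zero h.2.2.2 (h.1 w hw) hbc
  · rw [e]; exact (h.loopElim ha).forgetIsolated hs
  · rw [e]; exact h.forgetIsolated hs

/-- Forgetting a vertex updates the elimination correctly and computes the rank increase. -/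
theorem Represents.forget {M : Matrix V V (ZMod 2)} {W : Finset V} (hM : M.IsSymm)
    (h : Represents M W U s) (hs : IsScenario U s) (haU : a ∈ U) (haW : a ∉ W) :
    Represents M (insert a W) (U.erase a) (forgetScenario ord a s).1 ∧
      Module.finrank (ZMod 2) (radical M (insert a W)) + (forgetScenario ord a s).2 =
        Module.finrank (ZMod 2) (radical M W) + 1 := by
  rcases forgetScenario_cases ord a s with
    ⟨w, hw, hwa, h₁, h₂, hr⟩ | ⟨hs0, haa, e⟩ | ⟨hs0, haa, e⟩
  · refine ⟨h.forget_edge hM haU haW hw hwa h₁ h₂, ?_⟩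
    rw [hr, ← h.finrank_radical_edge hM haU haW hw hwa]
  · rw [e]
    refine ⟨h.forget_loop haU haW hs.2.2.1 hs0 haa ?_ rfl, ?_⟩
    · have hcol : (delVec a fun i => loopElim a s.2 i a) = 0 := by
        ext b
        by_cases hb : b = a
        · simp [delVec, hb]
        · simp [delVec, hb, loopElim]
      have := forgetIsolated_fst (a := a) (s := (s.1, loopElim a s.2)) hs0
      rw [hcol] at this
      simpa using this
    · exact congrArg (· + 1) (h.finrank_radical_loop haU haW hs0 haa)
  · rw [e]
    exact ⟨h.forget_isolated haU haW hs.2.2.1 hs0 haa (span_forgetIsolated_fst hs0) rfl,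
      h.finrank_radical_isolated haU haW hs0 haa⟩

theorem span_joinScenario_fst (s₁ s₂ : Scenario V) :
    Submodule.span (ZMod 2) ((joinScenario ord G U s₁ s₂).1 : Set (V → ZMod 2)) =
      Submodule.span (ZMod 2) ((s₁.1 : Set (V → ZMod 2)) ∪ s₂.1) := by
  rw [joinScenario, span_minBasis]
  congr 1
  ext c
  simp only [Finset.mem_coe, Finset.mem_union, Set.mem_union]

theorem span_ignoreScenario_fst (s : Scenario V) :
    Submodule.span (ZMod 2) ((ignoreScenario ord a s).1 : Set (V → ZMod 2)) =
      Submodule.span (ZMod 2) (delVec a '' (s.1 : Set (V → ZMod 2))) := by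
  rw [ignoreScenario, span_minBasis]
  congr 1
  ext c
  simp only [Finset.mem_coe, Finset.mem_image, Set.mem_image]

end Preservation

/-! ### Rooted trees, subtrees and forgotten vertices. -/

namespace NiceTreeDecomposition

variable {V I : Type*} [DecidableEq V] {G : LoopGraph V} (T : NiceTreeDecomposition G I)

/-- The node `j` is a child of the node `i`. -/
def IsChild (i j : I) : Prop := j ∈ T.childSet T.root i

/-- The node `j` belongs to the subtree rooted at `i`. -/
def Below (i j : I) : Prop := Relation.ReflTransGen T.IsChild i j

variable {T}

theorem IsChild.adj {i j : I} (h : T.IsChild i j) : T.tree.Adj i j := h.1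

theorem IsChild.dist_eq {i j : I} (h : T.IsChild i j) :
    T.tree.dist T.root j = T.tree.dist T.root i + 1 := h.2

theorem isChild_or_isChild_of_adj {i j : I} (h : T.tree.Adj i j) :
    T.IsChild i j ∨ T.IsChild j i := by
  rcases T.isTree.dist_eq_dist_add_one_of_adj T.root h with h' | h'
  · exact Or.inr ⟨h.symm, h'⟩
  · exact Or.inl ⟨h, h'⟩

/-- A shortest path from the root to a parent extends to a path to j, and in a tree that path, hence
its penultimate node, is unique. -/
theorem IsChild.parent_unique {i i' j : I} (h : T.IsChild i j) (h' : T.IsChild i' j) :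
    i = i' := by
  have key : ∀ i, T.IsChild i j → ∃ p : T.tree.Walk T.root j, p.IsPath ∧ p.penultimate = i := by
    intro i hi
    obtain ⟨p, hp, hlen⟩ := T.isTree.connected.exists_path_of_dist T.root i
    refine ⟨p.concat hi.adj, ?_, by simp⟩
    -- The node j is farther from the root than i, so it cannot lie on a shortest path to i.
    refine hp.concat (fun hj => ?_) hi.adj
    classical
    have := (SimpleGraph.dist_le (p.takeUntil j hj)).trans (p.length_takeUntil_le_length hj)
    have := hi.dist_eq
    omega
  obtain ⟨p, hp, rfl⟩ := key i h
  obtain ⟨q, hq, rfl⟩ := key i' h'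
  have := congrArg Subtype.val
    ((T.isTree.isAcyclic.subsingleton_path T.root j).elim ⟨p, hp⟩ ⟨q, hq⟩)
  exact congrArg SimpleGraph.Walk.penultimate this

theorem Below.refl (i : I) : T.Below i i := Relation.ReflTransGen.refl

theorem Below.dist_le {i j : I} (h : T.Below i j) :
    T.tree.dist T.root i ≤ T.tree.dist T.root j := by
  induction h with
  | refl => rfl
  | tail _ hjk ih => rw [hjk.dist_eq]; omega

theorem IsChild.not_below {i j : I} (h : T.IsChild i j) : ¬ T.Below j i := fun h' => by
  have := h'.dist_le
  rw [h.dist_eq] at this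
  omega

/-- An edge that leaves the subtree rooted at `i` does so at `i`. -/
theorem Below.eq_of_adj {i p q : I} (h : T.Below i p) (hpq : T.tree.Adj p q)
    (hq : ¬ T.Below i q) : p = i ∧ T.IsChild q i := by
  have hqp : T.IsChild q p :=
    (isChild_or_isChild_of_adj hpq).resolve_left fun h' => hq (h.tail h')
  rcases Relation.ReflTransGen.cases_tail h with rfl | ⟨p', hp', hpp'⟩
  · exact ⟨rfl, hqp⟩
  · exact absurd (hpp'.parent_unique hqp ▸ hp') hq

theorem below_root (j : I) : T.Below T.root j := by
  obtain ⟨w⟩ := T.isTree.connected T.root j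
  suffices ∀ i j, ∀ _ : T.tree.Walk i j, T.Below T.root i → T.Below T.root j from
    this _ _ w (Below.refl _)
  intro i j w
  induction w with
  | nil => exact id
  | cons h _ ih =>
    refine fun hi => ih ?_
    by_contra hne
    have := (hi.eq_of_adj h hne).2.dist_eq
    simp at this

/-- The nodes whose bags contain a are connected. A walk among them could leave the subtree only
through i, whose bag lacks a. -/
theorem below_of_mem_bag {i j j' : I} {a : V} (ha : a ∉ T.bag i) (hj : T.Below i j)
    (haj : a ∈ T.bag j) (haj' : a ∈ T.bag j') : T.Below i j' := by
  obtain ⟨w⟩ := (T.connected a).preconnected ⟨j, haj⟩ ⟨j', haj'⟩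
  suffices ∀ x y : {i | a ∈ T.bag i}, ∀ _ : (T.tree.induce {i | a ∈ T.bag i}).Walk x y,
      T.Below i x → T.Below i y from this _ _ w hj
  intro x y w
  induction w with
  | nil => exact id
  | @cons u _ _ h _ ih =>
    refine fun hi => ih ?_
    by_contra hne
    have := (hi.eq_of_adj h hne).1
    exact ha (this ▸ u.2)

theorem Below.eq_or_exists {i k : I} (h : T.Below i k) :
    k = i ∨ ∃ j, T.IsChild i j ∧ T.Below j k :=
  (Relation.ReflTransGen.cases_head h).imp Eq.symm id

/-- Parents are unique, so two ancestors of a common node are comparable, and distinct siblings are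
not. -/
theorem not_below_of_ne {i j₁ j₂ k : I} (h₁ : T.IsChild i j₁) (h₂ : T.IsChild i j₂)
    (hne : j₁ ≠ j₂) (hk : T.Below j₁ k) : ¬ T.Below j₂ k := by
  have main : ∀ {j₁ j₂ : I}, T.IsChild i j₁ → T.IsChild i j₂ → j₁ ≠ j₂ → ¬ T.Below j₁ j₂ := by
    intro j₁ j₂ h₁ h₂ hne h
    rcases Relation.ReflTransGen.cases_tail h with h | ⟨p, hp, hp'⟩
    · exact hne h.symm
    · exact h₁.not_below (hp'.parent_unique h₂ ▸ hp)
  intro hk'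
  have hu : Relator.RightUnique (Function.swap T.IsChild) := fun _ _ _ h h' => h.parent_unique h'
  rcases Relation.ReflTransGen.total_of_right_unique hu
    (Relation.reflTransGen_swap.2 hk) (Relation.reflTransGen_swap.2 hk') with h | h
  · exact main h₂ h₁ hne.symm (Relation.reflTransGen_swap.1 h)
  · exact main h₁ h₂ hne (Relation.reflTransGen_swap.1 h)

variable (T) [Fintype V]

open Classical in
/-- The vertices that are forgotten at the node `i` or below. -/
noncomputable def forgotten (i : I) : Finset V :=
  Finset.univ.filter fun a => a ∉ T.bag i ∧ ∃ j, T.Below i j ∧ a ∈ T.bag j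

variable {T}

theorem mem_forgotten {i : I} {a : V} :
    a ∈ T.forgotten i ↔ a ∉ T.bag i ∧ ∃ j, T.Below i j ∧ a ∈ T.bag j := by
  simp [forgotten]

theorem disjoint_forgotten_bag (i : I) : Disjoint (T.forgotten i) (T.bag i) :=
  Finset.disjoint_left.2 fun _ ha => (mem_forgotten.1 ha).1

/-- All nodes whose bag contains a vertex that is forgotten below `i` are below `i`. -/
theorem below_of_mem_forgotten {i j : I} {a : V} (ha : a ∈ T.forgotten i) (haj : a ∈ T.bag j) :
    T.Below i j := by
  obtain ⟨h, k, hk, hak⟩ := mem_forgotten.1 ha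
  exact below_of_mem_bag h hk hak haj

theorem forgotten_root : T.forgotten T.root = Finset.univ := by
  refine Finset.eq_univ_of_forall fun a => mem_forgotten.2 ⟨by simp [T.bag_root], ?_⟩
  obtain ⟨j, hj⟩ := T.vertex_mem a
  exact ⟨j, below_root j, hj⟩

theorem forgotten_leaf {i : I} (h : T.kind i = .leaf) : T.bag i = ∅ ∧ T.forgotten i = ∅ := by
  have hv := T.kind_valid i
  rw [h] at hv
  refine ⟨hv.2, Finset.eq_empty_of_forall_notMem fun a ha => ?_⟩
  obtain ⟨h₁, k, hk, hak⟩ := mem_forgotten.1 ha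
  rcases hk.eq_or_exists with rfl | ⟨j, hj, -⟩
  · exact h₁ hak
  · have hj : j ∈ T.childSet T.root i := hj
    rw [hv.1] at hj
    exact hj

section Join

variable {i j₁ j₂ : I} (h : T.kind i = .join j₁ j₂)

include h

theorem join_spec : j₁ ≠ j₂ ∧ (∀ j, T.IsChild i j ↔ j = j₁ ∨ j = j₂) ∧
    T.bag i = T.bag j₁ ∧ T.bag i = T.bag j₂ := by
  have hv := T.kind_valid i
  rw [h] at hv
  refine ⟨hv.1, fun j => ?_, hv.2.2⟩
  rw [IsChild, hv.2.1]
  rfl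

theorem forgotten_join : T.forgotten i = T.forgotten j₁ ∪ T.forgotten j₂ := by
  obtain ⟨-, hc, hb₁, hb₂⟩ := join_spec h
  ext a
  simp only [Finset.mem_union, mem_forgotten]
  rw [← hb₁, ← hb₂, ← and_or_left]
  refine and_congr_right fun ha => ⟨fun ⟨k, hk, hak⟩ => ?_, ?_⟩
  · rcases hk.eq_or_exists with rfl | ⟨j, hj, hjk⟩
    · exact absurd hak ha
    · rcases (hc j).1 hj with rfl | rfl
      · exact Or.inl ⟨k, hjk, hak⟩
      · exact Or.inr ⟨k, hjk, hak⟩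
  · rintro (⟨k, hk, hak⟩ | ⟨k, hk, hak⟩)
    · exact ⟨k, .head ((hc j₁).2 (Or.inl rfl)) hk, hak⟩
    · exact ⟨k, .head ((hc j₂).2 (Or.inr rfl)) hk, hak⟩

/-- All bags containing a lie below j₁ and all containing b below j₂, and these subtrees are
disjoint. Both the disjointness of the two forgotten sets and the absence of edges between them
follow. -/
theorem not_mem_bag_of_forgotten_join {a b : V} {k : I} (ha : a ∈ T.forgotten j₁)
    (hb : b ∈ T.forgotten j₂) (hak : a ∈ T.bag k) : b ∉ T.bag k := fun hbk => by
  obtain ⟨hne, hc, -⟩ := join_spec h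
  exact not_below_of_ne ((hc j₁).2 (Or.inl rfl)) ((hc j₂).2 (Or.inr rfl)) hne
    (below_of_mem_forgotten ha hak) (below_of_mem_forgotten hb hbk)

theorem disjoint_forgotten_join : Disjoint (T.forgotten j₁) (T.forgotten j₂) :=
  Finset.disjoint_left.2 fun a ha hb => by
    obtain ⟨-, k, -, hak⟩ := mem_forgotten.1 ha
    exact not_mem_bag_of_forgotten_join h ha hb hak hak

theorem not_adj_of_forgotten_join {a b : V} (ha : a ∈ T.forgotten j₁)
    (hb : b ∈ T.forgotten j₂) : ¬ G.Adj a b := fun hab => by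
  obtain ⟨k, hak, hbk⟩ := T.edge_mem a b hab
  exact not_mem_bag_of_forgotten_join h ha hb hak hbk

end Join

section Introduce

variable {i j : I} {a : V} (h : T.kind i = .introduce j a)

include h

theorem introduce_spec : (∀ k, T.IsChild i k ↔ k = j) ∧ a ∉ T.bag j ∧
    T.bag i = insert a (T.bag j) := by
  have hv := T.kind_valid i
  rw [h] at hv
  refine ⟨fun k => ?_, hv.2⟩
  rw [IsChild, hv.1]
  rfl

/-- Otherwise, as the bag of j lacks a, every bag containing a would lie below j, including that of
the parent i. -/
theorem not_mem_bag_of_below_introduce {k : I} (hk : T.Below j k) : a ∉ T.bag k := fun hak => by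
  obtain ⟨hc, haj, hb⟩ := introduce_spec h
  exact ((hc j).2 rfl).not_below
    (below_of_mem_bag haj hk hak (hb ▸ Finset.mem_insert_self _ _ : a ∈ T.bag i))

theorem notMem_forgotten_introduce : a ∉ T.forgotten j := fun ha => by
  obtain ⟨-, k, hk, hak⟩ := mem_forgotten.1 ha
  exact not_mem_bag_of_below_introduce h hk hak

theorem forgotten_introduce : T.forgotten i = T.forgotten j := by
  obtain ⟨hc, haj, hb⟩ := introduce_spec h
  ext b
  simp only [mem_forgotten, hb, Finset.mem_insert, not_or]
  constructor
  · rintro ⟨⟨hba, hbj⟩, k, hk, hbk⟩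
    rcases hk.eq_or_exists with rfl | ⟨j', hj', hk'⟩
    · rw [hb, Finset.mem_insert] at hbk
      exact absurd hbk (not_or.2 ⟨hba, hbj⟩)
    · rw [(hc j').1 hj'] at hk'
      exact ⟨hbj, k, hk', hbk⟩
  · rintro ⟨hbj, k, hk, hbk⟩
    refine ⟨⟨?_, hbj⟩, k, .head ((hc j).2 rfl) hk, hbk⟩
    rintro rfl
    exact not_mem_bag_of_below_introduce h hk hbk

theorem not_adj_of_forgotten_introduce {b : V} (hb : b ∈ T.forgotten j) : ¬ G.Adj a b :=
  fun hab => by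
    obtain ⟨k, hak, hbk⟩ := T.edge_mem a b hab
    exact not_mem_bag_of_below_introduce h (below_of_mem_forgotten hb hbk) hak

end Introduce

section Forget

variable {i j : I} {a : V} (h : T.kind i = .forget j a)

include h

theorem forget_spec : (∀ k, T.IsChild i k ↔ k = j) ∧ a ∉ T.bag i ∧
    T.bag j = insert a (T.bag i) := by
  have hv := T.kind_valid i
  rw [h] at hv
  refine ⟨fun k => ?_, hv.2⟩
  rw [IsChild, hv.1]
  rfl

theorem notMem_forgotten_forget : a ∉ T.forgotten j := fun ha => by
  obtain ⟨-, -, hb⟩ := forget_spec h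
  exact (mem_forgotten.1 ha).1 (hb ▸ Finset.mem_insert_self _ _)

theorem forgotten_forget : T.forgotten i = insert a (T.forgotten j) := by
  obtain ⟨hc, hai, hb⟩ := forget_spec h
  have hij : T.IsChild i j := (hc j).2 rfl
  ext b
  rw [Finset.mem_insert, mem_forgotten, mem_forgotten, hb]
  constructor
  · rintro ⟨hbi, k, hk, hbk⟩
    by_cases hba : b = a
    · exact Or.inl hba
    refine Or.inr ⟨by simp [hba, hbi], k, ?_, hbk⟩
    rcases hk.eq_or_exists with rfl | ⟨j', hj', hk'⟩
    · exact absurd hbk hbi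
    · rwa [(hc j').1 hj'] at hk'
  · rintro (rfl | ⟨hbj, k, hk, hbk⟩)
    · exact ⟨hai, j, .single hij, hb ▸ Finset.mem_insert_self _ _⟩
    · exact ⟨fun hbi => hbj (Finset.mem_insert_of_mem hbi), k, .head hij hk, hbk⟩

end Forget

/-- On the way down from i to a bag that contains a there is a step from a bag without a to one with
a, and only a forget node permits it. Hence `vertexOrder` lists all vertices and distinct vectors
have distinct entry lists. -/
theorem exists_forget_of_mem_forgotten {i : I} {a : V} (ha : a ∈ T.forgotten i) :
    ∃ k j, T.kind k = .forget j a := by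
  obtain ⟨h₁, k, hk, hak⟩ := mem_forgotten.1 ha
  induction hk using Relation.ReflTransGen.head_induction_on with
  | refl => exact absurd hak h₁
  | @head i j hij hjk ih =>
    by_cases haj : a ∈ T.bag j
    · cases hkind : T.kind i with
      | leaf =>
        have hv := T.kind_valid i
        rw [hkind] at hv
        have : j ∈ T.childSet T.root i := hij
        rw [hv.1] at this
        exact this.elim
      | join j₁ j₂ =>
        obtain ⟨-, hc, hb₁, hb₂⟩ := join_spec hkind
        rcases (hc j).1 hij with rfl | rfl
        · exact absurd (hb₁ ▸ haj) h₁
        · exact absurd (hb₂ ▸ haj) h₁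
      | introduce j' b =>
        obtain ⟨hc, -, hb⟩ := introduce_spec hkind
        rw [(hc j).1 hij] at haj
        exact absurd (hb ▸ Finset.mem_insert_of_mem haj) h₁
      | forget j' b =>
        obtain ⟨hc, -, hb⟩ := forget_spec hkind
        rw [(hc j).1 hij, hb, Finset.mem_insert] at haj
        rcases haj with rfl | haj
        · exact ⟨i, j', hkind⟩
        · exact absurd haj h₁
    · exact ih (mem_forgotten.2 ⟨haj, k, hjk, hak⟩) haj

theorem mem_vertexOrder [DecidableEq I] {t : List I} (ht : T.IsBottomUp t) (a : V) :
    a ∈ T.vertexOrder t := by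
  obtain ⟨k, j, hk⟩ := exists_forget_of_mem_forgotten (T := T) (i := T.root) (a := a)
    (by rw [forgotten_root]; exact Finset.mem_univ a)
  refine List.mem_filterMap.2 ⟨k, ht.2.1 k, ?_⟩
  rw [hk]

end NiceTreeDecomposition

/-! ### The number of scenarios. -/

section Count

variable {V : Type*} [Fintype V] [DecidableEq V] {U : Finset V}

theorem IsScenario.card_fst_le {s : Scenario V} (h : IsScenario U s) : s.1.card ≤ U.card := by
  let f : (V → ZMod 2) →ₗ[ZMod 2] (U → ZMod 2) := LinearMap.funLeft _ _ Subtype.val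
  have hspan : Submodule.span (ZMod 2) (id '' (s.1 : Set (V → ZMod 2))) ≤ supportedOn U := by
    rw [Set.image_id, Submodule.span_le]
    exact fun c hc => h.1 c hc
  have := h.2.1.map_injOn f fun x hx y hy hxy => by
    ext a
    by_cases ha : a ∈ U
    · exact congrFun hxy ⟨a, ha⟩
    · rw [hspan hx a ha, hspan hy a ha]
  have := LinearIndependent.fintype_card_le_finrank this
  simpa using this

theorem mem_scenarios {s : Scenario V} : s ∈ scenarios U ↔ IsScenario U s := by
  simp only [scenarios, Finset.mem_filter, Finset.mem_univ, true_and]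

open Classical in
/-- A scenario of `U`, encoded by a list of vectors and by the entries of its matrix. -/
noncomputable def decodeScenario (U : Finset V)
    (p : (U → U → ZMod 2) × (Sym2 U → ZMod 2)) : Scenario V :=
  ((Finset.univ.image fun u => fun a => if h : a ∈ U then p.1 u ⟨a, h⟩ else 0).erase 0,
    Matrix.of fun a b => if h : a ∈ U ∧ b ∈ U then p.2 s(⟨a, h.1⟩, ⟨b, h.2⟩) else 0)

/-- Independent vectors number at most |U| and are nonzero, so they can be indexed by part of U and
padded with zero vectors, which decoding erases. A symmetric matrix is a function on unordered
pairs. -/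
theorem IsScenario.exists_decode {s : Scenario V} (h : IsScenario U s) :
    ∃ p, decodeScenario U p = s := by
  have hcard : Fintype.card s.1 ≤ Fintype.card U := by simpa using h.card_fst_le
  obtain ⟨e⟩ := Function.Embedding.nonempty_of_card_le hcard
  refine ⟨(fun u a => Function.extend e Subtype.val (fun _ => 0) u a, Sym2.lift
    ⟨fun a b => s.2 a b, fun a b => (h.2.2.1.apply a b).symm⟩), Prod.ext ?_ ?_⟩
  · have h0 : (0 : V → ZMod 2) ∉ s.1 := fun h' => h.2.1.ne_zero h' rfl
    have hext : ∀ u, (fun a => if h : a ∈ U then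
        Function.extend e Subtype.val (fun _ => 0) u a else 0) =
          Function.extend e Subtype.val (fun _ => 0) u := fun u => by
      ext a
      by_cases hu : ∃ c, e c = u
      · obtain ⟨c, rfl⟩ := hu
        rw [e.injective.extend_apply]
        by_cases ha : a ∈ U
        · simp [ha]
        · simp [ha, h.1 c c.2 a ha]
      · rw [Function.extend_apply' _ _ _ hu]
        simp
    ext c
    simp only [decodeScenario, Finset.mem_erase, Finset.mem_image, Finset.mem_univ, true_and, hext]
    constructor
    · rintro ⟨hc, u, rfl⟩
      by_cases hu : ∃ c, e c = u
      · obtain ⟨c, rfl⟩ := hu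
        rw [e.injective.extend_apply]
        exact c.2
      · rw [Function.extend_apply' _ _ _ hu] at hc
        exact absurd rfl hc
    · intro hc
      refine ⟨fun h' => h0 (h' ▸ hc), e ⟨c, hc⟩, ?_⟩
      rw [e.injective.extend_apply]
  · ext a b
    simp only [decodeScenario, Matrix.of_apply, Sym2.lift_mk]
    split_ifs with hab
    · rfl
    · rw [h.2.2.2 a b (by tauto)]

/-- The code has |U|^2 bits for the vectors and |U|(|U|+1)/2 for the matrix; squaring doubles the
exponent to 3|U|^2 + |U|. -/
theorem card_scenarios_sq_le (U : Finset V) :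
    (scenarios U).card ^ 2 ≤ 2 ^ (3 * U.card ^ 2 + U.card) := by
  have h₁ : (scenarios U).card ≤
      Fintype.card ((U → U → ZMod 2) × (Sym2 U → ZMod 2)) := by
    classical
    refine Finset.card_le_card_of_surjOn (s := Finset.univ) (decodeScenario U) fun s hs => ?_
    obtain ⟨p, hp⟩ := (mem_scenarios.1 hs).exists_decode
    exact ⟨p, by simp, hp⟩
  have h₂ : Fintype.card ((U → U → ZMod 2) × (Sym2 U → ZMod 2)) =
      2 ^ (U.card ^ 2 + (U.card + 1).choose 2) := by
    simp only [Fintype.card_prod, Fintype.card_fun, ZMod.card, Fintype.card_coe, Sym2.card,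
      pow_add, ← pow_mul, sq]
  rw [h₂] at h₁
  refine (Nat.pow_le_pow_left h₁ 2).trans ?_
  rw [← pow_mul]
  refine Nat.pow_le_pow_right (by norm_num) ?_
  have : (U.card + 1).choose 2 * 2 = (U.card + 1) * U.card := by
    rw [Nat.choose_two_right, Nat.div_mul_cancel (Nat.even_mul_pred_self _).two_dvd]
    simp
  nlinarith

end Count

/-! ### Rank and nullity through the radical. -/

section Rank

variable {V : Type*} [Fintype V] [DecidableEq V]

/-- Rank-nullity for the induced matrix, whose kernel is carried onto the radical by extension by
zero. -/
theorem finrank_radical_add_rk (H : LoopGraph V) (W : Finset V) :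
    Module.finrank (ZMod 2) (radical (adjOn H Finset.univ) W) + H.rk W = W.card := by
  have h := LinearMap.finrank_range_add_finrank_ker (H.inducedMatrix W).mulVecLin
  rw [Module.finrank_fintype_fun_eq_card, Fintype.card_coe] at h
  rw [LoopGraph.rk, Matrix.rank, add_comm, ← h]
  congr 1
  let f : (W → ZMod 2) →ₗ[ZMod 2] (V → ZMod 2) :=
    Function.ExtendByZero.linearMap (ZMod 2) Subtype.val
  have hf : ∀ (x : W → ZMod 2) (a : W), f x a = x a := fun x a =>
    Subtype.val_injective.extend_apply _ _ _
  have hf0 : ∀ (x : W → ZMod 2) (a : V), a ∉ W → f x a = 0 := fun x a ha =>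
    Function.extend_apply' _ _ _ (by rintro ⟨b, rfl⟩; exact ha b.2)
  have hinj : Function.Injective f := fun x y hxy => funext fun a => by
    rw [← hf x, ← hf y, hxy]
  have hmul : ∀ (x : W → ZMod 2) (a : W),
      (adjOn H Finset.univ *ᵥ f x) a = (H.inducedMatrix W *ᵥ x) a := fun x a => by
    rw [mulVec, mulVec, dotProduct, dotProduct, ← Finset.sum_subset (Finset.subset_univ W)
      (fun b _ hb => by rw [hf0 x b hb, mul_zero]), ← Finset.sum_coe_sort]
    refine Finset.sum_congr rfl fun b _ => ?_
    rw [hf]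
    by_cases hab : H.Adj a b <;> simp [adjOn, LoopGraph.inducedMatrix, hab]
  have hmap : radical (adjOn H Finset.univ) W =
      (LinearMap.ker (H.inducedMatrix W).mulVecLin).map f := by
    ext x
    rw [radical, Submodule.mem_inf, mem_orth_iff, Submodule.mem_map]
    constructor
    · rintro ⟨hx, hx'⟩
      have hfx : f (fun a => x a) = x := funext fun a => by
        by_cases ha : a ∈ W
        · exact hf _ ⟨a, ha⟩
        · rw [hf0 _ a ha, hx a ha]
      refine ⟨fun a => x a, ?_, hfx⟩
      refine LinearMap.mem_ker.2 (funext fun a => ?_)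
      rw [Matrix.mulVecLin_apply, ← hmul, hfx]
      exact hx' a a.2
    · rintro ⟨y, hy, rfl⟩
      refine ⟨fun a ha => hf0 y a ha, fun w hw => ?_⟩
      have := congrFun (LinearMap.mem_ker.1 hy) ⟨w, hw⟩
      rw [Matrix.mulVecLin_apply, ← hmul] at this
      exact this
  rw [hmap]
  exact (Submodule.equivMapOfInjective f hinj _).finrank_eq.symm

theorem adjOn_toggle_congr {G : LoopGraph V} {B D : Finset V} {a b : V}
    (h : a = b → (a ∈ B ↔ a ∈ D)) :
    adjOn (G.toggle B) Finset.univ a b = adjOn (G.toggle D) Finset.univ a b := by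
  simp only [adjOn, Finset.mem_univ, true_and, LoopGraph.toggle]
  congr 1
  refine propext ?_
  by_cases hab : a = b
  · rw [h hab]
  · simp [hab]

theorem adjOn_toggle_eq_zero {G : LoopGraph V} {B : Finset V} {a b : V} (hne : a ≠ b)
    (h : ¬ G.Adj a b) : adjOn (G.toggle B) Finset.univ a b = 0 := by
  simp [adjOn, LoopGraph.toggle, hne, h]

/-- The scenarios refer to the graph with the set D of the bag also toggled. Loops outside W do not
affect the form on W, so the rank in the polynomial can be read off that graph. -/
theorem rk_toggle_add_finrank {G : LoopGraph V} {B D W : Finset V} (hD : Disjoint D W) :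
    Module.finrank (ZMod 2) (radical (adjOn (G.toggle (B ∪ D)) Finset.univ) W)
      + (G.toggle B).rk W = W.card := by
  rw [radical_congr (N := adjOn (G.toggle B) Finset.univ), finrank_radical_add_rk]
  refine fun a ha b _ => adjOn_toggle_congr fun _ => ?_
  simp [Finset.disjoint_right.1 hD ha]

end Rank

/-! ### Tables as sums of point masses. -/

section Point

variable {S F : Type*}

open Classical in
/-- The function with the value `z` at `s` and zero elsewhere. -/
noncomputable def pt [Zero F] (s : S) (z : F) : S → F := fun s' => if s' = s then z else 0

theorem pt_self [Zero F] (s : S) (z : F) : pt s z s = z := by simp [pt]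

theorem pt_of_ne [Zero F] {s s' : S} (h : s' ≠ s) (z : F) : pt s z s' = 0 := by simp [pt, h]

theorem pt_zero [Zero F] (s : S) : pt s (0 : F) = 0 := by
  ext s'; simp [pt]

theorem pt_add [AddZeroClass F] (s : S) (z z' : F) : pt s (z + z') = pt s z + pt s z' := by
  ext s'
  by_cases h : s' = s <;> simp [pt, h]

/-- Summation over all scenarios of an additive function of a table. -/
theorem sum_apply_sum_pt [AddCommMonoid F] {A E : Type*} [AddCommMonoid E] {P : Finset A}
    {sc : Finset S} {σ : A → S} (hσ : ∀ x ∈ P, σ x ∈ sc) (z : A → F) (Φ : S → F → E)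
    (h0 : ∀ s, Φ s 0 = 0) (hadd : ∀ s z z', Φ s (z + z') = Φ s z + Φ s z') :
    ∑ s ∈ sc, Φ s ((∑ x ∈ P, pt (σ x) (z x)) s) = ∑ x ∈ P, Φ (σ x) (z x) := by
  classical
  have hsum : ∀ s (f : A → F), Φ s (∑ x ∈ P, f x) = ∑ x ∈ P, Φ s (f x) := fun s f =>
    map_sum (⟨⟨Φ s, h0 s⟩, hadd s⟩ : F →+ E) f P
  simp only [Finset.sum_apply, hsum]
  rw [Finset.sum_comm]
  refine Finset.sum_congr rfl fun x hx => ?_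
  rw [Finset.sum_eq_single (σ x), pt_self]
  · intro s _ hs
    rw [pt_of_ne hs, h0]
  · exact fun h => absurd (hσ x hx) h

end Point

/-! ### Reasoning about programs: returned value, table, operations and size budget. -/

section Machine

variable {V I F : Type}

/-- The state after a computation. -/
def exec {α : Type} (c : Comp V I F α) (m : Machine V I F) : Machine V I F := (c.run m).2

theorem exec_bind {α β : Type} (c : Comp V I F α) (k : α → Comp V I F β) (m : Machine V I F) :
    exec (c >>= k) m = exec (k (c.run m).1) (exec c m) := rfl

theorem exec_forM_cons {α : Type} (x : α) (l : List α) (g : α → Comp V I F Unit)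
    (m : Machine V I F) : exec ((x :: l).forM g) m = exec (l.forM g) (exec (g x) m) := rfl

/-- A condition on the recorded operations, together with a way to guarantee it: `within f b`
says that the table `f` has size at most `b`, and sizes up to `limit` are admissible. -/
structure Guard (V F : Type) where
  good : ArithStep F → Prop
  within : (Scenario V → F) → ℚ → Prop
  limit : ℚ

/-- The guard that admits everything. -/
def trivialGuard (V F : Type) : Guard V F := ⟨fun _ => True, fun _ _ => True, 0⟩

/-- The computation `c`, run on a memory that agrees with `τ` outside the row `i`, returns `val`,
adds `f` to the part `(i, D)` of the table, changes no other part of it, records at most `N`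
operations, all of which are good, and increases the size by at most `b`. -/
def Runs (g : Guard V F) [Add F] (i : I) (D : Finset V) (τ : I → Finset V → Scenario V → F)
    {α : Type} (c : Comp V I F α) (val : α) (f : Scenario V → F) (N : ℕ) (b : ℚ) : Prop :=
  0 ≤ b ∧ ∀ (m : Machine V I F) (b₀ : ℚ), (∀ i' D', i' ≠ i → m.table i' D' = τ i' D') →
    g.within (m.table i D) b₀ → b₀ + b ≤ g.limit →
    (c.run m).1 = val ∧
    (∀ i' D', i' ≠ i ∨ D' ≠ D → (exec c m).table i' D' = m.table i' D') ∧
    (exec c m).table i D = m.table i D + f ∧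
    g.within ((exec c m).table i D) (b₀ + b) ∧
    ∃ new, (exec c m).record = new ++ m.record ∧ new.length ≤ N ∧ ∀ step ∈ new, g.good step

variable [Field F] {g : Guard V F} {i : I} {D : Finset V} {τ : I → Finset V → Scenario V → F}

theorem Runs.mono {α : Type} {c : Comp V I F α} {val : α} {f : Scenario V → F} {N N' : ℕ} {b : ℚ}
    (h : Runs g i D τ c val f N b) (hN : N ≤ N') : Runs g i D τ c val f N' b := by
  refine ⟨h.1, fun m b₀ h₁ h₂ h₃ => ?_⟩
  obtain ⟨e₁, e₂, e₃, e₄, new, e₅, e₆, e₇⟩ := h.2 m b₀ h₁ h₂ h₃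
  exact ⟨e₁, e₂, e₃, e₄, new, e₅, e₆.trans hN, e₇⟩

/-- Agreement with τ is required only outside row i, so the writes of the first computation leave
the assumption of the second intact. Operation counts and size budgets add up. -/
theorem Runs.bind {α β : Type} {c : Comp V I F α} {k : α → Comp V I F β} {val : α} {val' : β}
    {f f' : Scenario V → F} {N N' : ℕ} {b b' : ℚ} (h : Runs g i D τ c val f N b)
    (h' : Runs g i D τ (k val) val' f' N' b') :
    Runs g i D τ (c >>= k) val' (f + f') (N + N') (b + b') := by
  refine ⟨add_nonneg h.1 h'.1, fun m b₀ h₁ h₂ h₃ => ?_⟩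
  obtain ⟨e₁, e₂, e₃, e₄, new, e₅, e₆, e₇⟩ := h.2 m b₀ h₁ h₂ (by linarith [h'.1])
  obtain ⟨e₁', e₂', e₃', e₄', new', e₅', e₆', e₇'⟩ := h'.2 (exec c m) (b₀ + b)
    (fun i' D' hi => (e₂ i' D' (Or.inl hi)).trans (h₁ i' D' hi)) e₄ (by linarith)
  have hex : exec (c >>= k) m = exec (k val) (exec c m) := by rw [exec_bind, e₁]
  have hval : ((c >>= k).run m).1 = ((k val).run (exec c m)).1 := by
    rw [← e₁]; rfl
  rw [hex, hval]
  refine ⟨e₁', fun i' D' hi => (e₂' i' D' hi).trans (e₂ i' D' hi), ?_, ?_, new' ++ new, ?_, ?_, ?_⟩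
  · rw [e₃', e₃, add_assoc]
  · rwa [← add_assoc]
  · rw [e₅', e₅, List.append_assoc]
  · rw [List.length_append]; omega
  · intro step hs
    rcases List.mem_append.1 hs with hs | hs
    · exact e₇' step hs
    · exact e₇ step hs

theorem Runs.pure {α : Type} (val : α) : Runs g i D τ (Pure.pure val) val 0 0 0 :=
  ⟨le_rfl, fun m b₀ _ h₂ _ => ⟨rfl, fun _ _ _ => rfl, (add_zero _).symm,
    (by rw [add_zero]; exact h₂), [], rfl, le_rfl, by simp⟩⟩

theorem Runs.arith {inputs : List F} {result : F} (h : g.good ⟨inputs, result⟩) :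
    Runs g i D τ (Interlace.arith inputs result) result 0 1 0 :=
  ⟨le_rfl, fun m b₀ _ h₂ _ => ⟨rfl, fun _ _ _ => rfl, (add_zero _).symm,
    (by rw [add_zero]; exact h₂), [⟨inputs, result⟩], rfl, le_rfl, by simpa using h⟩⟩

theorem Runs.read {j : I} (hj : j ≠ i) (D' : Finset V) (s : Scenario V) :
    Runs g i D τ (readS j D' s) (τ j D' s) 0 0 0 :=
  ⟨le_rfl, fun m b₀ h₁ h₂ _ => ⟨congrFun (h₁ j D' hj) s, fun _ _ _ => rfl, (add_zero _).symm,
    (by rw [add_zero]; exact h₂), [], rfl, le_rfl, by simp⟩⟩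

theorem writeS_table_of_ne {s : Scenario V} {z : F} {m : Machine V I F} {i' : I} {D' : Finset V}
    (h : i' ≠ i ∨ D' ≠ D) : (exec (writeS i D s z) m).table i' D' = m.table i' D' := by
  ext s'
  refine if_neg ?_
  rintro ⟨rfl, rfl, -⟩
  simp at h

theorem writeS_table_self {s s' : Scenario V} {z : F} {m : Machine V I F} [Decidable (s' = s)] :
    (exec (writeS i D s z) m).table i D s' = if s' = s then z else m.table i D s' := by
  by_cases h : s' = s
  · rw [if_pos h]; exact if_pos ⟨rfl, rfl, h⟩
  · rw [if_neg h]; exact if_neg fun h' => h h'.2.2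

theorem Runs.accumulate {s : Scenario V} {z : F} {b : ℚ} (hb : 0 ≤ b)
    (h : ∀ T b₀, g.within T b₀ → b₀ + b ≤ g.limit →
      g.good ⟨[T s, z], T s + z⟩ ∧ g.within (T + pt s z) (b₀ + b)) :
    Runs g i D τ (Interlace.accumulate i D s z) () (pt s z) 1 b := by
  refine ⟨hb, fun m b₀ h₁ h₂ h₃ => ?_⟩
  obtain ⟨hg, hw⟩ := h _ _ h₂ h₃
  have htab : (exec (Interlace.accumulate i D s z) m).table i D = m.table i D + pt s z := by
    classical
    ext s'
    refine (writeS_table_self (i := i) (D := D) (s := s) (m := m)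
      (z := m.table i D s + z) (s' := s')).trans ?_
    by_cases hs : s' = s
    · subst hs; simp [pt_self]
    · simp [hs, pt_of_ne hs]
  refine ⟨rfl, fun i' D' hi => writeS_table_of_ne (m := m) (z := m.table i D s + z) hi, htab, ?_,
    [⟨[m.table i D s, z], m.table i D s + z⟩], rfl, le_rfl, by simpa using hg⟩
  rw [htab]
  exact hw

theorem Runs.forM {α : Type} {l : List α} {c : α → Comp V I F Unit} {f : α → Scenario V → F}
    {N : ℕ} {b : α → ℚ} (h : ∀ x ∈ l, Runs g i D τ (c x) () (f x) N (b x)) :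
    Runs g i D τ (l.forM c) () (l.map f).sum (N * l.length) (l.map b).sum := by
  induction l with
  | nil => exact Runs.pure ()
  | cons x l ih =>
    have := (h x (by simp)).bind (k := fun _ => l.forM c) (ih fun y hy => h y (by simp [hy]))
    rw [List.map_cons, List.sum_cons, List.map_cons, List.sum_cons, List.length_cons, mul_add_one,
      add_comm (N * l.length)]
    exact this

theorem Runs.forM_toList {α : Type} {S : Finset α} {c : α → Comp V I F Unit}
    {f : α → Scenario V → F} {N : ℕ} {b : α → ℚ}
    (h : ∀ x ∈ S, Runs g i D τ (c x) () (f x) N (b x)) :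
    Runs g i D τ (S.toList.forM c) () (∑ x ∈ S, f x) (N * S.card) (∑ x ∈ S, b x) := by
  have := Runs.forM (l := S.toList) (g := g) (i := i) (D := D) (τ := τ) (c := c) (f := f) (N := N)
    (b := b) fun x hx => h x (Finset.mem_toList.1 hx)
  rwa [Finset.sum_map_toList, Finset.sum_map_toList, Finset.length_toList] at this

variable [Fintype V] [DecidableEq V]

/-- The memory starts as zero and each part is filled only once, so the initialization has no
effect. -/
theorem exec_initS {U : Finset V} {m : Machine V I F} (h : m.table i D = 0) :
    exec (initS i U D) m = m := by
  have hw : ∀ s, exec (writeS i D s 0) m = m := fun s => by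
    classical
    have ht : (exec (writeS i D s 0) m).table = m.table := by
      funext i' D' s'
      by_cases hc : i' ≠ i ∨ D' ≠ D
      · rw [writeS_table_of_ne hc]
      · simp only [not_or, not_not] at hc
        rw [hc.1, hc.2, writeS_table_self, h]
        simp
    have hext : ∀ m₁ : Machine V I F, m₁.table = m.table → m₁.record = m.record → m₁ = m := by
      rintro ⟨_, _⟩ rfl rfl; rfl
    exact hext _ ht rfl
  unfold initS
  induction (scenarios U).toList with
  | nil => rfl
  | cons s l ih => rw [exec_forM_cons, hw, ih]

/-- Assignments to distinct entries that were zero act like additions of point masses. This puts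
introduce nodes on the same footing as the accumulating ones. -/
theorem exec_forM_write {j : I} (hj : j ≠ i) {D' : Finset V} {σ : Scenario V → Scenario V}
    {l : List (Scenario V)} (hl : l.Nodup) (hσ : Set.InjOn σ {s | s ∈ l}) (m : Machine V I F)
    (h0 : ∀ s ∈ l, m.table i D (σ s) = 0) :
    (∀ i' D'', i' ≠ i ∨ D'' ≠ D → (exec (l.forM fun s => readS j D' s >>= fun z =>
      writeS i D (σ s) z) m).table i' D'' = m.table i' D'') ∧
    (exec (l.forM fun s => readS j D' s >>= fun z => writeS i D (σ s) z) m).table i D =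
      m.table i D + (l.map fun s => pt (σ s) (m.table j D' s)).sum ∧
    (exec (l.forM fun s => readS j D' s >>= fun z => writeS i D (σ s) z) m).record =
      m.record := by
  classical
  induction l generalizing m with
  | nil => exact ⟨fun _ _ _ => rfl, (add_zero _).symm, rfl⟩
  | cons s l ih =>
    rw [exec_forM_cons]
    set m₁ := exec (readS j D' s >>= fun z => writeS i D (σ s) z) m with hm₁
    have hm₁' : m₁ = exec (writeS i D (σ s) (m.table j D' s)) m := rfl
    obtain ⟨hs, hl⟩ := List.nodup_cons.1 hl
    have hne : ∀ s' ∈ l, σ s' ≠ σ s := fun s' hs' he =>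
      hs (hσ (by simp [hs']) (by simp) he ▸ hs')
    have htab : m₁.table i D = m.table i D + pt (σ s) (m.table j D' s) := by
      ext s'
      rw [hm₁', writeS_table_self]
      by_cases h : s' = σ s
      · subst h; simp [pt_self, h0 s]
      · simp [h, pt_of_ne h]
    obtain ⟨e₁, e₂, e₃⟩ := ih hl (hσ.mono fun x hx => by simp_all) m₁ fun s' hs' => by
      rw [htab, Pi.add_apply, pt_of_ne (hne s' hs'), h0 s' (by simp [hs']), add_zero]
    have hoff : ∀ i' D'', i' ≠ i ∨ D'' ≠ D → m₁.table i' D'' = m.table i' D'' := fun i' D'' h => by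
      rw [hm₁', writeS_table_of_ne h]
    refine ⟨fun i' D'' h => (e₁ i' D'' h).trans (hoff i' D'' h), ?_, e₃⟩
    rw [e₂, htab, List.map_cons, List.sum_cons, add_assoc, hoff j D' (Or.inl hj)]

end Machine

/-! ### The effect of processing one node. -/

section Nodes

variable {V I F : Type} [Field F] {g : Guard V F} {i : I} {D : Finset V}

/-- The number `z` can be added to any table entry, at the expense of the size `b`. -/
def Guard.Accepts (g : Guard V F) (z : F) (b : ℚ) : Prop :=
  0 ≤ b ∧ ∀ s T b₀, g.within T b₀ → b₀ + b ≤ g.limit →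
    g.good ⟨[T s, z], T s + z⟩ ∧ g.within (T + pt s z) (b₀ + b)

theorem trivialGuard_accepts (z : F) : (trivialGuard V F).Accepts z 0 :=
  ⟨le_rfl, fun _ _ _ _ _ => ⟨trivial, trivial⟩⟩

/-- The effect of a computation on the memory: the part `(i, D)` of the table becomes `f`, nothing
else changes, and at most `N` operations are recorded, all of which are good. -/
def Effect (good : ArithStep F → Prop) (N : ℕ) (i : I) (D : Finset V) (f : Scenario V → F)
    (m m' : Machine V I F) : Prop :=
  (∀ i' D', i' ≠ i ∨ D' ≠ D → m'.table i' D' = m.table i' D') ∧ m'.table i D = f ∧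
    ∃ new, m'.record = new ++ m.record ∧ new.length ≤ N ∧ ∀ step ∈ new, good step

theorem Effect.mono {good : ArithStep F → Prop} {N N' : ℕ} {f : Scenario V → F}
    {m m' : Machine V I F} (h : Effect good N i D f m m') (hN : N ≤ N') :
    Effect good N' i D f m m' := by
  obtain ⟨h₁, h₂, new, h₃, h₄, h₅⟩ := h
  exact ⟨h₁, h₂, new, h₃, h₄.trans hN, h₅⟩

/-- The new operations are determined by the two states, so both hypotheses speak of the same list.
The count can come from one analysis and the property of the operations from another. -/
theorem Effect.and_good {good good' : ArithStep F → Prop} {N N' : ℕ} {f : Scenario V → F}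
    {m m' : Machine V I F} (h : Effect good N i D f m m') (h' : Effect good' N' i D f m m') :
    Effect good' N i D f m m' := by
  obtain ⟨h₁, h₂, new, h₃, h₄, -⟩ := h
  obtain ⟨-, -, new', h₃', -, h₅'⟩ := h'
  obtain rfl := List.append_cancel_right (h₃.symm.trans h₃')
  exact ⟨h₁, h₂, new, h₃, h₄, h₅'⟩

theorem Runs.effect {m : Machine V I F} {c : Comp V I F Unit} {f : Scenario V → F} {N : ℕ} {b : ℚ}
    (h : Runs g i D m.table c () f N b) (h0 : m.table i D = 0) (hw : g.within 0 0)
    (hb : b ≤ g.limit) : Effect g.good N i D f m (exec c m) ∧ g.within f b := by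
  obtain ⟨-, e₂, e₃, e, e₄⟩ := h.2 m 0 (fun _ _ _ => rfl) (by rwa [h0]) (by linarith)
  rw [h0, zero_add] at e₃
  rw [e₃, zero_add] at e
  exact ⟨⟨e₂, e₃, e₄⟩, e⟩

theorem exec_initS_bind [Fintype V] [DecidableEq V] {U : Finset V} {m : Machine V I F}
    (h : m.table i D = 0) (c : Comp V I F Unit) :
    exec (do initS i U D; c) m = exec c m := by
  rw [exec_bind, exec_initS h]

theorem Runs.of_eq {α : Type} {τ : I → Finset V → Scenario V → F} {c : Comp V I F α} {val : α}
    {f f' : Scenario V → F} {N N' : ℕ} {b b' : ℚ} (h : Runs g i D τ c val f N b) (hf : f = f')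
    (hN : N = N') (hb : b = b') : Runs g i D τ c val f' N' b' := by
  subst hf hN hb; exact h

/-- The factor with which a table entry is multiplied when a vertex is forgotten. -/
def forgetCoeff (t u v : F) (r : ℕ) : F := t * u ^ r * v ^ (1 - (r : ℤ))

theorem Runs.powOp {τ : I → Finset V → Scenario V → F} {u : F} {r : ℕ} (hr : r ≤ 2)
    (hg : g.good ⟨[u, u], u * u⟩) : Runs g i D τ (powOp u r) (u ^ r) 0 1 0 := by
  interval_cases r
  · rw [pow_zero]; exact (Runs.pure 1).mono zero_le_one
  · rw [pow_one]; exact (Runs.pure u).mono zero_le_one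
  · rw [pow_two]
    change Runs g i D τ (Pure.pure u >>= fun q => mulOp q u) (u * u) 0 1 0
    exact Runs.of_eq (Runs.bind (Runs.pure u) (Runs.arith hg)) (add_zero _) rfl (add_zero _)

theorem Runs.signPowOp {τ : I → Finset V → Scenario V → F} {v : F} {r : ℕ} (hr : r ≤ 2)
    (hg : g.good ⟨[v], v⁻¹⟩) :
    Runs g i D τ (signPowOp v (1 - (r : ℤ))) (v ^ (1 - (r : ℤ))) 0 1 0 := by
  interval_cases r
  · norm_num [Interlace.signPowOp]
    exact (Runs.pure v).mono zero_le_one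
  · norm_num [Interlace.signPowOp]
    exact (Runs.pure 1).mono zero_le_one
  · norm_num [Interlace.signPowOp]
    exact Runs.arith hg

theorem forgetScenario_snd_le [DecidableEq V] [Fintype V] (ord : List V) (a : V)
    (s : Scenario V) : (forgetScenario ord a s).2 ≤ 2 := by
  rcases forgetScenario_cases ord a s with ⟨w, -, -, -, -, h⟩ | ⟨-, -, h⟩ | ⟨-, -, h⟩ <;>
    rw [h] <;> norm_num

variable [Fintype V] [DecidableEq V]

/-- The multiplications for a forget node with factor `t` are good. -/
structure Guard.ForgetGood (g : Guard V F) (t u v : F) : Prop where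
  sq : g.good ⟨[u, u], u * u⟩
  inv : g.good ⟨[v], v⁻¹⟩
  mul₁ : ∀ r ≤ 2, g.good ⟨[t, u ^ r], t * u ^ r⟩
  mul₂ : ∀ r : ℕ, r ≤ 2 → g.good ⟨[t * u ^ r, v ^ (1 - (r : ℤ))], t * u ^ r * v ^ (1 - (r : ℤ))⟩

/-- Six operations: one for each of the two powers, two products for the coefficient, one product
with the table entry, one addition. -/
theorem Runs.forgetTerm {τ : I → Finset V → Scenario V → F} {ord : List V} {t u v : F} {j : I}
    {a : V} {D' : Finset V} {s : Scenario V} {b : ℚ} (hj : j ≠ i) (hg : g.ForgetGood t u v)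
    (hmul : g.good ⟨[forgetCoeff t u v (forgetScenario ord a s).2, τ j D' s],
      forgetCoeff t u v (forgetScenario ord a s).2 * τ j D' s⟩)
    (hb : g.Accepts (forgetCoeff t u v (forgetScenario ord a s).2 * τ j D' s) b) :
    Runs g i D τ (forgetTerm ord t u v i j a D D' s) ()
      (pt (forgetScenario ord a s).1
        (forgetCoeff t u v (forgetScenario ord a s).2 * τ j D' s)) 6 b := by
  have hr := forgetScenario_snd_le ord a s
  unfold Interlace.forgetTerm
  exact Runs.of_eq (Runs.bind (Runs.powOp hr hg.sq) <| Runs.bind (Runs.signPowOp hr hg.inv) <|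
    Runs.bind (Runs.arith (hg.mul₁ _ hr)) <| Runs.bind (Runs.arith (hg.mul₂ _ hr)) <|
    Runs.bind (Runs.read hj D' s) <| Runs.bind (Runs.arith hmul) <|
    Runs.accumulate hb.1 (hb.2 _)) (by simp only [zero_add]; rfl) rfl (by simp only [zero_add])

section Effects

variable {G : LoopGraph V} (T : NiceTreeDecomposition G I) (ord : List V) (x y : V → F) (u v : F)

/-- The contents of the part `(i, D)` of the table in terms of the parts of the children. -/
noncomputable def nodeTable (τ : I → Finset V → Scenario V → F) (i : I) (D : Finset V) :
    Scenario V → F :=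
  match T.kind i with
  | .leaf => pt emptyScenario 1
  | .join j₁ j₂ => ∑ s₁ ∈ scenarios (T.bag i), ∑ s₂ ∈ scenarios (T.bag i),
      pt (joinScenario ord (G.toggle D) (T.bag i) s₁ s₂) (τ j₁ D s₁ * τ j₂ D s₂)
  | .introduce j a => ∑ s ∈ scenarios (T.bag j),
      pt (introduceScenario (G.toggle D) (T.bag i) a s) (τ j (D.erase a) s)
  | .forget j a => ∑ s ∈ scenarios (T.bag j),
      (pt (ignoreScenario ord a s) (τ j D s)
        + (pt (forgetScenario ord a s).1
            (forgetCoeff (x a) u v (forgetScenario ord a s).2 * τ j D s)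
          + pt (forgetScenario ord a s).1
            (forgetCoeff (y a) u v (forgetScenario ord a s).2 * τ j (insert a D) s)))

/-- The part of the algorithm that fills the part `(i, D)` of the table. -/
noncomputable def nodeStep (i : I) (D : Finset V) : Comp V I F Unit :=
  match T.kind i with
  | .leaf => writeS i D emptyScenario 1
  | .join j₁ j₂ => joinNode G ord i j₁ j₂ (T.bag i) D
  | .introduce j a => introduceNode G i j a (T.bag i) (T.bag j) D
  | .forget j a => forgetNode ord x y u v i j a (T.bag i) (T.bag j) D

variable {T ord x y u v} {m : Machine V I F} {good : ArithStep F → Prop}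

theorem effect_leaf (h : T.kind i = .leaf) (h0 : m.table i D = 0) :
    Effect good 0 i D (nodeTable T ord x y u v m.table i D) m
      (exec (nodeStep T ord x y u v i D) m) := by
  classical
  rw [nodeTable, nodeStep, h]
  refine ⟨fun i' D' hi => writeS_table_of_ne hi, ?_, [], rfl, le_rfl, by simp⟩
  ext s
  change _ = pt emptyScenario 1 s
  rw [writeS_table_self, h0]
  by_cases hs : s = emptyScenario
  · rw [if_pos hs, hs, pt_self]
  · rw [if_neg hs, pt_of_ne hs]; rfl

theorem effect_introduce {j : I} {a : V} (h : T.kind i = .introduce j a)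
    (h0 : m.table i D = 0) :
    Effect good 0 i D (nodeTable T ord x y u v m.table i D) m
      (exec (nodeStep T ord x y u v i D) m) := by
  obtain ⟨hc, haj, hb⟩ := NiceTreeDecomposition.introduce_spec h
  have hji : j ≠ i := ((hc j).2 rfl).adj.ne'
  rw [nodeTable, nodeStep, h]
  simp only [introduceNode]
  rw [exec_initS_bind h0]
  obtain ⟨e₁, e₂, e₃⟩ := exec_forM_write (i := i) (D := D) hji (D' := D.erase a)
    (σ := introduceScenario (G.toggle D) (T.bag i) a) (l := (scenarios (T.bag j)).toList)
    (Finset.nodup_toList _) (by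
      rw [hb]
      refine (introduceScenario_injOn haj).mono fun s hs => ?_
      exact mem_scenarios.1 (Finset.mem_toList.1 hs)) m (fun s _ => by rw [h0]; rfl)
  refine ⟨e₁, ?_, [], e₃, le_rfl, by simp⟩
  rw [e₂, h0, zero_add, Finset.sum_map_toList]

theorem effect_join {j₁ j₂ : I} (h : T.kind i = .join j₁ j₂) (h0 : m.table i D = 0)
    {b : Scenario V → Scenario V → ℚ}
    (hmul : ∀ s₁ ∈ scenarios (T.bag i), ∀ s₂ ∈ scenarios (T.bag i),
      g.good ⟨[m.table j₁ D s₁, m.table j₂ D s₂], m.table j₁ D s₁ * m.table j₂ D s₂⟩)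
    (hacc : ∀ s₁ ∈ scenarios (T.bag i), ∀ s₂ ∈ scenarios (T.bag i),
      g.Accepts (m.table j₁ D s₁ * m.table j₂ D s₂) (b s₁ s₂))
    (hw : g.within 0 0)
    (hb : ∑ s₁ ∈ scenarios (T.bag i), ∑ s₂ ∈ scenarios (T.bag i), b s₁ s₂ ≤ g.limit) :
    Effect g.good (2 * (scenarios (T.bag i)).card ^ 2) i D
      (nodeTable T ord x y u v m.table i D) m (exec (nodeStep T ord x y u v i D) m) ∧
    g.within (nodeTable T ord x y u v m.table i D)
      (∑ s₁ ∈ scenarios (T.bag i), ∑ s₂ ∈ scenarios (T.bag i), b s₁ s₂) := by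
  obtain ⟨-, hc, -⟩ := NiceTreeDecomposition.join_spec h
  have h₁ : j₁ ≠ i := ((hc j₁).2 (Or.inl rfl)).adj.ne'
  have h₂ : j₂ ≠ i := ((hc j₂).2 (Or.inr rfl)).adj.ne'
  rw [nodeTable, nodeStep, h]
  simp only [joinNode]
  rw [exec_initS_bind h0]
  refine (Runs.effect (g := g) (N := 2 * (scenarios (T.bag i)).card *
    (scenarios (T.bag i)).card) (Runs.forM_toList fun s₁ hs₁ => Runs.forM_toList
    fun s₂ hs₂ => ?_) h0 hw hb).imp_left fun e => e.mono (by rw [sq, mul_assoc])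
  exact Runs.of_eq (Runs.bind (Runs.read h₁ D s₁) <| Runs.bind (Runs.read h₂ D s₂) <|
    Runs.bind (Runs.arith (hmul s₁ hs₁ s₂ hs₂)) <|
    Runs.accumulate (hacc s₁ hs₁ s₂ hs₂).1 ((hacc s₁ hs₁ s₂ hs₂).2 _))
    (by simp only [zero_add]) rfl (by simp only [zero_add])

theorem effect_forget {j : I} {a : V} (h : T.kind i = .forget j a) (h0 : m.table i D = 0)
    {b₁ b₂ b₃ : Scenario V → ℚ} (hx : g.ForgetGood (x a) u v) (hy : g.ForgetGood (y a) u v)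
    (hmulx : ∀ r ≤ 2, ∀ s ∈ scenarios (T.bag j),
      g.good ⟨[forgetCoeff (x a) u v r, m.table j D s],
        forgetCoeff (x a) u v r * m.table j D s⟩)
    (hmuly : ∀ r ≤ 2, ∀ s ∈ scenarios (T.bag j),
      g.good ⟨[forgetCoeff (y a) u v r, m.table j (insert a D) s],
        forgetCoeff (y a) u v r * m.table j (insert a D) s⟩)
    (hacc₁ : ∀ s ∈ scenarios (T.bag j), g.Accepts (m.table j D s) (b₁ s))
    (hacc₂ : ∀ r ≤ 2, ∀ s ∈ scenarios (T.bag j),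
      g.Accepts (forgetCoeff (x a) u v r * m.table j D s) (b₂ s))
    (hacc₃ : ∀ r ≤ 2, ∀ s ∈ scenarios (T.bag j),
      g.Accepts (forgetCoeff (y a) u v r * m.table j (insert a D) s) (b₃ s))
    (hw : g.within 0 0)
    (hb : ∑ s ∈ scenarios (T.bag j), (b₁ s + (b₂ s + b₃ s)) ≤ g.limit) :
    Effect g.good (13 * (scenarios (T.bag j)).card) i D
      (nodeTable T ord x y u v m.table i D) m (exec (nodeStep T ord x y u v i D) m) ∧
    g.within (nodeTable T ord x y u v m.table i D)
      (∑ s ∈ scenarios (T.bag j), (b₁ s + (b₂ s + b₃ s))) := by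
  obtain ⟨hc, -, -⟩ := NiceTreeDecomposition.forget_spec h
  have hji : j ≠ i := ((hc j).2 rfl).adj.ne'
  rw [nodeTable, nodeStep, h]
  simp only [forgetNode]
  rw [exec_initS_bind h0]
  refine Runs.effect (g := g) (Runs.forM_toList fun s hs => ?_) h0 hw hb
  have hr := forgetScenario_snd_le ord a s
  -- Per scenario: 1 addition for ignoring a, and 6 operations for each of the two forget terms,
  -- hence 13.
  exact Runs.of_eq (Runs.bind (Runs.read hji D s) <|
    Runs.bind (Runs.accumulate (hacc₁ s hs).1 ((hacc₁ s hs).2 _)) <|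
    Runs.bind (Runs.forgetTerm hji hx (hmulx _ hr s hs) (hacc₂ _ hr s hs)) <|
    Runs.forgetTerm hji hy (hmuly _ hr s hs) (hacc₃ _ hr s hs))
    (by simp only [zero_add]) rfl (by simp only [zero_add])

end Effects

end Nodes

/-! ### The invariant along the traversal. -/

section Traversal

variable {V I F : Type} [Field F] [Fintype V] [DecidableEq V] {G : LoopGraph V}
  {T : NiceTreeDecomposition G I} {ord : List V} {x y : V → F} {u v : F}

theorem exec_forM_nodeStep {Spec : I → Finset V → (Scenario V → F) → Prop}
    {good : ArithStep F → Prop} {N : ℕ} {i : I}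
    (hstep : ∀ D m, D ⊆ T.bag i → m.table i D = 0 →
      (∀ j, T.IsChild i j → ∀ D' ⊆ T.bag j, Spec j D' (m.table j D')) →
      ∃ f, Spec i D f ∧ Effect good N i D f m (exec (nodeStep T ord x y u v i D) m))
    (l : List (Finset V)) (hl : l.Nodup) (hsub : ∀ D ∈ l, D ⊆ T.bag i) (m : Machine V I F)
    (h0 : ∀ D ∈ l, m.table i D = 0)
    (hch : ∀ j, T.IsChild i j → ∀ D' ⊆ T.bag j, Spec j D' (m.table j D')) :
    (∀ i' D', i' ≠ i ∨ D' ∉ l →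
      (exec (l.forM (nodeStep T ord x y u v i)) m).table i' D' = m.table i' D') ∧
    (∀ D ∈ l, Spec i D ((exec (l.forM (nodeStep T ord x y u v i)) m).table i D)) ∧
    ∃ new, (exec (l.forM (nodeStep T ord x y u v i)) m).record = new ++ m.record ∧
      new.length ≤ l.length * N ∧ ∀ step ∈ new, good step := by
  induction l generalizing m with
  | nil => exact ⟨fun _ _ _ => rfl, by simp, [], rfl, by simp, by simp⟩
  | cons D l ih =>
    rw [exec_forM_cons]
    obtain ⟨hD, hl⟩ := List.nodup_cons.1 hl
    obtain ⟨f, hf, e₁, e₂, new, e₃, e₄, e₅⟩ := hstep D m (hsub D (by simp)) (h0 D (by simp)) hch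
    set m₁ := exec (nodeStep T ord x y u v i D) m
    obtain ⟨k₁, k₂, new', k₃, k₄, k₅⟩ := ih hl (fun D' hD' => hsub D' (by simp [hD'])) m₁
      (fun D' hD' => by
        rw [e₁ i D' (Or.inr fun h => hD (h ▸ hD'))]
        exact h0 D' (by simp [hD']))
      (fun j hj D' hD' => by
        rw [e₁ j D' (Or.inl hj.adj.ne')]
        exact hch j hj D' hD')
    refine ⟨fun i' D' h => ?_, fun D' hD' => ?_, new' ++ new, ?_, ?_, fun step hs => ?_⟩
    · rw [List.mem_cons, not_or] at h
      rw [k₁ i' D' (h.imp id And.right), e₁ i' D' (h.imp id And.left)]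
    · rcases List.mem_cons.1 hD' with rfl | hD'
      · rwa [k₁ i D' (Or.inr hD), e₂]
      · exact k₂ D' hD'
    · rw [k₃, e₃, List.append_assoc]
    · rw [List.length_append, List.length_cons, add_one_mul]; omega
    · rcases List.mem_append.1 hs with hs | hs
      · exact k₅ step hs
      · exact e₅ step hs

/-- The loop invariant: rows of nodes already visited satisfy `Spec`, all other rows are zero.
Children precede parents, so their rows are finished when needed. `Spec` is left open because it is
instantiated both with correctness and with the size bound. -/
theorem exec_forM_traversal [DecidableEq I] {Spec : I → Finset V → (Scenario V → F) → Prop}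
    {good : ArithStep F → Prop} {N P : ℕ} {t : List I} (ht : T.IsBottomUp t)
    (hP : ∀ i, 2 ^ (T.bag i).card ≤ P)
    (hstep : ∀ i D m, D ⊆ T.bag i → m.table i D = 0 →
      (∀ j, T.IsChild i j → ∀ D' ⊆ T.bag j, Spec j D' (m.table j D')) →
      ∃ f, Spec i D f ∧ Effect good N i D f m (exec (nodeStep T ord x y u v i D) m))
    (l₂ : List I) : ∀ (l₁ : List I) (m : Machine V I F), t = l₁ ++ l₂ →
    (∀ i ∈ l₁, ∀ D ⊆ T.bag i, Spec i D (m.table i D)) →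
    (∀ i ∉ l₁, ∀ D, m.table i D = 0) →
    ∀ m', m' = exec (l₂.forM fun i =>
      (T.bag i).powerset.toList.forM (nodeStep T ord x y u v i)) m →
    (∀ i, ∀ D ⊆ T.bag i, Spec i D (m'.table i D)) ∧
    ∃ new, m'.record = new ++ m.record ∧ new.length ≤ l₂.length * (P * N) ∧
      ∀ step ∈ new, good step := by
  induction l₂ with
  | nil =>
    rintro l₁ m htl hs - m' rfl
    rw [List.append_nil] at htl
    refine ⟨fun i D hD => hs i (htl ▸ ht.2.1 i) D hD, [], rfl, by simp, by simp⟩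
  | cons i l₂ ih =>
    rintro l₁ m htl hs h0 m' rfl
    rw [exec_forM_cons]
    have hi : i ∉ l₁ := fun h => by
      have := ht.1
      rw [htl, List.nodup_append] at this
      exact this.2.2 i h i (by simp) rfl
    have hchild : ∀ j, T.IsChild i j → j ∈ l₁ := fun j hj => by
      have := ht.2.2 i j hj
      rw [htl, List.idxOf_append_of_notMem hi, List.idxOf_cons_self, add_zero] at this
      by_contra hjl
      rw [List.idxOf_append_of_notMem hjl] at this
      omega
    obtain ⟨e₁, e₂, new, e₃, e₄, e₅⟩ := exec_forM_nodeStep (hstep i)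
      (T.bag i).powerset.toList (Finset.nodup_toList _)
      (fun D hD => Finset.mem_powerset.1 (Finset.mem_toList.1 hD)) m (fun D _ => h0 i hi D)
      (fun j hj D' hD' => hs j (hchild j hj) D' hD')
    obtain ⟨k₁, new', k₂, k₃, k₄⟩ := ih (l₁ ++ [i]) _ (by simp [htl])
      (fun i' hi' D hD => by
        rcases List.mem_append.1 hi' with hi' | hi'
        · rw [e₁ i' D (Or.inl fun h => hi (h ▸ hi'))]
          exact hs i' hi' D hD
        · rw [List.mem_singleton.1 hi'] at hD ⊢
          exact e₂ D (Finset.mem_toList.2 (Finset.mem_powerset.2 hD)))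
      (fun i' hi' D => by
        rw [List.mem_append, List.mem_singleton, not_or] at hi'
        rw [e₁ i' D (Or.inl hi'.2)]
        exact h0 i' hi'.1 D) _ rfl
    refine ⟨k₁, new' ++ new, ?_, ?_, fun step hstep' => ?_⟩
    · rw [k₂, e₃, List.append_assoc]
    · rw [Finset.length_toList, Finset.card_powerset] at e₄
      have := e₄.trans (Nat.mul_le_mul_right N (hP i))
      rw [List.length_append, List.length_cons, add_one_mul]
      omega
    · rcases List.mem_append.1 hstep' with hs' | hs'
      · exact k₄ step hs'
      · exact e₅ step hs'

theorem algorithm_spec [Fintype I] [DecidableEq I] {Spec : I → Finset V → (Scenario V → F) → Prop}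
    {good : ArithStep F → Prop} {N P : ℕ} {t : List I} (ht : T.IsBottomUp t)
    (hP : ∀ i, 2 ^ (T.bag i).card ≤ P)
    (hstep : ∀ i D m, D ⊆ T.bag i → m.table i D = 0 →
      (∀ j, T.IsChild i j → ∀ D' ⊆ T.bag j, Spec j D' (m.table j D')) →
      ∃ f, Spec i D f ∧
        Effect good N i D f m (exec (nodeStep T (T.vertexOrder t) x y u v i D) m)) :
    (∃ f, Spec T.root ∅ f ∧ output T t x y u v = f emptyScenario) ∧
    (operations T t x y u v).length ≤ Fintype.card I * (P * N) ∧
    ∀ step ∈ operations T t x y u v, good step := by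
  obtain ⟨h₁, new, h₂, h₃, h₄⟩ := exec_forM_traversal ht hP hstep t [] ⟨fun _ _ _ => 0, []⟩ rfl
    (by simp) (fun _ _ _ => rfl) _ rfl
  have hops : operations T t x y u v = new := by
    rw [List.append_nil] at h₂
    exact h₂
  have hlen : t.length ≤ Fintype.card I := by
    rw [← List.toFinset_card_of_nodup ht.1]
    exact Finset.card_le_univ _
  refine ⟨⟨_, h₁ T.root ∅ (Finset.empty_subset _), rfl⟩, ?_, ?_⟩
  · rw [hops]
    exact h₃.trans (Nat.mul_le_mul_right _ hlen)
  · rw [hops]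
    exact h₄

end Traversal

/-! ### Terms of the interlace polynomial and how they multiply. -/

section Monomials

variable {V F : Type} [Field F] [Fintype V] [DecidableEq V]

/-- The pairs of disjoint subsets of `S`. -/
def disjointPairs (S : Finset V) : Finset (Finset V × Finset V) :=
  Finset.univ.filter fun p => Disjoint p.1 p.2 ∧ p.1 ∪ p.2 ⊆ S

theorem mem_disjointPairs {S : Finset V} {p : Finset V × Finset V} :
    p ∈ disjointPairs S ↔ Disjoint p.1 p.2 ∧ p.1 ∪ p.2 ⊆ S := by
  simp [disjointPairs]

theorem disjointPairs_empty : disjointPairs (∅ : Finset V) = {(∅, ∅)} := by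
  ext p
  simp only [mem_disjointPairs, Finset.subset_empty, Finset.union_eq_empty, Finset.mem_singleton]
  constructor
  · rintro ⟨-, h₁, h₂⟩; exact Prod.ext h₁ h₂
  · rintro rfl; simp

/-- The vertex a is in neither set, in the first or in the second, matching the three updates at a
forget node. -/
theorem sum_disjointPairs_insert {E : Type*} [AddCommMonoid E] {S : Finset V} {a : V} (ha : a ∉ S)
    (f : Finset V × Finset V → E) :
    ∑ p ∈ disjointPairs (insert a S), f p = ∑ p ∈ disjointPairs S, f p +
      (∑ p ∈ disjointPairs S, f (insert a p.1, p.2) +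
        ∑ p ∈ disjointPairs S, f (p.1, insert a p.2)) := by
  have hS : ∀ p ∈ disjointPairs S, a ∉ p.1 ∧ a ∉ p.2 := fun p hp => by
    have := (mem_disjointPairs.1 hp).2
    exact ⟨fun h => ha (this (Finset.mem_union_left _ h)),
      fun h => ha (this (Finset.mem_union_right _ h))⟩
  rw [← Finset.sum_filter_not_add_sum_filter (disjointPairs (insert a S))
    (fun p => a ∈ p.1 ∨ a ∈ p.2) f,
    ← Finset.sum_filter_add_sum_filter_not ((disjointPairs (insert a S)).filter
      fun p => a ∈ p.1 ∨ a ∈ p.2) (fun p => a ∈ p.1) f]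
  congr 1
  · refine Finset.sum_congr ?_ fun _ _ => rfl
    ext p
    simp only [Finset.mem_filter, mem_disjointPairs, not_or]
    constructor
    · rintro ⟨⟨h, hs⟩, h₁, h₂⟩
      exact ⟨h, (Finset.subset_insert_iff_of_notMem (by simp [h₁, h₂])).1 hs⟩
    · rintro ⟨h, hs⟩
      exact ⟨⟨h, hs.trans (Finset.subset_insert _ _)⟩, hS p (mem_disjointPairs.2 ⟨h, hs⟩)⟩
  congr 1
  · symm
    refine Finset.sum_nbij' (fun p => (insert a p.1, p.2)) (fun p => (p.1.erase a, p.2))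
      ?_ ?_ ?_ ?_ fun _ _ => rfl
    · intro p hp
      obtain ⟨h, hs⟩ := mem_disjointPairs.1 hp
      simp only [Finset.mem_filter, mem_disjointPairs, Finset.disjoint_insert_left,
        Finset.mem_insert_self, true_or, and_true]
      exact ⟨⟨(hS p hp).2, h⟩, by rw [Finset.insert_union]; exact Finset.insert_subset_insert _ hs⟩
    · intro p hp
      simp only [Finset.mem_filter, mem_disjointPairs] at hp ⊢
      obtain ⟨⟨⟨h, hs⟩, -⟩, h₁⟩ := hp
      refine ⟨h.mono_left (Finset.erase_subset _ _), fun b hb => ?_⟩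
      have h₂ := Finset.disjoint_left.1 h h₁
      have hba : b ≠ a := by
        rintro rfl
        simp [h₂] at hb
      have := hs (Finset.union_subset_union_left (Finset.erase_subset _ _) hb)
      exact (Finset.mem_insert.1 this).resolve_left hba
    · intro p hp
      simp [Finset.erase_insert (hS p hp).1]
    · intro p hp
      simp only [Finset.mem_filter] at hp
      simp [Finset.insert_erase hp.2]
  · symm
    refine Finset.sum_nbij' (fun p => (p.1, insert a p.2)) (fun p => (p.1, p.2.erase a))
      ?_ ?_ ?_ ?_ fun _ _ => rfl
    · intro p hp
      obtain ⟨h, hs⟩ := mem_disjointPairs.1 hp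
      simp only [Finset.mem_filter, mem_disjointPairs, Finset.disjoint_insert_right,
        Finset.mem_insert_self, or_true, and_true]
      exact ⟨⟨⟨(hS p hp).1, h⟩, by
        rw [Finset.union_insert]; exact Finset.insert_subset_insert _ hs⟩, (hS p hp).1⟩
    · intro p hp
      simp only [Finset.mem_filter, mem_disjointPairs] at hp ⊢
      obtain ⟨⟨⟨h, hs⟩, h₂⟩, h₁⟩ := hp
      refine ⟨h.mono_right (Finset.erase_subset _ _), fun b hb => ?_⟩
      have hba : b ≠ a := by
        rintro rfl
        simp [h₁] at hb
      have := hs (Finset.union_subset_union_right (Finset.erase_subset _ _) hb)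
      exact (Finset.mem_insert.1 this).resolve_left hba
    · intro p hp
      simp [Finset.erase_insert (hS p hp).2]
    · intro p hp
      simp only [Finset.mem_filter] at hp
      simp [Finset.insert_erase (hp.1.2.resolve_left hp.2)]

theorem sum_disjointPairs_union {E : Type*} [AddCommMonoid E] {S T : Finset V} (hd : Disjoint S T)
    (f : Finset V × Finset V → E) :
    ∑ p ∈ disjointPairs (S ∪ T), f p =
      ∑ p ∈ disjointPairs S, ∑ q ∈ disjointPairs T, f (p.1 ∪ q.1, p.2 ∪ q.2) := by
  rw [← Finset.sum_product']
  symm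
  refine Finset.sum_nbij' (fun r => (r.1.1 ∪ r.2.1, r.1.2 ∪ r.2.2))
    (fun p => ((p.1 ∩ S, p.2 ∩ S), (p.1 ∩ T, p.2 ∩ T))) ?_ ?_ ?_ ?_ fun _ _ => rfl
  · rintro ⟨p, q⟩ hr
    obtain ⟨hp, hq⟩ := Finset.mem_product.1 hr
    obtain ⟨h₁, h₂⟩ := mem_disjointPairs.1 hp
    obtain ⟨h₃, h₄⟩ := mem_disjointPairs.1 hq
    rw [Finset.union_subset_iff] at h₂ h₄
    refine mem_disjointPairs.2 ⟨?_, ?_⟩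
    · simp only [Finset.disjoint_union_left, Finset.disjoint_union_right]
      exact ⟨⟨h₁, hd.symm.mono h₄.1 h₂.2⟩, hd.mono h₂.1 h₄.2, h₃⟩
    · exact Finset.union_subset (Finset.union_subset_union h₂.1 h₄.1)
        (Finset.union_subset_union h₂.2 h₄.2)
  · intro p hp
    obtain ⟨h₁, h₂⟩ := mem_disjointPairs.1 hp
    refine Finset.mem_product.2 ⟨mem_disjointPairs.2 ⟨?_, ?_⟩, mem_disjointPairs.2 ⟨?_, ?_⟩⟩
    · exact h₁.mono Finset.inter_subset_left Finset.inter_subset_left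
    · exact Finset.union_subset Finset.inter_subset_right Finset.inter_subset_right
    · exact h₁.mono Finset.inter_subset_left Finset.inter_subset_left
    · exact Finset.union_subset Finset.inter_subset_right Finset.inter_subset_right
  · rintro ⟨p, q⟩ hr
    obtain ⟨hp, hq⟩ := Finset.mem_product.1 hr
    have h₂ := Finset.union_subset_iff.1 (mem_disjointPairs.1 hp).2
    have h₄ := Finset.union_subset_iff.1 (mem_disjointPairs.1 hq).2
    have hS : ∀ {A B : Finset V}, A ⊆ S → B ⊆ T → (A ∪ B) ∩ S = A := fun hA hB => by
      rw [Finset.union_inter_distrib_right, Finset.inter_eq_left.2 hA,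
        (Finset.disjoint_iff_inter_eq_empty.1 (hd.symm.mono_left hB)), Finset.union_empty]
    have hT : ∀ {A B : Finset V}, A ⊆ S → B ⊆ T → (A ∪ B) ∩ T = B := fun hA hB => by
      rw [Finset.union_inter_distrib_right, Finset.inter_eq_left.2 hB,
        (Finset.disjoint_iff_inter_eq_empty.1 (hd.mono_left hA)), Finset.empty_union]
    simp only [hS h₂.1 h₄.1, hS h₂.2 h₄.2, hT h₂.1 h₄.1, hT h₂.2 h₄.2]
  · intro p hp
    have h := Finset.union_subset_iff.1 (mem_disjointPairs.1 hp).2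
    simp only [← Finset.inter_union_distrib_left, Finset.inter_eq_left.2 h.1,
      Finset.inter_eq_left.2 h.2]

/-- The term of the interlace polynomial that belongs to a pair of sets, evaluated. -/
noncomputable def term (G : LoopGraph V) (x y : V → F) (u v : F) (p : Finset V × Finset V) : F :=
  (∏ a ∈ p.1, x a) * (∏ a ∈ p.2, y a) * u ^ (G.toggle p.2).rk (p.1 ∪ p.2)
    * v ^ (G.toggle p.2).nullity (p.1 ∪ p.2)

variable {G : LoopGraph V} {x y : V → F} {u v : F}

theorem sum_term : ∑ p ∈ disjointPairs Finset.univ, term G x y u v p =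
    MvPolynomial.aeval (evalPoint x y u v) (interlacePolynomial G) := by
  simp only [interlacePolynomial, map_sum, map_mul, map_prod, map_pow, MvPolynomial.aeval_X,
    evalPoint]
  refine Finset.sum_congr ?_ fun _ _ => rfl
  ext p
  simp [mem_disjointPairs]

/-- Shows in particular that the truncated subtraction in `nullity` is a true one. -/
theorem rk_and_nullity {B D W : Finset V} (hD : Disjoint D W) :
    (G.toggle B).nullity W =
      Module.finrank (ZMod 2) (radical (adjOn (G.toggle (B ∪ D)) Finset.univ) W) ∧
    Module.finrank (ZMod 2) (radical (adjOn (G.toggle (B ∪ D)) Finset.univ) W)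
      + (G.toggle B).rk W = W.card := by
  have := rk_toggle_add_finrank (G := G) (B := B) hD
  exact ⟨by rw [LoopGraph.nullity]; omega, this⟩

theorem term_empty : term G x y u v (∅, ∅) = 1 := by
  obtain ⟨h₁, h₂⟩ := rk_and_nullity (G := G) (B := ∅) (Finset.disjoint_empty_right (∅ : Finset V))
  rw [finrank_radical_empty] at h₁ h₂
  have h₃ : (G.toggle ∅).rk ∅ = 0 := by simpa using h₂
  simp [term, h₁, h₃]

/-- The exponent 1 - r can be -1; here v ≠ 0 enters the correctness proof. -/
theorem pow_mul_zpow_eq (hv : v ≠ 0) {k k' n n' r : ℕ} (hk : k' = k + r) (hn : n' + r = n + 1) :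
    u ^ k' * v ^ n' = u ^ r * v ^ (1 - (r : ℤ)) * (u ^ k * v ^ n) := by
  have h : v ^ n' = v ^ (1 - (r : ℤ)) * v ^ n := by
    rw [← zpow_natCast v n', ← zpow_natCast v n, ← zpow_add₀ hv]
    congr 1
    omega
  rw [hk, h, pow_add]
  ring

/-- Without edges between S and T the matrix is block diagonal, so ranks and nullities add and the
monomials multiply. -/
theorem term_union {p q : Finset V × Finset V} {S T : Finset V} (hp : p ∈ disjointPairs S)
    (hq : q ∈ disjointPairs T) (hd : Disjoint S T) (hadj : ∀ a ∈ S, ∀ b ∈ T, ¬ G.Adj a b) :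
    term G x y u v (p.1 ∪ q.1, p.2 ∪ q.2) = term G x y u v p * term G x y u v q := by
  obtain ⟨hp₁, hp₂⟩ := mem_disjointPairs.1 hp
  obtain ⟨hq₁, hq₂⟩ := mem_disjointPairs.1 hq
  have hpS := Finset.union_subset_iff.1 hp₂
  have hqT := Finset.union_subset_iff.1 hq₂
  have hW : Disjoint (p.1 ∪ p.2) (q.1 ∪ q.2) := hd.mono hp₂ hq₂
  have hWW : p.1 ∪ q.1 ∪ (p.2 ∪ q.2) = (p.1 ∪ p.2) ∪ (q.1 ∪ q.2) :=
    Finset.union_union_union_comm _ _ _ _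
  have hne : ∀ a ∈ S, ∀ b ∈ T, a ≠ b := fun a ha b hb h => Finset.disjoint_left.1 hd ha (h ▸ hb)
  obtain ⟨n₁, k₁⟩ := rk_and_nullity (G := G) (B := p.2) (D := q.2) (W := p.1 ∪ p.2)
    (hW.symm.mono_left Finset.subset_union_right)
  obtain ⟨n₂, k₂⟩ := rk_and_nullity (G := G) (B := q.2) (D := p.2) (W := q.1 ∪ q.2)
    (hW.mono_left Finset.subset_union_right)
  obtain ⟨n, k⟩ := rk_and_nullity (G := G) (B := p.2 ∪ q.2) (D := ∅)
    (W := (p.1 ∪ p.2) ∪ (q.1 ∪ q.2)) (Finset.disjoint_empty_left _)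
  have hu := finrank_radical_union (M := adjOn (G.toggle (p.2 ∪ q.2)) Finset.univ) hW
    (fun a ha b hb =>
      adjOn_toggle_eq_zero (hne a (hp₂ ha) b (hq₂ hb)) (hadj a (hp₂ ha) b (hq₂ hb)))
    (fun a ha b hb => adjOn_toggle_eq_zero (hne b (hp₂ hb) a (hq₂ ha)).symm
      fun h => hadj b (hp₂ hb) a (hq₂ ha) (G.symm _ _ h))
  rw [Finset.union_empty, hu] at n k
  rw [Finset.union_comm q.2 p.2] at n₂ k₂
  rw [Finset.card_union_of_disjoint hW] at k
  have hrk : (G.toggle (p.2 ∪ q.2)).rk ((p.1 ∪ p.2) ∪ (q.1 ∪ q.2)) =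
      (G.toggle p.2).rk (p.1 ∪ p.2) + (G.toggle q.2).rk (q.1 ∪ q.2) := by omega
  simp only [term, hWW]
  rw [n, hrk, ← n₁, ← n₂, Finset.prod_union (hd.mono hpS.1 hqT.1),
    Finset.prod_union (hd.mono hpS.2 hqT.2), pow_add, pow_add]
  ring

end Monomials

/-! ### Correctness of the table. -/

section Correct

variable {V I F : Type} [Field F] [Fintype V] [DecidableEq V] {G : LoopGraph V}
  (T : NiceTreeDecomposition G I) {ord : List V} (x y : V → F) (u v : F)

/-- The scenario `s` of the bag of `i` belongs to the pair `p` of sets of vertices that are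
forgotten below `i`, and to the set `D` of toggled vertices of the bag. -/
def IsScenarioOf (i : I) (D : Finset V) (p : Finset V × Finset V) (s : Scenario V) : Prop :=
  IsScenario (T.bag i) s ∧
    Represents (adjOn (G.toggle (p.2 ∪ D)) Finset.univ) (p.1 ∪ p.2) (T.bag i) s

/-- The part `(i, D)` of the table is correct: it collects the terms of the interlace polynomial
of the forgotten vertices according to their scenarios. -/
def Correct (i : I) (D : Finset V) (f : Scenario V → F) : Prop :=
  ∃ σ : Finset V × Finset V → Scenario V,
    (∀ p ∈ disjointPairs (T.forgotten i), IsScenarioOf T i D p (σ p)) ∧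
    f = ∑ p ∈ disjointPairs (T.forgotten i), pt (σ p) (term G x y u v p)

variable {T x y u v} {i : I} {D : Finset V} {τ : I → Finset V → Scenario V → F}

theorem adjOn_apply_univ {H : LoopGraph V} {U : Finset V} {a b : V} (ha : a ∈ U) (hb : b ∈ U) :
    adjOn H U a b = adjOn H Finset.univ a b := by
  by_cases h : H.Adj a b <;> simp [adjOn, ha, hb, h]

/-- At the root every vertex is forgotten and the bag is empty, so all terms sit at the single entry
of the empty scenario. -/
theorem Correct.root {f : Scenario V → F} (h : Correct T x y u v T.root ∅ f) :
    f emptyScenario = MvPolynomial.aeval (evalPoint x y u v) (interlacePolynomial G) := by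
  obtain ⟨σ, hσ, rfl⟩ := h
  rw [NiceTreeDecomposition.forgotten_root] at hσ ⊢
  rw [← sum_term, Finset.sum_apply]
  refine Finset.sum_congr rfl fun p hp => ?_
  have := (hσ p hp).1
  rw [T.bag_root] at this
  rw [this.eq_emptyScenario, pt_self]

theorem correct_leaf (h : T.kind i = .leaf) :
    Correct T x y u v i D (nodeTable T ord x y u v τ i D) := by
  obtain ⟨hb, hF⟩ := NiceTreeDecomposition.forgotten_leaf h
  refine ⟨fun _ => emptyScenario, fun p hp => ?_, ?_⟩
  · rw [hF, disjointPairs_empty, Finset.mem_singleton] at hp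
    subst hp
    rw [IsScenarioOf, hb, Finset.union_empty]
    exact ⟨isScenario_emptyScenario, represents_empty _⟩
  · rw [nodeTable, h, hF, disjointPairs_empty, Finset.sum_singleton, term_empty]

theorem IsScenarioOf.join {j₁ j₂ : I} (hord : ∀ a, a ∈ ord) (h : T.kind i = .join j₁ j₂)
    {p q : Finset V × Finset V} {s₁ s₂ : Scenario V}
    (hp : p ∈ disjointPairs (T.forgotten j₁)) (hq : q ∈ disjointPairs (T.forgotten j₂))
    (h₁ : IsScenarioOf T j₁ D p s₁) (h₂ : IsScenarioOf T j₂ D q s₂) :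
    IsScenarioOf T i D (p.1 ∪ q.1, p.2 ∪ q.2)
      (joinScenario ord (G.toggle D) (T.bag i) s₁ s₂) := by
  obtain ⟨-, -, hb₁, hb₂⟩ := NiceTreeDecomposition.join_spec h
  have hd := NiceTreeDecomposition.disjoint_forgotten_join h
  have hp₂ := (mem_disjointPairs.1 hp).2
  have hq₂ := (mem_disjointPairs.1 hq).2
  have hdU₁ : Disjoint (T.forgotten j₁) (T.bag i) :=
    hb₁ ▸ NiceTreeDecomposition.disjoint_forgotten_bag j₁
  have hdU₂ : Disjoint (T.forgotten j₂) (T.bag i) :=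
    hb₂ ▸ NiceTreeDecomposition.disjoint_forgotten_bag j₂
  rw [IsScenarioOf, ← hb₁] at h₁
  rw [IsScenarioOf, ← hb₂] at h₂
  refine ⟨h₁.1.join hord h₂.1, ?_⟩
  have hp2 : ∀ b ∈ p.2, b ∈ T.forgotten j₁ := fun b hb => hp₂ (Finset.mem_union_right _ hb)
  have hq2 : ∀ b ∈ q.2, b ∈ T.forgotten j₂ := fun b hb => hq₂ (Finset.mem_union_right _ hb)
  have hne : ∀ a ∈ T.forgotten j₁, ∀ b ∈ T.forgotten j₂, a ≠ b := fun a ha b hb h =>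
    Finset.disjoint_left.1 hd ha (h ▸ hb)
  have hnadj := fun a ha b hb => NiceTreeDecomposition.not_adj_of_forgotten_join h (a := a)
    (b := b) ha hb
  -- Both scenarios are transferred to the graph with all of p.2, q.2 and D toggled: vertices
  -- forgotten on the other side lie neither in W nor in the bag.
  have g₁ : Represents (adjOn (G.toggle (p.2 ∪ q.2 ∪ D)) Finset.univ) (p.1 ∪ p.2) (T.bag i) s₁ := by
    refine h₁.2.congr fun b hb c _ => adjOn_toggle_congr fun _ => ?_
    have : b ∉ q.2 := fun hbq => by
      rcases Finset.mem_union.1 hb with hb | hb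
      · exact hne b (hp₂ hb) b (hq2 b hbq) rfl
      · exact Finset.disjoint_left.1 hdU₂ (hq2 b hbq) hb
    simp [this]
  have g₂ : Represents (adjOn (G.toggle (p.2 ∪ q.2 ∪ D)) Finset.univ) (q.1 ∪ q.2) (T.bag i) s₂ := by
    refine h₂.2.congr fun b hb c _ => adjOn_toggle_congr fun _ => ?_
    have : b ∉ p.2 := fun hbp => by
      rcases Finset.mem_union.1 hb with hb | hb
      · exact hne b (hp2 b hbp) b (hq₂ hb) rfl
      · exact Finset.disjoint_left.1 hdU₁ (hp2 b hbp) hb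
    simp [this]
  have key := g₁.join g₂ (s' := joinScenario ord (G.toggle D) (T.bag i) s₁ s₂)
    (A := adjOn (G.toggle D) (T.bag i))
    (fun a ha b hb => adjOn_toggle_eq_zero (hne a (hp₂ ha) b (hq₂ hb))
      (hnadj a (hp₂ ha) b (hq₂ hb)))
    (fun a ha b hb => adjOn_toggle_eq_zero (hne b (hp₂ hb) a (hq₂ ha)).symm
      fun h => hnadj b (hp₂ hb) a (hq₂ ha) (G.symm _ _ h))
    (fun a ha b hb => (adjOn_apply_univ ha hb).trans <| adjOn_toggle_congr fun _ => by
      have h₁ : a ∉ p.2 := fun h => Finset.disjoint_left.1 hdU₁ (hp2 a h) ha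
      have h₂ : a ∉ q.2 := fun h => Finset.disjoint_left.1 hdU₂ (hq2 a h) ha
      simp [h₁, h₂])
    (span_joinScenario_fst s₁ s₂) rfl
  rwa [Finset.union_union_union_comm] at key

theorem correct_join {j₁ j₂ : I} (hord : ∀ a, a ∈ ord) (h : T.kind i = .join j₁ j₂)
    (h₁ : Correct T x y u v j₁ D (τ j₁ D)) (h₂ : Correct T x y u v j₂ D (τ j₂ D)) :
    Correct T x y u v i D (nodeTable T ord x y u v τ i D) := by
  obtain ⟨σ₁, hσ₁, e₁⟩ := h₁
  obtain ⟨σ₂, hσ₂, e₂⟩ := h₂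
  obtain ⟨-, -, hb₁, hb₂⟩ := NiceTreeDecomposition.join_spec h
  have hd := NiceTreeDecomposition.disjoint_forgotten_join h
  set F₁ := T.forgotten j₁ with hF₁
  set F₂ := T.forgotten j₂ with hF₂
  have hF : T.forgotten i = F₁ ∪ F₂ := NiceTreeDecomposition.forgotten_join h
  have hr : ∀ p ∈ disjointPairs F₁, ∀ q ∈ disjointPairs F₂,
      (p.1 ∪ q.1) ∩ F₁ = p.1 ∧ (p.2 ∪ q.2) ∩ F₁ = p.2 ∧
      (p.1 ∪ q.1) ∩ F₂ = q.1 ∧ (p.2 ∪ q.2) ∩ F₂ = q.2 := by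
    intro p hp q hq
    have h₂ := Finset.union_subset_iff.1 (mem_disjointPairs.1 hp).2
    have h₄ := Finset.union_subset_iff.1 (mem_disjointPairs.1 hq).2
    have hS : ∀ {A B : Finset V}, A ⊆ F₁ → B ⊆ F₂ → (A ∪ B) ∩ F₁ = A := fun hA hB => by
      rw [Finset.union_inter_distrib_right, Finset.inter_eq_left.2 hA,
        (Finset.disjoint_iff_inter_eq_empty.1 (hd.symm.mono_left hB)), Finset.union_empty]
    have hT : ∀ {A B : Finset V}, A ⊆ F₁ → B ⊆ F₂ → (A ∪ B) ∩ F₂ = B := fun hA hB => by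
      rw [Finset.union_inter_distrib_right, Finset.inter_eq_left.2 hB,
        (Finset.disjoint_iff_inter_eq_empty.1 (hd.mono_left hA)), Finset.empty_union]
    exact ⟨hS h₂.1 h₄.1, hS h₂.2 h₄.2, hT h₂.1 h₄.1, hT h₂.2 h₄.2⟩
  -- A pair for i splits into its traces on the two forgotten sets.
  refine ⟨fun p => joinScenario ord (G.toggle D) (T.bag i) (σ₁ (p.1 ∩ F₁, p.2 ∩ F₁))
    (σ₂ (p.1 ∩ F₂, p.2 ∩ F₂)), fun p hp => ?_, ?_⟩
  · rw [hF] at hp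
    obtain ⟨k₁, k₂⟩ := mem_disjointPairs.1 hp
    have hp₁ : (p.1 ∩ F₁, p.2 ∩ F₁) ∈ disjointPairs F₁ := mem_disjointPairs.2
      ⟨k₁.mono Finset.inter_subset_left Finset.inter_subset_left,
        Finset.union_subset Finset.inter_subset_right Finset.inter_subset_right⟩
    have hp₂ : (p.1 ∩ F₂, p.2 ∩ F₂) ∈ disjointPairs F₂ := mem_disjointPairs.2
      ⟨k₁.mono Finset.inter_subset_left Finset.inter_subset_left,
        Finset.union_subset Finset.inter_subset_right Finset.inter_subset_right⟩
    have := IsScenarioOf.join hord h hp₁ hp₂ (hσ₁ _ hp₁) (hσ₂ _ hp₂)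
    have h' := Finset.union_subset_iff.1 k₂
    simpa only [← Finset.inter_union_distrib_left, Finset.inter_eq_left.2 h'.1,
      Finset.inter_eq_left.2 h'.2] using this
  · rw [nodeTable, h, hF, sum_disjointPairs_union hd]
    -- The update is bilinear: the sum over scenarios of the first child is collapsed to pairs,
    -- afterwards that of the second.
    have step₁ := sum_apply_sum_pt (sc := scenarios (T.bag i))
      (fun p hp => mem_scenarios.2 (hb₁ ▸ (hσ₁ p hp).1)) (term G x y u v)
      (fun s z => ∑ s₂ ∈ scenarios (T.bag i),
        pt (joinScenario ord (G.toggle D) (T.bag i) s s₂) (z * τ j₂ D s₂))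
      (fun s => by simp [pt_zero])
      (fun s z z' => by simp only [add_mul, pt_add, Finset.sum_add_distrib])
    rw [← e₁] at step₁
    refine step₁.trans (Finset.sum_congr rfl fun p hp => ?_)
    have step₂ := sum_apply_sum_pt (sc := scenarios (T.bag i))
      (fun p hp => mem_scenarios.2 (hb₂ ▸ (hσ₂ p hp).1)) (term G x y u v)
      (fun s z => pt (joinScenario ord (G.toggle D) (T.bag i) (σ₁ p) s) (term G x y u v p * z))
      (fun s => by simp [pt_zero])
      (fun s z z' => by simp only [mul_add, pt_add])
    rw [← e₂] at step₂
    refine step₂.trans (Finset.sum_congr rfl fun q hq => ?_)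
    obtain ⟨r₁, r₂, r₃, r₄⟩ := hr p hp q hq
    simp only [r₁, r₂, r₃, r₄]
    rw [term_union hp hq hd fun a ha b hb =>
      NiceTreeDecomposition.not_adj_of_forgotten_join h ha hb]

theorem IsScenarioOf.introduce {j : I} {a : V} (h : T.kind i = .introduce j a)
    {p : Finset V × Finset V} {s : Scenario V}
    (hp : p ∈ disjointPairs (T.forgotten j)) (hs : IsScenarioOf T j (D.erase a) p s) :
    IsScenarioOf T i D p (introduceScenario (G.toggle D) (T.bag i) a s) := by
  obtain ⟨-, haj, hb⟩ := NiceTreeDecomposition.introduce_spec h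
  have haF := NiceTreeDecomposition.notMem_forgotten_introduce h
  have hp₂ := (mem_disjointPairs.1 hp).2
  have hbF : Disjoint (T.forgotten j) (T.bag i) :=
    NiceTreeDecomposition.forgotten_introduce h ▸ NiceTreeDecomposition.disjoint_forgotten_bag i
  have hna := fun w (hw : w ∈ p.1 ∪ p.2) =>
    NiceTreeDecomposition.not_adj_of_forgotten_introduce h (hp₂ hw)
  have hwa : ∀ w ∈ p.1 ∪ p.2, w ≠ a := fun w hw hwa => haF (hwa ▸ hp₂ hw)
  refine ⟨by rw [hb]; exact hs.1.introduce, ?_⟩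
  -- The child was processed without toggling a, which is immaterial because a belongs neither to W
  -- nor to its bag.
  have hc : Represents (adjOn (G.toggle (p.2 ∪ D)) Finset.univ) (p.1 ∪ p.2) (T.bag j) s := by
    refine hs.2.congr fun b hbW c _ => adjOn_toggle_congr fun _ => ?_
    have hba : b ≠ a := by
      rintro rfl
      rcases Finset.mem_union.1 hbW with hbW | hbW
      · exact hwa b hbW rfl
      · exact haj hbW
    simp [hba]
  have hbU : ∀ b ∈ insert a (T.bag j), ∀ c ∈ insert a (T.bag j),
      adjOn (G.toggle D) (T.bag i) b c = adjOn (G.toggle (p.2 ∪ D)) Finset.univ b c := by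
    rw [← hb]
    intro b hb c hc
    refine (adjOn_apply_univ hb hc).trans (adjOn_toggle_congr fun _ => ?_)
    have : b ∉ p.2 := fun h' =>
      Finset.disjoint_left.1 hbF (hp₂ (Finset.mem_union_right _ h')) hb
    simp [this]
  have key := hc.introduce (a := a) (s' := introduceScenario (G.toggle D) (T.bag i) a s) haj
    (fun w hw => adjOn_toggle_eq_zero (hwa w hw) fun h' => hna w hw (G.symm _ _ h'))
    (fun w hw => adjOn_toggle_eq_zero (hwa w hw).symm (hna w hw))
    (fun c hc => hs.1.1 c hc a haj) rfl
    (fun b hb c hc => by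
      have hba : b ≠ a := fun h' => haj (h' ▸ hb)
      have hca : c ≠ a := fun h' => haj (h' ▸ hc)
      simp [introduceScenario, hba, hca])
    (fun b hb => ⟨by simpa [introduceScenario] using hbU a (by simp) b hb,
      by simpa [introduceScenario] using hbU b hb a (by simp)⟩)
  rwa [← hb] at key

theorem correct_introduce {j : I} {a : V} (h : T.kind i = .introduce j a)
    (hj : Correct T x y u v j (D.erase a) (τ j (D.erase a))) :
    Correct T x y u v i D (nodeTable T ord x y u v τ i D) := by
  obtain ⟨σ, hσ, e⟩ := hj
  have hF := NiceTreeDecomposition.forgotten_introduce h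
  refine ⟨fun p => introduceScenario (G.toggle D) (T.bag i) a (σ p), fun p hp => ?_, ?_⟩
  · rw [hF] at hp
    exact IsScenarioOf.introduce h hp (hσ p hp)
  · rw [nodeTable, h, hF]
    have step := sum_apply_sum_pt (sc := scenarios (T.bag j))
      (fun p hp => mem_scenarios.2 (hσ p hp).1) (term G x y u v)
      (fun s z => pt (introduceScenario (G.toggle D) (T.bag i) a s) z)
      (fun s => pt_zero _) (fun s z z' => pt_add _ _ _)
    rw [← e] at step
    exact step

theorem IsScenarioOf.ignore {j : I} {a : V} (hord : ∀ a, a ∈ ord) (h : T.kind i = .forget j a)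
    {p : Finset V × Finset V} {s : Scenario V} (hs : IsScenarioOf T j D p s) :
    IsScenarioOf T i D p (ignoreScenario ord a s) := by
  obtain ⟨-, hai, hb⟩ := NiceTreeDecomposition.forget_spec h
  have hb' : T.bag i = (T.bag j).erase a := by rw [hb, Finset.erase_insert hai]
  rw [IsScenarioOf, hb']
  exact ⟨hs.1.ignore hord, hs.2.ignore (span_ignoreScenario_fst s) rfl⟩

/-- Covers both uses of a: in A with D' = D, and in B with a moved from D' to q.2. In either case
q.2 ∪ D = p.2 ∪ D', so the toggled graph stays the same while a passes from the bag to W. -/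
theorem IsScenarioOf.forget {j : I} {a : V} (h : T.kind i = .forget j a)
    {p q : Finset V × Finset V} {D' : Finset V} {s : Scenario V} (hD : D ⊆ T.bag i)
    (hD' : D' ⊆ T.bag j) (hp : p ∈ disjointPairs (T.forgotten j)) (hs : IsScenarioOf T j D' p s)
    (hq : q.1 ∪ q.2 = insert a (p.1 ∪ p.2)) (hqD : q.2 ∪ D = p.2 ∪ D') :
    IsScenarioOf T i D q (forgetScenario ord a s).1 ∧
    (G.toggle q.2).rk (q.1 ∪ q.2) =
      (G.toggle p.2).rk (p.1 ∪ p.2) + (forgetScenario ord a s).2 ∧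
    (G.toggle q.2).nullity (q.1 ∪ q.2) + (forgetScenario ord a s).2 =
      (G.toggle p.2).nullity (p.1 ∪ p.2) + 1 := by
  obtain ⟨-, hai, hb⟩ := NiceTreeDecomposition.forget_spec h
  have hb' : T.bag i = (T.bag j).erase a := by rw [hb, Finset.erase_insert hai]
  have haj : a ∈ T.bag j := hb ▸ Finset.mem_insert_self _ _
  have hp₂ := (mem_disjointPairs.1 hp).2
  have hbF := NiceTreeDecomposition.disjoint_forgotten_bag (T := T) j
  have haW : a ∉ p.1 ∪ p.2 := fun h' => Finset.disjoint_left.1 hbF (hp₂ h') haj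
  obtain ⟨k₁, k₂⟩ := hs.2.forget (ord := ord) (isSymm_adjOn _ _) hs.1 haj haW
  obtain ⟨n₁, r₁⟩ := rk_and_nullity (G := G) (B := p.2) (D := D') (W := p.1 ∪ p.2)
    ((hbF.mono_left hp₂).symm.mono_left hD')
  obtain ⟨n₂, r₂⟩ := rk_and_nullity (G := G) (B := q.2) (D := D) (W := q.1 ∪ q.2) (by
    rw [hq, Finset.disjoint_insert_right]
    refine ⟨fun h' => hai (hD h'), (hbF.mono_left hp₂).symm.mono_left (hD.trans ?_)⟩
    rw [hb]
    exact Finset.subset_insert _ _)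
  rw [hqD, hq] at n₂ r₂
  rw [Finset.card_insert_of_notMem haW] at r₂
  rw [IsScenarioOf, hb', hqD, hq]
  exact ⟨⟨hs.1.forget haj, k₁⟩, by omega, by omega⟩

theorem correct_forget {j : I} {a : V} (hord : ∀ a, a ∈ ord) (hv : v ≠ 0)
    (h : T.kind i = .forget j a) (hD : D ⊆ T.bag i)
    (h₁ : Correct T x y u v j D (τ j D))
    (h₂ : Correct T x y u v j (insert a D) (τ j (insert a D))) :
    Correct T x y u v i D (nodeTable T ord x y u v τ i D) := by
  obtain ⟨σ₁, hσ₁, e₁⟩ := h₁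
  obtain ⟨σ₂, hσ₂, e₂⟩ := h₂
  obtain ⟨-, hai, hb⟩ := NiceTreeDecomposition.forget_spec h
  have hF := NiceTreeDecomposition.forgotten_forget h
  have haF := NiceTreeDecomposition.notMem_forgotten_forget h
  have hDj : D ⊆ T.bag j := hD.trans (hb ▸ Finset.subset_insert _ _)
  have haDj : insert a D ⊆ T.bag j := hb ▸ Finset.insert_subset_insert _ hD
  set F' := T.forgotten j with hF'
  have hna : ∀ p ∈ disjointPairs F', a ∉ p.1 ∧ a ∉ p.2 := fun p hp => by
    have := (mem_disjointPairs.1 hp).2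
    exact ⟨fun h => haF (this (Finset.mem_union_left _ h)),
      fun h => haF (this (Finset.mem_union_right _ h))⟩
  have hx : ∀ p ∈ disjointPairs F', IsScenarioOf T i D (insert a p.1, p.2)
      (forgetScenario ord a (σ₁ p)).1 ∧ term G x y u v (insert a p.1, p.2) =
        forgetCoeff (x a) u v (forgetScenario ord a (σ₁ p)).2 * term G x y u v p := by
    intro p hp
    obtain ⟨k₁, k₂, k₃⟩ := IsScenarioOf.forget (ord := ord) (q := (insert a p.1, p.2)) h hD hDj hp
      (hσ₁ p hp) (Finset.insert_union _ _ _) rfl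
    refine ⟨k₁, ?_⟩
    simp only [term, forgetCoeff]
    rw [mul_assoc _ (u ^ _), pow_mul_zpow_eq hv k₂ k₃, Finset.prod_insert (hna p hp).1]
    ring
  have hy : ∀ p ∈ disjointPairs F', IsScenarioOf T i D (p.1, insert a p.2)
      (forgetScenario ord a (σ₂ p)).1 ∧ term G x y u v (p.1, insert a p.2) =
        forgetCoeff (y a) u v (forgetScenario ord a (σ₂ p)).2 * term G x y u v p := by
    intro p hp
    obtain ⟨k₁, k₂, k₃⟩ := IsScenarioOf.forget (ord := ord) (q := (p.1, insert a p.2)) h hD haDj hp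
      (hσ₂ p hp) (Finset.union_insert _ _ _) (by
        rw [Finset.insert_union, Finset.union_insert])
    refine ⟨k₁, ?_⟩
    simp only [term, forgetCoeff]
    rw [mul_assoc _ (u ^ _), pow_mul_zpow_eq hv k₂ k₃, Finset.prod_insert (hna p hp).2]
    ring
  -- The scenario of a pair depends on which of its sets contains a; in the second case it comes
  -- from the child's part in which a is toggled.
  refine ⟨fun p => if a ∈ p.1 then (forgetScenario ord a (σ₁ (p.1.erase a, p.2))).1 else
    if a ∈ p.2 then (forgetScenario ord a (σ₂ (p.1, p.2.erase a))).1 else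
      ignoreScenario ord a (σ₁ p), fun p hp => ?_, ?_⟩
  · rw [hF] at hp
    obtain ⟨k₁, k₂⟩ := mem_disjointPairs.1 hp
    by_cases hp₁ : a ∈ p.1
    · have hp₂ : a ∉ p.2 := Finset.disjoint_left.1 k₁ hp₁
      have hmem : (p.1.erase a, p.2) ∈ disjointPairs F' := by
        refine mem_disjointPairs.2 ⟨k₁.mono_left (Finset.erase_subset _ _), ?_⟩
        have := Finset.erase_subset_erase a k₂
        rwa [Finset.erase_insert haF, Finset.erase_union_distrib,
          Finset.erase_eq_of_notMem hp₂] at this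
      have := (hx _ hmem).1
      simp only [hp₁, if_true]
      simpa only [Finset.insert_erase hp₁] using this
    · by_cases hp₂ : a ∈ p.2
      · have hmem : (p.1, p.2.erase a) ∈ disjointPairs F' := by
          refine mem_disjointPairs.2 ⟨k₁.mono_right (Finset.erase_subset _ _), ?_⟩
          have := Finset.erase_subset_erase a k₂
          rwa [Finset.erase_insert haF, Finset.erase_union_distrib,
            Finset.erase_eq_of_notMem hp₁] at this
        have := (hy _ hmem).1
        simp only [hp₁, hp₂, if_true, if_false]
        simpa only [Finset.insert_erase hp₂] using this
      · have hmem : p ∈ disjointPairs F' := mem_disjointPairs.2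
          ⟨k₁, (Finset.subset_insert_iff_of_notMem (by simp [hp₁, hp₂])).1 k₂⟩
        simp only [hp₁, hp₂, if_false]
        exact (hσ₁ p hmem).ignore hord h
  · rw [nodeTable, h, hF, sum_disjointPairs_insert haF]
    have step₁ := sum_apply_sum_pt (sc := scenarios (T.bag j))
      (fun p hp => mem_scenarios.2 (hσ₁ p hp).1) (term G x y u v)
      (fun s z => pt (ignoreScenario ord a s) z)
      (fun s => pt_zero _) (fun s z z' => pt_add _ _ _)
    have step₂ := sum_apply_sum_pt (sc := scenarios (T.bag j))
      (fun p hp => mem_scenarios.2 (hσ₁ p hp).1) (term G x y u v)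
      (fun s z => pt (forgetScenario ord a s).1
        (forgetCoeff (x a) u v (forgetScenario ord a s).2 * z))
      (fun s => by rw [mul_zero, pt_zero]) (fun s z z' => by rw [mul_add, pt_add])
    have step₃ := sum_apply_sum_pt (sc := scenarios (T.bag j))
      (fun p hp => mem_scenarios.2 (hσ₂ p hp).1) (term G x y u v)
      (fun s z => pt (forgetScenario ord a s).1
        (forgetCoeff (y a) u v (forgetScenario ord a s).2 * z))
      (fun s => by rw [mul_zero, pt_zero]) (fun s z z' => by rw [mul_add, pt_add])
    rw [← e₁] at step₁ step₂
    rw [← e₂] at step₃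
    simp only [Finset.sum_add_distrib]
    rw [step₁, step₂, step₃]
    refine congrArg₂ _ (Finset.sum_congr rfl fun p hp => ?_) (congrArg₂ _
      (Finset.sum_congr rfl fun p hp => ?_) (Finset.sum_congr rfl fun p hp => ?_))
    · simp only [(hna p hp).1, (hna p hp).2, if_false]
    · simp only [Finset.mem_insert_self, if_true, Finset.erase_insert (hna p hp).1, (hx p hp).2]
    · simp only [Finset.mem_insert_self, if_true, (hna p hp).1, if_false,
        Finset.erase_insert (hna p hp).2, (hy p hp).2]

theorem correct_nodeTable (hord : ∀ a, a ∈ ord) (hv : v ≠ 0) (hD : D ⊆ T.bag i)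
    (hch : ∀ j, T.IsChild i j → ∀ D' ⊆ T.bag j, Correct T x y u v j D' (τ j D')) :
    Correct T x y u v i D (nodeTable T ord x y u v τ i D) := by
  cases h : T.kind i with
  | leaf => exact correct_leaf h
  | join j₁ j₂ =>
    obtain ⟨-, hc, hb₁, hb₂⟩ := NiceTreeDecomposition.join_spec h
    exact correct_join hord h (hch j₁ ((hc _).2 (Or.inl rfl)) D (hb₁ ▸ hD))
      (hch j₂ ((hc _).2 (Or.inr rfl)) D (hb₂ ▸ hD))
  | introduce j a =>
    obtain ⟨hc, -, hb⟩ := NiceTreeDecomposition.introduce_spec h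
    refine correct_introduce h (hch j ((hc _).2 rfl) _ ?_)
    rw [hb] at hD
    exact Finset.subset_insert_iff.1 hD
  | forget j a =>
    obtain ⟨hc, -, hb⟩ := NiceTreeDecomposition.forget_spec h
    exact correct_forget hord hv h hD
      (hch j ((hc _).2 rfl) _ (hD.trans (hb ▸ Finset.subset_insert _ _)))
      (hch j ((hc _).2 rfl) _ (hb ▸ Finset.insert_subset_insert _ hD))

end Correct

/-! ### The number of operations. -/

section Count

variable {V I F : Type} [Field F] [Fintype V] [DecidableEq V] {G : LoopGraph V}
  {T : NiceTreeDecomposition G I} {ord : List V} {x y : V → F} {u v : F}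

theorem trivialGuard_forgetGood (t u v : F) : (trivialGuard V F).ForgetGood t u v :=
  ⟨trivial, trivial, fun _ _ => trivial, fun _ _ => trivial⟩

/-- Joins cost 2 per pair of scenarios and forget nodes 13 per scenario; both are bounded by 13
times the square of the number of scenarios. -/
theorem effect_nodeStep {w : ℕ} (hw : ∀ i, (T.bag i).card ≤ w) {i : I} {D : Finset V}
    {m : Machine V I F} (h0 : m.table i D = 0) :
    Effect (fun _ => True) (13 * 2 ^ (3 * w ^ 2 + w)) i D (nodeTable T ord x y u v m.table i D) m
      (exec (nodeStep T ord x y u v i D) m) := by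
  have hcard : ∀ i, (scenarios (T.bag i)).card ^ 2 ≤ 2 ^ (3 * w ^ 2 + w) := fun i =>
    (card_scenarios_sq_le _).trans (Nat.pow_le_pow_right (by norm_num)
      (by have := hw i; gcongr))
  cases h : T.kind i with
  | leaf => exact (effect_leaf h h0).mono (Nat.zero_le _)
  | join j₁ j₂ =>
    refine (effect_join (g := trivialGuard V F) (b := fun _ _ => 0) h h0
      (fun _ _ _ _ => trivial) (fun _ _ _ _ => trivialGuard_accepts _) trivial
      (by simp [trivialGuard])).1.mono ?_
    have := hcard i
    omega
  | introduce j a => exact (effect_introduce h h0).mono (Nat.zero_le _)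
  | forget j a =>
    refine (effect_forget (g := trivialGuard V F) (b₁ := fun _ => 0) (b₂ := fun _ => 0)
      (b₃ := fun _ => 0) h h0 (trivialGuard_forgetGood _ _ _) (trivialGuard_forgetGood _ _ _)
      (fun _ _ _ _ => trivial) (fun _ _ _ _ => trivial) (fun _ _ => trivialGuard_accepts _)
      (fun _ _ _ _ => trivialGuard_accepts _) (fun _ _ _ _ => trivialGuard_accepts _) trivial
      (by simp [trivialGuard])).1.mono ?_
    have := hcard j
    have := Nat.le_self_pow two_ne_zero (scenarios (T.bag j)).card
    omega

theorem output_and_length [Fintype I] [DecidableEq I] {w : ℕ} {t : List I} (ht : T.IsBottomUp t)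
    (hw : ∀ i, (T.bag i).card ≤ w) (hv : v ≠ 0) :
    output T t x y u v = MvPolynomial.aeval (evalPoint x y u v) (interlacePolynomial G) ∧
    (operations T t x y u v).length ≤ Fintype.card I * (2 ^ w * (13 * 2 ^ (3 * w ^ 2 + w))) := by
  obtain ⟨⟨f, hf, ho⟩, hlen, -⟩ := algorithm_spec (x := x) (y := y) (u := u) (v := v)
    (Spec := Correct T x y u v) (good := fun _ => True) ht
    (fun i => Nat.pow_le_pow_right (by norm_num) (hw i))
    fun i D m hD h0 hch => ⟨_, correct_nodeTable
      (NiceTreeDecomposition.mem_vertexOrder ht) hv hD hch, effect_nodeStep hw h0⟩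
  exact ⟨by rw [ho, hf.root], hlen⟩

theorem count_bound {c k n N : ℕ} (hN : N ≤ c * n) :
    N * (2 ^ (k + 1) * (13 * 2 ^ (3 * (k + 1) ^ 2 + (k + 1)))) ≤
      2 ^ (3 * k ^ 2 + (9 + c) * (k + 1)) * n := by
  have hc : c ≤ 2 ^ c := Nat.lt_two_pow_self.le
  calc N * (2 ^ (k + 1) * (13 * 2 ^ (3 * (k + 1) ^ 2 + (k + 1))))
      ≤ (2 ^ c * n) * (2 ^ (k + 1) * (2 ^ 4 * 2 ^ (3 * (k + 1) ^ 2 + (k + 1)))) := by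
        gcongr
        · exact hN.trans (Nat.mul_le_mul_right _ hc)
        · norm_num
    _ = 2 ^ (c + ((k + 1) + (4 + (3 * (k + 1) ^ 2 + (k + 1))))) * n := by
        rw [pow_add, pow_add, pow_add]; ring
    _ ≤ 2 ^ (3 * k ^ 2 + (9 + c) * (k + 1)) * n := by
        refine Nat.mul_le_mul_right _ (Nat.pow_le_pow_right (by norm_num) ?_)
        -- The exponent on the left is 3k^2 + 8k + 9 + c.
        nlinarith

end Count

/-! ### Bit lengths from denominators. -/

section Bits

/-- `Q` is a denominator of `z`, and `|Q * z| ≤ E`. -/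
def HasDenom (Q : ℕ) (E z : ℚ) : Prop := (∃ n : ℤ, (Q : ℚ) * z = n) ∧ |(Q : ℚ) * z| ≤ E

theorem HasDenom.mul {Q Q' : ℕ} {E E' z z' : ℚ} (h : HasDenom Q E z) (h' : HasDenom Q' E' z') :
    HasDenom (Q * Q') (E * E') (z * z') := by
  obtain ⟨⟨n, hn⟩, hE⟩ := h
  obtain ⟨⟨n', hn'⟩, hE'⟩ := h'
  have e : ((Q * Q' : ℕ) : ℚ) * (z * z') = (Q * z) * (Q' * z') := by push_cast; ring
  refine ⟨⟨n * n', by rw [e, hn, hn']; push_cast; ring⟩, ?_⟩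
  rw [e, abs_mul]
  exact mul_le_mul hE hE' (abs_nonneg _) ((abs_nonneg _).trans hE)

theorem HasDenom.mono {Q : ℕ} {E E' z : ℚ} (h : HasDenom Q E z) (hE : E ≤ E') :
    HasDenom Q E' z := ⟨h.1, h.2.trans hE⟩

theorem hasDenom_one {Q : ℕ} {E : ℚ} (h : (Q : ℚ) ≤ E) : HasDenom Q E 1 :=
  ⟨⟨Q, by simp⟩, by simpa using h⟩

theorem HasDenom.bitLength_le {Q e : ℕ} {z : ℚ} (hQ : 0 < Q) (hQe : Q ≤ 2 ^ e)
    (h : HasDenom Q (2 ^ e) z) : bitLength z ≤ 2 * (e + 1) := by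
  obtain ⟨⟨n, hn⟩, hE⟩ := h
  rw [hn] at hE
  have hQ' : (Q : ℚ) ≠ 0 := by exact_mod_cast hQ.ne'
  have hz : z = (n : ℚ) / ((Q : ℤ) : ℚ) := by
    rw [← hn]; push_cast; field_simp
  have hnE : n.natAbs ≤ 2 ^ e := by
    have : |n| ≤ 2 ^ e := by exact_mod_cast hE
    zify
    exact this
  have hpow : 2 ^ e < 2 ^ (e + 1) := Nat.pow_lt_pow_right (by norm_num) (by omega)
  -- Reduction to lowest terms can only shrink the fraction n / Q: its numerator divides n and its
  -- denominator divides Q.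
  have hden : z.den ≤ Q := by
    refine Nat.le_of_dvd hQ ?_
    have := Rat.den_dvd n (Q : ℤ)
    rw [Rat.divInt_eq_div, ← hz] at this
    exact_mod_cast this
  have hnum : z.num.natAbs ≤ 2 ^ e := by
    have hdvd : z.num ∣ n := by
      have := Rat.num_dvd n (b := (Q : ℤ)) (by exact_mod_cast hQ.ne')
      rwa [Rat.divInt_eq_div, ← hz] at this
    by_cases hn0 : n = 0
    · rw [hz, hn0]; simp
    · exact (Nat.le_of_dvd (Int.natAbs_pos.2 hn0) (Int.natAbs_dvd_natAbs.2 hdvd)).trans hnE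
  rw [bitLength, two_mul]
  exact add_le_add (Nat.size_le.2 (hnum.trans_lt hpow))
    (Nat.size_le.2 ((hden.trans hQe).trans_lt hpow))

variable {l : ℕ} {z : ℚ}

theorem den_le_of_bitLength_le (h : bitLength z ≤ l) : z.den ≤ 2 ^ l :=
  (Nat.size_le.1 ((Nat.le_add_left _ _).trans h)).le

theorem num_le_of_bitLength_le (h : bitLength z ≤ l) : z.num.natAbs ≤ 2 ^ l :=
  (Nat.size_le.1 ((Nat.le_add_right _ _).trans h)).le

theorem one_le_of_bitLength_le (h : bitLength z ≤ l) : 1 ≤ l := by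
  have : 0 < Nat.size z.den := Nat.size_pos.2 z.den_pos
  rw [bitLength] at h
  omega

theorem hasDenom_den (h : bitLength z ≤ l) : HasDenom z.den (2 ^ l) z := by
  have e : (z.den : ℚ) * z = z.num := by rw [mul_comm]; exact Rat.mul_den_eq_num z
  refine ⟨⟨z.num, e⟩, ?_⟩
  rw [e, ← Int.cast_abs, Int.abs_eq_natAbs]
  exact_mod_cast num_le_of_bitLength_le h

theorem hasDenom_den_one (h : bitLength z ≤ l) : HasDenom z.den (2 ^ l) 1 :=
  hasDenom_one (by exact_mod_cast den_le_of_bitLength_le h)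

theorem hasDenom_num_one (h : bitLength z ≤ l) : HasDenom z.num.natAbs (2 ^ l) 1 :=
  hasDenom_one (by exact_mod_cast num_le_of_bitLength_le h)

theorem hasDenom_num_inv (h : bitLength z ≤ l) (hz : z ≠ 0) :
    HasDenom z.num.natAbs (2 ^ l) z⁻¹ := by
  have hnum : (z.num : ℚ) ≠ 0 := by exact_mod_cast Rat.num_ne_zero.2 hz
  have e : z⁻¹ = z.den / z.num := by
    conv_lhs => rw [← Rat.num_div_den z, inv_div]
  have hden : |(z.den : ℚ)| ≤ 2 ^ l := by
    rw [Nat.abs_cast]; exact_mod_cast den_le_of_bitLength_le h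
  have habs : ((z.num.natAbs : ℕ) : ℚ) = |(z.num : ℚ)| := by
    rw [← Int.cast_abs, Int.abs_eq_natAbs]; simp
  rw [HasDenom, e, habs]
  rcases abs_choice (z.num : ℚ) with h' | h' <;> rw [h']
  · rw [mul_div_cancel₀ _ hnum]
    exact ⟨⟨z.den, by simp⟩, hden⟩
  · rw [neg_mul, mul_div_cancel₀ _ hnum]
    exact ⟨⟨-z.den, by simp⟩, by rwa [abs_neg]⟩

/-- A number that has a denominator and a numerator of at most `e` digits. -/
def Small (e : ℕ) (z : ℚ) : Prop := ∃ Q : ℕ, 0 < Q ∧ Q ≤ 2 ^ e ∧ HasDenom Q (2 ^ e) z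

theorem Small.mul {e e' : ℕ} {z z' : ℚ} (h : Small e z) (h' : Small e' z') :
    Small (e + e') (z * z') := by
  obtain ⟨Q, hQ, hQe, hz⟩ := h
  obtain ⟨Q', hQ', hQe', hz'⟩ := h'
  refine ⟨Q * Q', Nat.mul_pos hQ hQ', ?_, ?_⟩
  · rw [pow_add]; exact Nat.mul_le_mul hQe hQe'
  · rw [pow_add]; exact hz.mul hz'

theorem Small.mono {e e' : ℕ} {z : ℚ} (h : Small e z) (he : e ≤ e') : Small e' z := by
  obtain ⟨Q, hQ, hQe, hz⟩ := h
  exact ⟨Q, hQ, hQe.trans (Nat.pow_le_pow_right (by norm_num) he),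
    hz.mono (pow_le_pow_right₀ (by norm_num) he)⟩

theorem Small.bitLength_le {e : ℕ} {z : ℚ} (h : Small e z) : bitLength z ≤ 2 * (e + 1) := by
  obtain ⟨Q, hQ, hQe, hz⟩ := h
  exact hz.bitLength_le hQ hQe

theorem small_one : Small 0 1 := ⟨1, one_pos, by simp, hasDenom_one (by simp)⟩

theorem small_of_bitLength_le (h : bitLength z ≤ l) : Small l z :=
  ⟨z.den, z.den_pos, den_le_of_bitLength_le h, hasDenom_den h⟩

theorem small_inv (h : bitLength z ≤ l) (hz : z ≠ 0) : Small l z⁻¹ :=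
  ⟨z.num.natAbs, Int.natAbs_pos.2 (Rat.num_ne_zero.2 hz), num_le_of_bitLength_le h,
    hasDenom_num_inv h hz⟩

theorem small_pow (h : bitLength z ≤ l) {r : ℕ} (hr : r ≤ 2) : Small (2 * l) (z ^ r) := by
  interval_cases r
  · rw [pow_zero]; exact small_one.mono (Nat.zero_le _)
  · rw [pow_one]; exact (small_of_bitLength_le h).mono (by omega)
  · rw [pow_two, two_mul]; exact (small_of_bitLength_le h).mul (small_of_bitLength_le h)

theorem small_zpow (h : bitLength z ≤ l) (hz : z ≠ 0) {r : ℕ} (hr : r ≤ 2) :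
    Small (2 * l) (z ^ (1 - (r : ℤ))) := by
  interval_cases r
  · norm_num
    exact (small_of_bitLength_le h).mono (by omega)
  · norm_num
    exact small_one.mono (Nat.zero_le _)
  · norm_num
    exact (small_inv h hz).mono (by omega)

/-- One denominator has to serve all exponents r; smaller powers are padded with factors 1 written
as a denominator over itself. -/
theorem hasDenom_pow (h : bitLength z ≤ l) {r : ℕ} (hr : r ≤ 2) :
    HasDenom (z.den * z.den) (2 ^ l * 2 ^ l) (z ^ r) := by
  interval_cases r
  · simpa using (hasDenom_den_one h).mul (hasDenom_den_one h)
  · simpa using (hasDenom_den h).mul (hasDenom_den_one h)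
  · rw [pow_two]; exact (hasDenom_den h).mul (hasDenom_den h)

/-- The exponent 1 needs the denominator of z, the exponent -1 its numerator, so the product of both
serves all three cases. -/
theorem hasDenom_zpow (h : bitLength z ≤ l) (hz : z ≠ 0) {r : ℕ} (hr : r ≤ 2) :
    HasDenom (z.num.natAbs * z.den) (2 ^ l * 2 ^ l) (z ^ (1 - (r : ℤ))) := by
  interval_cases r
  · simpa using (hasDenom_num_one h).mul (hasDenom_den h)
  · simpa using (hasDenom_num_one h).mul (hasDenom_den_one h)
  · have := (hasDenom_num_inv h hz).mul (hasDenom_den_one h)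
    norm_num at this ⊢
    exact this

end Bits

/-! ### The size budget: the sum of numerators over a common denominator. -/

section BitGuard

variable {V : Type}

/-- The guard for computations with common denominator `Q`: all numbers have bit length at most
`M`, and the size of a table `f` is the sum of the numerators `|Q * f s|`. -/
def bitGuard (V : Type) (Q e M : ℕ) : Guard V ℚ where
  good step := ∀ q ∈ step.result :: step.inputs, bitLength q ≤ M
  within f b := (∀ s, ∃ n : ℤ, (Q : ℚ) * f s = n) ∧
    ∀ S : Finset (Scenario V), ∑ s ∈ S, |(Q : ℚ) * f s| ≤ b
  limit := 2 ^ e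

variable {Q e M : ℕ} {f : Scenario V → ℚ} {b b' : ℚ}

theorem bitGuard_within_mono (h : (bitGuard V Q e M).within f b) (hb : b ≤ b') :
    (bitGuard V Q e M).within f b' := ⟨h.1, fun S => (h.2 S).trans hb⟩

theorem bitGuard_within_zero : (bitGuard V Q e M).within 0 0 :=
  ⟨fun _ => ⟨0, by simp⟩, fun S => by simp⟩

theorem bitGuard_within_hasDenom_abs (h : (bitGuard V Q e M).within f b) (s : Scenario V) :
    HasDenom Q |(Q : ℚ) * f s| (f s) := ⟨h.1 s, le_rfl⟩

theorem bitGuard_within_hasDenom (h : (bitGuard V Q e M).within f b) (s : Scenario V) :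
    HasDenom Q b (f s) := ⟨h.1 s, by simpa using h.2 {s}⟩

theorem bitGuard_within_add_pt {z : ℚ} (h : (bitGuard V Q e M).within f b)
    (hz : HasDenom Q b' z) (s : Scenario V) :
    (bitGuard V Q e M).within (f + pt s z) (b + b') := by
  classical
  obtain ⟨n', hn'⟩ := hz.1
  refine ⟨fun s' => ?_, fun S => ?_⟩
  · obtain ⟨n, hn⟩ := h.1 s'
    by_cases hs : s' = s
    · subst hs
      exact ⟨n + n', by rw [Pi.add_apply, pt_self, mul_add, hn, hn', Int.cast_add]⟩
    · exact ⟨n, by rw [Pi.add_apply, pt_of_ne hs, add_zero, hn]⟩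
  · have hpt : ∑ s' ∈ S, |(Q : ℚ) * pt s z s'| ≤ b' := by
      by_cases hs : s ∈ S
      · rw [Finset.sum_eq_single_of_mem s hs fun s' _ h => by rw [pt_of_ne h]; simp, pt_self]
        exact hz.2
      · rw [Finset.sum_eq_zero fun s' h => by
          rw [pt_of_ne (by rintro rfl; exact hs h)]; simp]
        exact (abs_nonneg _).trans hz.2
    calc ∑ s' ∈ S, |(Q : ℚ) * (f + pt s z) s'|
        ≤ ∑ s' ∈ S, (|(Q : ℚ) * f s'| + |(Q : ℚ) * pt s z s'|) :=
          Finset.sum_le_sum fun s' _ => by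
            rw [Pi.add_apply, mul_add]; exact abs_add_le _ _
      _ ≤ b + b' := by
          rw [Finset.sum_add_distrib]; exact add_le_add (h.2 S) hpt

theorem bitGuard_within_sum_pt {A : Type} {P : Finset A} {σ : A → Scenario V} {z : A → ℚ}
    {β : A → ℚ} (h : ∀ a ∈ P, HasDenom Q (β a) (z a)) :
    (bitGuard V Q e M).within (∑ a ∈ P, pt (σ a) (z a)) (∑ a ∈ P, β a) := by
  classical
  induction P using Finset.induction_on with
  | empty => simpa using bitGuard_within_zero
  | insert a P ha ih =>
    rw [Finset.sum_insert ha, Finset.sum_insert ha, add_comm, add_comm (β a)]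
    exact bitGuard_within_add_pt (ih fun a' h' => h a' (Finset.mem_insert_of_mem h'))
      (h a (Finset.mem_insert_self _ _)) _

/-- While the sum of all numerators stays within the limit, so does each entry, each summand and
each intermediate sum. -/
theorem bitGuard_accepts {z : ℚ} (hQ : 0 < Q) (hQe : Q ≤ 2 ^ e) (hM : 2 * (e + 1) ≤ M)
    (hz : HasDenom Q b z) : (bitGuard V Q e M).Accepts z b := by
  have hb : 0 ≤ b := (abs_nonneg _).trans hz.2
  refine ⟨hb, fun s T b₀ hT hl => ?_⟩
  have hw := bitGuard_within_add_pt hT hz s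
  have hb₀ : 0 ≤ b₀ := by simpa using hT.2 ∅
  have hl' : b₀ + b ≤ 2 ^ e := hl
  have bit : ∀ {q : ℚ} {β : ℚ}, HasDenom Q β q → β ≤ 2 ^ e → bitLength q ≤ M :=
    fun h h' => ((h.mono h').bitLength_le hQ hQe).trans hM
  have hsum := bitGuard_within_hasDenom hw s
  rw [Pi.add_apply, pt_self] at hsum
  refine ⟨fun q hq => ?_, hw⟩
  simp only [List.mem_cons, List.not_mem_nil, or_false] at hq
  rcases hq with rfl | rfl | rfl
  · exact bit hsum hl'
  · exact bit (bitGuard_within_hasDenom hT s) (by linarith)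
  · exact bit hz (by linarith)

end BitGuard

/-! ### The bound on the bit length. -/

section BitLength

variable {V I : Type} {x y : V → ℚ} {u v : ℚ} {l M : ℕ}

/-- The point `(x, y, u, v)` with `v ≠ 0` has coordinates of bit length at most `l`. -/
structure ShortPoint (x y : V → ℚ) (u v : ℚ) (l : ℕ) : Prop where
  ne_zero : v ≠ 0
  u_le : bitLength u ≤ l
  v_le : bitLength v ≤ l
  x_le : ∀ a, bitLength (x a) ≤ l
  y_le : ∀ a, bitLength (y a) ≤ l

/-- A common denominator of the factors for forgetting the vertex `a`. -/
def forgetDenom (x y : V → ℚ) (u v : ℚ) (a : V) : ℕ :=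
  (x a).den * (y a).den * (u.den * u.den) * (v.num.natAbs * v.den)

namespace ShortPoint

variable (h : ShortPoint x y u v l) (a : V)

include h

theorem forgetDenom_pos : 0 < forgetDenom x y u v a := by
  have := Int.natAbs_pos.2 (Rat.num_ne_zero.2 h.ne_zero)
  have := (x a).den_pos
  have := (y a).den_pos
  have := u.den_pos
  have := v.den_pos
  unfold forgetDenom
  positivity

theorem hasDenom_forgetCoeff {t : ℚ}
    (ht : HasDenom ((x a).den * (y a).den) (2 ^ l * 2 ^ l) t) {r : ℕ} (hr : r ≤ 2) :
    HasDenom (forgetDenom x y u v a) (2 ^ (6 * l)) (forgetCoeff t u v r) := by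
  have := (ht.mul (hasDenom_pow h.u_le hr)).mul (hasDenom_zpow h.v_le h.ne_zero hr)
  refine this.mono (le_of_eq ?_)
  ring

theorem hasDenom_x {r : ℕ} (hr : r ≤ 2) :
    HasDenom (forgetDenom x y u v a) (2 ^ (6 * l)) (forgetCoeff (x a) u v r) :=
  h.hasDenom_forgetCoeff a
    (by simpa using (hasDenom_den (h.x_le a)).mul (hasDenom_den_one (h.y_le a))) hr

theorem hasDenom_y {r : ℕ} (hr : r ≤ 2) :
    HasDenom (forgetDenom x y u v a) (2 ^ (6 * l)) (forgetCoeff (y a) u v r) :=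
  h.hasDenom_forgetCoeff a
    (by simpa using (hasDenom_den_one (h.x_le a)).mul (hasDenom_den (h.y_le a))) hr

theorem forgetDenom_le : forgetDenom x y u v a ≤ 2 ^ (6 * l) := by
  have hx := den_le_of_bitLength_le (h.x_le a)
  have hy := den_le_of_bitLength_le (h.y_le a)
  have hu := den_le_of_bitLength_le h.u_le
  have hv := den_le_of_bitLength_le h.v_le
  have hv' := num_le_of_bitLength_le h.v_le
  calc forgetDenom x y u v a
      ≤ 2 ^ l * 2 ^ l * (2 ^ l * 2 ^ l) * (2 ^ l * 2 ^ l) := by unfold forgetDenom; gcongr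
    _ = 2 ^ (6 * l) := by ring

theorem hasDenom_one : HasDenom (forgetDenom x y u v a) (2 ^ (6 * l)) 1 :=
  Interlace.hasDenom_one (by exact_mod_cast h.forgetDenom_le a)

theorem prod_pos (S : Finset V) : 0 < ∏ a ∈ S, forgetDenom x y u v a :=
  Finset.prod_pos fun a _ => h.forgetDenom_pos a

/-- Six l per vertex would suffice here; the exponent 8 * l matches the limit of the guard, where
the spare factor 2^(2l) pays for the additions at a forget node. -/
theorem prod_le (S : Finset V) :
    ∏ a ∈ S, forgetDenom x y u v a ≤ 2 ^ (8 * l * S.card) := by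
  rw [pow_mul]
  exact Finset.prod_le_pow_card _ _ _ fun a _ =>
    (h.forgetDenom_le a).trans (Nat.pow_le_pow_right (by norm_num) (by omega))

theorem one_le : 1 ≤ l := one_le_of_bitLength_le h.u_le

theorem forgetGood {Q e : ℕ} {t : ℚ} (ht : bitLength t ≤ l) (hM : 18 * l ≤ M) :
    (bitGuard V Q e M).ForgetGood t u v := by
  have hl := h.one_le
  -- Since l ≥ 1, the bound 2(5l + 1) is at most 12l.
  have bit : ∀ {z : ℚ} {e : ℕ}, Small e z → e ≤ 5 * l → bitLength z ≤ M := fun hz he =>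
    hz.bitLength_le.trans (by omega)
  have hu := small_of_bitLength_le h.u_le
  have hsv := small_of_bitLength_le h.v_le
  have hst := small_of_bitLength_le ht
  refine ⟨?_, ?_, fun r hr => ?_, fun r hr => ?_⟩ <;> intro q hq <;>
    simp only [List.mem_cons, List.not_mem_nil, or_false] at hq
  · rcases hq with rfl | rfl | rfl
    · exact bit (hu.mul hu) (by omega)
    · exact bit hu (by omega)
    · exact bit hu (by omega)
  · rcases hq with rfl | rfl
    · exact bit (small_inv h.v_le h.ne_zero) (by omega)
    · exact bit hsv (by omega)
  · have hp := small_pow h.u_le hr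
    rcases hq with rfl | rfl | rfl
    · exact bit (hst.mul hp) (by omega)
    · exact bit hst (by omega)
    · exact bit hp (by omega)
  · have hp := small_pow h.u_le hr
    have hz := small_zpow h.v_le h.ne_zero hr
    rcases hq with rfl | rfl | rfl
    · exact bit ((hst.mul hp).mul hz) (by omega)
    · exact bit (hst.mul hp) (by omega)
    · exact bit hz (by omega)

end ShortPoint

variable [Fintype V] [DecidableEq V] {G : LoopGraph V} (T : NiceTreeDecomposition G I)
  {ord : List V}

/-- The guard for the node `i`. -/
noncomputable def nodeGuard (x y : V → ℚ) (u v : ℚ) (l M : ℕ) (i : I) : Guard V ℚ :=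
  bitGuard V (∏ a ∈ T.forgotten i, forgetDenom x y u v a) (8 * l * (T.forgotten i).card) M

variable {T} {i : I} {D : Finset V} {m : Machine V I ℚ}

theorem ShortPoint.nodeGuard_accepts (h : ShortPoint x y u v l)
    (hM : 16 * l * Fintype.card V + 2 * l ≤ M) {z b : ℚ}
    (hz : HasDenom (∏ a ∈ T.forgotten i, forgetDenom x y u v a) b z) :
    (nodeGuard T x y u v l M i).Accepts z b := by
  refine bitGuard_accepts (h.prod_pos _) (h.prod_le _) (le_trans ?_ hM) hz
  have := Nat.mul_le_mul_left (16 * l) (Finset.card_le_univ (T.forgotten i))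
  have := h.one_le
  linarith

theorem ShortPoint.bitLength_le (h : ShortPoint x y u v l)
    (hM : 16 * l * Fintype.card V + 2 * l ≤ M) (S : Finset V) {z : ℚ}
    (hz : HasDenom (∏ a ∈ S, forgetDenom x y u v a) (2 ^ (8 * l * S.card)) z) :
    bitLength z ≤ M := by
  refine (hz.bitLength_le (h.prod_pos _) (h.prod_le _)).trans (le_trans ?_ hM)
  have := Nat.mul_le_mul_left (16 * l) (Finset.card_le_univ S)
  have := h.one_le
  linarith

/-- Propagates the budget from the children to i. A leaf has size 1, an introduce node keeps the
size, a join multiplies the sizes, and a forget node adds three contributions, each at most 2^(6l)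
times the limit of the child. -/
theorem ShortPoint.effect_nodeStep (h : ShortPoint x y u v l)
    (hM : 16 * l * Fintype.card V + 2 * l ≤ M) (h0 : m.table i D = 0)
    (hD : D ⊆ T.bag i)
    (hch : ∀ j, T.IsChild i j → ∀ D' ⊆ T.bag j, (nodeGuard T x y u v l M j).within
      (m.table j D') (nodeGuard T x y u v l M j).limit) :
    (nodeGuard T x y u v l M i).within (nodeTable T ord x y u v m.table i D)
      (nodeGuard T x y u v l M i).limit ∧
    ∃ N, Effect (nodeGuard T x y u v l M i).good N i D (nodeTable T ord x y u v m.table i D) m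
      (exec (nodeStep T ord x y u v i D) m) := by
  have hl := h.one_le
  cases hk : T.kind i with
  | leaf =>
    refine ⟨?_, 0, effect_leaf hk h0⟩
    obtain ⟨-, hF⟩ := NiceTreeDecomposition.forgotten_leaf hk
    rw [nodeTable, hk, nodeGuard, hF]
    have := bitGuard_within_sum_pt (Q := 1) (e := 0) (M := M) (P := {()})
      (σ := fun _ => (emptyScenario : Scenario V)) (z := fun _ => 1) (β := fun _ => 1)
      fun _ _ => Interlace.hasDenom_one (by norm_num)
    simpa [bitGuard] using this
  | introduce j a =>
    refine ⟨?_, 0, effect_introduce hk h0⟩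
    obtain ⟨hc, haj, hb⟩ := NiceTreeDecomposition.introduce_spec hk
    have hj := hch j ((hc j).2 rfl) (D.erase a) fun b hb' => by
      have hbi := hD (Finset.mem_of_mem_erase hb')
      rw [hb] at hbi
      exact Finset.mem_of_mem_insert_of_ne hbi (Finset.ne_of_mem_erase hb')
    have hF := NiceTreeDecomposition.forgotten_introduce hk
    rw [nodeTable, hk]
    rw [nodeGuard, ← hF] at hj
    exact bitGuard_within_mono (bitGuard_within_sum_pt fun s _ =>
      bitGuard_within_hasDenom_abs hj s) (hj.2 _)
  | join j₁ j₂ =>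
    obtain ⟨-, hc, hb₁, hb₂⟩ := NiceTreeDecomposition.join_spec hk
    have h₁ := hch j₁ ((hc j₁).2 (Or.inl rfl)) D (hb₁ ▸ hD)
    have h₂ := hch j₂ ((hc j₂).2 (Or.inr rfl)) D (hb₂ ▸ hD)
    have hF := NiceTreeDecomposition.forgotten_join hk
    have hd := NiceTreeDecomposition.disjoint_forgotten_join hk
    have hQ := Finset.prod_union (f := forgetDenom x y u v) hd
    have hz : ∀ s₁ s₂, HasDenom (∏ a ∈ T.forgotten i, forgetDenom x y u v a) _
        (m.table j₁ D s₁ * m.table j₂ D s₂) := fun s₁ s₂ => by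
      rw [hF, hQ]
      exact (bitGuard_within_hasDenom_abs h₁ s₁).mul (bitGuard_within_hasDenom_abs h₂ s₂)
    have hlim : (2 : ℚ) ^ (8 * l * (T.forgotten i).card) =
        2 ^ (8 * l * (T.forgotten j₁).card) * 2 ^ (8 * l * (T.forgotten j₂).card) := by
      rw [← pow_add, hF, Finset.card_union_of_disjoint hd, mul_add]
    have hb : ∑ s₁ ∈ scenarios (T.bag i), ∑ s₂ ∈ scenarios (T.bag i),
        |((∏ a ∈ T.forgotten j₁, forgetDenom x y u v a : ℕ) : ℚ) * m.table j₁ D s₁| *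
        |((∏ a ∈ T.forgotten j₂, forgetDenom x y u v a : ℕ) : ℚ) * m.table j₂ D s₂| ≤
        (nodeGuard T x y u v l M i).limit := by
      -- The double sum factors, so the number of scenarios does not enter.
      rw [← Finset.sum_mul_sum]
      refine (mul_le_mul (h₁.2 _) (h₂.2 _) (Finset.sum_nonneg fun _ _ => abs_nonneg _)
        ?_).trans hlim.ge
      exact pow_nonneg (by norm_num) _
    obtain ⟨e₁, e₂⟩ := effect_join (g := nodeGuard T x y u v l M i) (T := T) (ord := ord)
      (x := x) (y := y) (u := u) (v := v) hk h0
      (fun s₁ _ s₂ _ q hq => by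
        simp only [List.mem_cons, List.not_mem_nil, or_false] at hq
        rcases hq with rfl | rfl | rfl
        · refine h.bitLength_le hM (T.forgotten i) ?_
          rw [hlim, hF, hQ]
          exact (bitGuard_within_hasDenom h₁ s₁).mul (bitGuard_within_hasDenom h₂ s₂)
        · exact h.bitLength_le hM _ (bitGuard_within_hasDenom h₁ s₁)
        · exact h.bitLength_le hM _ (bitGuard_within_hasDenom h₂ s₂))
      (fun s₁ _ s₂ _ => h.nodeGuard_accepts hM (hz s₁ s₂)) bitGuard_within_zero hb
    exact ⟨bitGuard_within_mono e₂ hb, _, e₁⟩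
  | forget j a =>
    obtain ⟨hc, -, hb⟩ := NiceTreeDecomposition.forget_spec hk
    have hj := hch j ((hc j).2 rfl)
    have hjD := hj D (hD.trans (hb ▸ Finset.subset_insert _ _))
    have hjD' := hj (insert a D) (hb ▸ Finset.insert_subset_insert _ hD)
    have hF := NiceTreeDecomposition.forgotten_forget hk
    have ha := NiceTreeDecomposition.notMem_forgotten_forget hk
    have hQ := Finset.prod_insert (f := forgetDenom x y u v) ha
    -- The factor 4 covers the three contributions, and 4 ≤ 2^(2l) because l ≥ 1.
    have hpow : (2 : ℚ) ^ (6 * l) * 4 ≤ 2 ^ (8 * l) := by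
      rw [show (4 : ℚ) = 2 ^ 2 by norm_num, ← pow_add]
      exact pow_le_pow_right₀ (by norm_num) (by omega)
    have hlim : (2 : ℚ) ^ (8 * l * (T.forgotten i).card) =
        2 ^ (8 * l) * 2 ^ (8 * l * (T.forgotten j).card) := by
      rw [← pow_add, hF, Finset.card_insert_of_notMem ha]; ring
    have hz : ∀ {t z b : ℚ}, HasDenom (forgetDenom x y u v a) (2 ^ (6 * l)) t →
        HasDenom (∏ a ∈ T.forgotten j, forgetDenom x y u v a) b z →
        HasDenom (∏ a ∈ T.forgotten i, forgetDenom x y u v a) (2 ^ (6 * l) * b) (t * z) :=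
      fun ht hz => by rw [hF, hQ]; exact ht.mul hz
    have hE : (0 : ℚ) < 2 ^ (8 * l * (T.forgotten j).card) := by positivity
    have hmul : ∀ {t z : ℚ}, HasDenom (forgetDenom x y u v a) (2 ^ (6 * l)) t →
        HasDenom (∏ a ∈ T.forgotten j, forgetDenom x y u v a)
          (2 ^ (8 * l * (T.forgotten j).card)) z →
        (nodeGuard T x y u v l M i).good ⟨[t, z], t * z⟩ := fun ht hz' q hq => by
      simp only [List.mem_cons, List.not_mem_nil, or_false] at hq
      have hpow' : (2 : ℚ) ^ (6 * l) ≤ 2 ^ (8 * l) :=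
        pow_le_pow_right₀ (by norm_num) (by omega)
      rcases hq with rfl | rfl | rfl
      · exact h.bitLength_le hM (T.forgotten i) ((hz ht hz').mono (by
          rw [hlim]; exact mul_le_mul_of_nonneg_right hpow' hE.le))
      · exact h.bitLength_le hM {a} (by simpa using ht.mono hpow')
      · exact h.bitLength_le hM _ hz'
    have hbsum : ∑ s ∈ scenarios (T.bag j),
        (2 ^ (6 * l) * |((∏ a ∈ T.forgotten j, forgetDenom x y u v a : ℕ) : ℚ)
            * m.table j D s| +
          (2 ^ (6 * l) * |((∏ a ∈ T.forgotten j, forgetDenom x y u v a : ℕ) : ℚ)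
            * m.table j D s| +
          2 ^ (6 * l) * |((∏ a ∈ T.forgotten j, forgetDenom x y u v a : ℕ) : ℚ)
            * m.table j (insert a D) s|)) ≤ (nodeGuard T x y u v l M i).limit := by
      simp only [Finset.sum_add_distrib, ← Finset.mul_sum]
      refine le_trans ?_ hlim.ge
      have k₁ : _ ≤ (2 : ℚ) ^ (8 * l * (T.forgotten j).card) := hjD.2 (scenarios (T.bag j))
      have k₂ : _ ≤ (2 : ℚ) ^ (8 * l * (T.forgotten j).card) := hjD'.2 (scenarios (T.bag j))
      have h6 : (0 : ℚ) ≤ 2 ^ (6 * l) := by positivity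
      have k₁' := mul_le_mul_of_nonneg_left k₁ h6
      have k₂' := mul_le_mul_of_nonneg_left k₂ h6
      have k₃ := mul_le_mul_of_nonneg_right hpow hE.le
      have k₄ := mul_nonneg h6 hE.le
      linarith
    have h18 : 18 * l ≤ M := by
      have := Nat.mul_le_mul_left (16 * l) (Fintype.card_pos_iff.2 ⟨a⟩)
      linarith
    obtain ⟨e₁, e₂⟩ := effect_forget (g := nodeGuard T x y u v l M i) (T := T) (ord := ord)
      (x := x) (y := y) (u := u) (v := v) hk h0
      (h.forgetGood (h.x_le a) h18) (h.forgetGood (h.y_le a) h18)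
      (fun r hr s _ => hmul (h.hasDenom_x a hr) (bitGuard_within_hasDenom hjD s))
      (fun r hr s _ => hmul (h.hasDenom_y a hr) (bitGuard_within_hasDenom hjD' s))
      (fun s _ => h.nodeGuard_accepts hM (by
        -- The ignored contribution has factor 1, which is still rewritten over the denominator of
        -- a, so that all three share one denominator.
        have := hz (h.hasDenom_one a) (bitGuard_within_hasDenom_abs hjD s)
        rwa [one_mul] at this))
      (fun r hr s _ => h.nodeGuard_accepts hM
        (hz (h.hasDenom_x a hr) (bitGuard_within_hasDenom_abs hjD s)))
      (fun r hr s _ => h.nodeGuard_accepts hM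
        (hz (h.hasDenom_y a hr) (bitGuard_within_hasDenom_abs hjD' s)))
      bitGuard_within_zero hbsum
    exact ⟨bitGuard_within_mono e₂ hbsum, _, e₁⟩

theorem ShortPoint.bitLength_operations_le [Nonempty V] [Fintype I] [DecidableEq I]
    {t : List I} (h : ShortPoint x y u v l) (ht : T.IsBottomUp t) :
    ∀ step ∈ operations T t x y u v, ∀ q ∈ step.result :: step.inputs,
      bitLength q ≤ 18 * l * Fintype.card V := by
  have hM : 16 * l * Fintype.card V + 2 * l ≤ 18 * l * Fintype.card V := by
    have := Nat.mul_le_mul_left l (Fintype.card_pos (α := V))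
    nlinarith
  refine (algorithm_spec (x := x) (y := y) (u := u) (v := v)
    (Spec := fun i _ f => (nodeGuard T x y u v l (18 * l * Fintype.card V) i).within f
      (nodeGuard T x y u v l (18 * l * Fintype.card V) i).limit)
    (good := fun step => ∀ q ∈ step.result :: step.inputs,
      bitLength q ≤ 18 * l * Fintype.card V)
    -- Only the property of the operations is wanted here; a crude uniform count suffices.
    (N := 13 * 2 ^ (3 * Fintype.card V ^ 2 + Fintype.card V)) ht
    (fun i => Nat.pow_le_pow_right (by norm_num) (Finset.card_le_univ (T.bag i)))
    fun i D m hD h0 hch => ?_).2.2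
  obtain ⟨hs, N, he⟩ := h.effect_nodeStep (ord := T.vertexOrder t) hM h0 hD hch
  exact ⟨_, hs, (Interlace.effect_nodeStep
    (fun i => Finset.card_le_univ (T.bag i)) h0).and_good he⟩

end BitLength

end Interlace

open Interlace in
theorem mainTheorem1 :
    ∃ B : ℕ, ∀ c : ℕ, ∃ K : ℕ,
      ∀ (V I : Type) [Fintype V] [DecidableEq V] [Fintype I] [DecidableEq I]
        (G : LoopGraph V) (T : NiceTreeDecomposition G I) (t : List I) (k : ℕ),
        T.IsBottomUp t → T.width = k → Fintype.card I ≤ c * Fintype.card V →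
        (∀ (F : Type) [Field F] (x y : V → F) (u v : F), v ≠ 0 →
          output T t x y u v
              = MvPolynomial.aeval (evalPoint x y u v) (interlacePolynomial G) ∧
          (operations T t x y u v).length
              ≤ 2 ^ (3 * k ^ 2 + K * (k + 1)) * Fintype.card V) ∧
        (∀ (x y : V → ℚ) (u v : ℚ) (l : ℕ), v ≠ 0 →
          bitLength u ≤ l → bitLength v ≤ l →
          (∀ a, bitLength (x a) ≤ l ∧ bitLength (y a) ≤ l) →
          ∀ step ∈ operations T t x y u v, ∀ q ∈ step.result :: step.inputs,
            bitLength q ≤ B * l * Fintype.card V) := by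
  refine ⟨18, fun c => ⟨9 + c, ?_⟩⟩
  intro V I _ _ _ _ G T t k ht hw hI
  have hbag : ∀ i, (T.bag i).card ≤ k + 1 := fun i => by
    have := Finset.le_sup (f := fun i => (T.bag i).card) (Finset.mem_univ i)
    rw [TreeDecomposition.width] at hw
    omega
  -- The root is a node, so the bound on the number of nodes forces a vertex. This lets 16ln + 2l be
  -- absorbed into 18ln.
  have hV : Nonempty V := by
    refine Fintype.card_pos_iff.1 (Nat.pos_of_ne_zero fun h => ?_)
    have : 0 < Fintype.card I := Fintype.card_pos_iff.2 ⟨T.root⟩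
    rw [h] at hI
    omega
  refine ⟨fun F _ x y u v hv => ?_, fun x y u v l hv hu hvl hxy => ?_⟩
  · obtain ⟨h₁, h₂⟩ := output_and_length (x := x) (y := y) (u := u) ht hbag hv
    exact ⟨h₁, h₂.trans (count_bound hI)⟩
  · exact ShortPoint.bitLength_operations_le
      ⟨hv, hu, hvl, fun a => (hxy a).1, fun a => (hxy a).2⟩ ht
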